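/- Let $d,k\ge 1$, let $\mathcal P_2(\mathbb R^d)$ be the set of Borel probability measures on $\mathbb R^d$ with finite second moment, with the Wasserstein distance $W_2$, and let $P_k$ be the group of permutations of $\{1,\dots,k\}$. *Laplacians.* Let $\Gamma_0(m,\nu)$ be the set of $W_2$-optimal couplings of $m$ and $\nu$. A field $\zeta\in L^2(m)=L^2(\mathbb R^d,m;\mathbb R^d)$ is a subgradient of $U:\mathcal P_2(\mathbb R^d)\to\mathbb R$ at $m$ if $U[\nu]-U[m]\ge\inf_{\gamma\in\Gamma_0(m,\nu)}\int\langle\zeta(x),y-x\rangle\,\gamma(dx,dy)+o(W_2(m,\nu))$, and a supergradient if $-\zeta$ is a subgradient of $-U$ at $m$. $U$ is differentiable at $m$ if it has both a subgradient and a supergradient there; its Wasserstein gradient $\nabla_wU[m]$ is the subgradient of minimal norm, and $\zeta\cdot(U[m]):=\langle\nabla_wU[m],\zeta\rangle_m$, where $\langle\cdot,\cdot\rangle_m$ is the inner product of $L^2(m)$. Let $T_m$ be the closure of $\nabla C_c^\infty(\mathbb R^d)$ in $L^2(m)$. $U$ has a Hessian at $m$ if $U$ is differentiable near $m$, $\nu\mapsto\zeta\cdot(U[\nu])$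 is differentiable at $m$ for every $\zeta\in C_c^\infty(\mathbb R^d;\mathbb R^d)$, and $(\zeta_1,\zeta_2)\mapsto\zeta_1\cdot(\zeta_2\cdot(U[m]))-(\nabla\zeta_2\,\zeta_1)\cdot(U[m])$, $\zeta_1,\zeta_2\in\nabla C_c^\infty(\mathbb R^d)$, extends to a bounded bilinear form $\mathrm{Hess}\,U[m]$ on $T_m$. $U$ is twice differentiable at $m$ if it is differentiable near $m$, with gradients $\nabla_wU[\nu]$ represented by continuous fields satisfying $|\nabla_wU[\nu](x)|\le C(1+|x|)$ uniformly in $\nu$ near $m$, and if there are bounded Borel matrix fields $\tilde A(x)$, $A(x,a)$, a concave modulus $\rho$ and a function $\epsilon_2\ge 0$ with $\epsilon_2(t)\to0$ as $t\to0^+$ such that $$\Bigl|\nabla_wU[\nu](y)-\nabla_wU[m](x)-\tilde A(x)(y-x)-\int A(x,a)(b-a)\,\gamma(da,db)\Bigr|\le|x-y|\,\rho(|x-y|)+W_2(m,\nu)\,\epsilon_2(W_2(m,\nu))$$ for all $\nu$ near $m$, $\gamma\in\Gamma_0(m,\nu)$ and $x,y\in\mathbb R^d$. With $\zeta_i$ the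 Wasserstein gradient at $m$ of the $i$-th moment $m\mapsto\int x_i\,m(dx)$, set $$\triangle_wU[m]=\sum_{i=1}^d\mathrm{Hess}\,U[m](\zeta_i,\zeta_i),\qquad \triangle_{w,\epsilon}U[m]=\triangle_wU[m]+\epsilon\sum_{i=1}^d\int\langle\tilde A(x)\zeta_i(x),\zeta_i(x)\rangle\,m(dx).$$ Complex valued functions are treated through their real and imaginary parts. The kernel of $\triangle_w+\beta$ consists of the functions $U:\mathcal P_2(\mathbb R^d)\to\mathbb C$ that are twice differentiable and have a Hessian at every $m$ and satisfy $\triangle_wU+\beta U\equiv0$. *Polynomials.* For $\Phi:(\mathbb R^d)^k\to\mathbb C$ put $F_\Phi[m]=\frac1k\int\Phi(x_1,\dots,x_k)\,m(dx_1)\cdots m(dx_k)$. For $\xi=(\xi_1,\dots,\xi_k)\in(\mathbb R^d)^k$ let $$\Phi^k_\xi(x)=\frac1{k!}\sum_{\sigma\in P_k}\exp\Bigl(-2\pi i\sum_{j=1}^k\langle\xi_{\sigma(j)},x_j\rangle\Bigr),\quad F^k_\xi=F_{\Phi^k_\xi},\quad \lambda_k^2(\xi)=4\pi^2\Bigl|\sum_{j=1}^k\xi_j\Bigr|^2,\quad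 \widehat m(\eta)=\int e^{-2\pi i\langle\eta,z\rangle}\,m(dz).$$ Then, for all $\xi,\eta\in(\mathbb R^d)^k$ and $m\in\mathcal P_2(\mathbb R^d)$: 1. $F^k_\xi[m]=k^{-1}\prod_{j=1}^k\widehat m(\xi_j)$. 2. $F^k_\xi$ is twice differentiable and has a Hessian at $m$, and $\triangle_wF^k_\xi[m]=-\lambda_k^2(\xi)F^k_\xi[m]$. 3. For every $\epsilon\ge0$, $\triangle_{w,\epsilon}F^k_\xi[m]=-\bigl(\lambda_k^2(\xi)+4\pi^2\epsilon\sum_{j=1}^k|\xi_j|^2\bigr)F^k_\xi[m]$. 4. For every $\beta\ge0$ the kernel of $\triangle_w+\beta$ on $k$-polynomials is described by the conic surface $S_\beta=\{\xi\in(\mathbb R^d)^k:\ 4\pi^2|\sum_j\xi_j|^2=\beta\}$ modulo $P_k$, in the following sense. (a) $F^k_\xi$ lies in the kernel if and only if $\xi\in S_\beta$; and $F^k_\xi=F^k_\eta$ if and only if $\eta$ is obtained from $\xi$ by a permutation of its $k$ entries. (b) Let $\Phi:(\mathbb R^d)^k\to\mathbb C$ be symmetric and $C^2$, of at most quadratic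 growth, with $\nabla^2\Phi$ bounded and having a concave modulus of continuity. Then $F_\Phi$ lies in the kernel if and only if the tempered distribution $(\lambda_k^2-\beta)\widehat\Phi$ vanishes; in particular $\widehat\Phi$ is then supported in $S_\beta$. -/

import Mathlib

open MeasureTheory Filter Topology
open scoped ENNReal ContDiff FourierTransform SchwartzMap

noncomputable section

namespace WassersteinFourier

/-! ### The Wasserstein space -/

/-- The base space `ℝ^d` with its Euclidean structure. -/
abbrev Sp (d : ℕ) : Type := EuclideanSpace ℝ (Fin d)

/-- Borel probability measures on `ℝ^d` with finite second moment. -/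
def P2 (d : ℕ) : Type :=
  {m : Measure (Sp d) // IsProbabilityMeasure m ∧ ∫⁻ x, ‖x‖ₑ ^ 2 ∂m < ⊤}

instance {d : ℕ} (m : P2 d) : IsProbabilityMeasure m.1 := m.2.1

/-- Borel measures on `ℝ^d × ℝ^d` with marginals `m` and `ν`. -/
def couplings {d : ℕ} (m ν : P2 d) : Set (Measure (Sp d × Sp d)) :=
  {γ | γ.map Prod.fst = m.1 ∧ γ.map Prod.snd = ν.1}

/-- Quadratic transport cost `∫ |x - y|² γ(dx, dy)`. -/
def cost {d : ℕ} (γ : Measure (Sp d × Sp d)) : ℝ≥0∞ :=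
  ∫⁻ p, ‖p.1 - p.2‖ₑ ^ 2 ∂γ

/-- The Wasserstein distance `W₂`. -/
def W2 {d : ℕ} (m ν : P2 d) : ℝ :=
  Real.sqrt (⨅ γ ∈ couplings m ν, cost γ).toReal

/-- Optimal couplings: those `γ` with `∫ |x - y|² γ(dx, dy) = W₂²(m, ν)`. -/
def optimalPlans {d : ℕ} (m ν : P2 d) : Set (Measure (Sp d × Sp d)) :=
  {γ | γ ∈ couplings m ν ∧ cost γ = ENNReal.ofReal (W2 m ν ^ 2)}

/-- The inner product `∫ ⟨ζ(x), η(x)⟩ m(dx)` of `L²(m)`. -/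
def pairing {d : ℕ} (m : P2 d) (ζ η : Sp d → Sp d) : ℝ :=
  ∫ x, inner ℝ (ζ x) (η x) ∂m.1

/-! ### Wasserstein differentiability -/

/-- `ζ ∈ L²(m)` is a subgradient of `U` at `m`:
`U[ν] - U[m] ≥ inf_γ ∫ ⟨ζ(x), y - x⟩ γ(dx, dy) + o(W₂(m, ν))`,
the infimum being over the optimal couplings `γ` of `m` and `ν`. -/
def IsSubgradient {d : ℕ} (U : P2 d → ℝ) (m : P2 d) (ζ : Sp d → Sp d) : Prop :=
  MemLp ζ 2 m.1 ∧
    ∀ ε > 0, ∃ δ > 0, ∀ ν : P2 d, W2 m ν < δ →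
      (⨅ γ : optimalPlans m ν, ∫ p, inner ℝ (ζ p.1) (p.2 - p.1) ∂γ.1) - ε * W2 m ν
        ≤ U ν - U m

/-- `ζ` is a supergradient of `U` at `m` when `-ζ` is a subgradient of `-U`. -/
def IsSupergradient {d : ℕ} (U : P2 d → ℝ) (m : P2 d) (ζ : Sp d → Sp d) : Prop :=
  IsSubgradient (fun ν => -U ν) m (fun x => -ζ x)

/-- `U` is differentiable at `m`: both the sub- and the superdifferential are nonempty. -/
def WDifferentiableAt {d : ℕ} (U : P2 d → ℝ) (m : P2 d) : Prop :=
  (∃ ζ, IsSubgradient U m ζ) ∧ ∃ ζ, IsSupergradient U m ζ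

/-- `ζ` is an element of minimal `L²(m)`-norm of the subdifferential of `U` at `m`. -/
def IsWGradient {d : ℕ} (U : P2 d → ℝ) (m : P2 d) (ζ : Sp d → Sp d) : Prop :=
  IsSubgradient U m ζ ∧ ∀ η, IsSubgradient U m η → pairing m ζ ζ ≤ pairing m η η

open Classical in
/-- The Wasserstein gradient `∇_w U[m]` (a representative of a class in `L²(m)`). -/
def wGradient {d : ℕ} (U : P2 d → ℝ) (m : P2 d) : Sp d → Sp d :=
  if h : ∃ ζ, IsWGradient U m ζ then h.choose else 0

/-- The function `ν ↦ ζ · (U[ν]) = ⟨∇_w U[ν]; ζ⟩_ν`. -/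
def dirDeriv {d : ℕ} (U : P2 d → ℝ) (ζ : Sp d → Sp d) : P2 d → ℝ :=
  fun ν => pairing ν (wGradient U ν) ζ

/-! ### The Wasserstein Hessian -/

/-- `C_c^∞(ℝ^d; F)`. -/
def IsTestMap {d : ℕ} {F : Type*} [NormedAddCommGroup F] [NormedSpace ℝ F]
    (f : Sp d → F) : Prop :=
  ContDiff ℝ ∞ f ∧ HasCompactSupport f

/-- The tangent space `T_m`, the closure of `∇ C_c^∞(ℝ^d)` in `L²(m)`. -/
def tangentSpace {d : ℕ} (m : P2 d) : Submodule ℝ (Lp (Sp d) 2 m.1) :=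
  (Submodule.span ℝ
    {f : Lp (Sp d) 2 m.1 |
      ∃ φ : Sp d → ℝ, IsTestMap φ ∧ f =ᵐ[m.1] gradient φ}).topologicalClosure

/-- `ζ₁ · (ζ₂ · U[m]) - (∇ζ₂ ζ₁) · U[m]` for `ζ₁ = ∇φ`, `ζ₂ = ∇ψ`. -/
def hessBar {d : ℕ} (U : P2 d → ℝ) (m : P2 d) (φ ψ : Sp d → ℝ) : ℝ :=
  dirDeriv (dirDeriv U (gradient ψ)) (gradient φ) m
    - dirDeriv U (fun x => fderiv ℝ (gradient ψ) x (gradient φ x)) m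

/-- `H` is the Hessian of `U` at `m`: `U` is differentiable near `m`, `ν ↦ ζ · (U[ν])` is
differentiable at `m` for all `ζ ∈ C_c^∞(ℝ^d; ℝ^d)`, and `H` is a bounded bilinear form on
`T_m` that extends `hessBar`. -/
def IsWHessian {d : ℕ} (U : P2 d → ℝ) (m : P2 d)
    (H : tangentSpace m →L[ℝ] tangentSpace m →L[ℝ] ℝ) : Prop :=
  (∃ r > 0, ∀ ν : P2 d, W2 m ν < r → WDifferentiableAt U ν) ∧
  (∀ ζ : Sp d → Sp d, IsTestMap ζ → WDifferentiableAt (dirDeriv U ζ) m) ∧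
  ∀ φ ψ : Sp d → ℝ, IsTestMap φ → IsTestMap ψ →
    ∀ f g : tangentSpace m, f.1 =ᵐ[m.1] gradient φ → g.1 =ᵐ[m.1] gradient ψ →
      H f g = hessBar U m φ ψ

/-- `U` has a Hessian at `m`. -/
def HasWHessianAt {d : ℕ} (U : P2 d → ℝ) (m : P2 d) : Prop := ∃ H, IsWHessian U m H

open Classical in
/-- `Hess U[m]`, as a bilinear form on `T_m`. -/
def wHessian {d : ℕ} (U : P2 d → ℝ) (m : P2 d) :
    tangentSpace m →L[ℝ] tangentSpace m →L[ℝ] ℝ :=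
  if h : HasWHessianAt U m then h.choose else 0

/-! ### Twice differentiable functions -/

/-- A concave modulus (of continuity) on `[0, ∞)`. -/
structure IsConcaveModulus (ρ : ℝ → ℝ) : Prop where
  continuousOn : ContinuousOn ρ (Set.Ici 0)
  monotoneOn : MonotoneOn ρ (Set.Ici 0)
  subadditive : ∀ s t : ℝ, 0 ≤ s → 0 ≤ t → ρ (s + t) ≤ ρ s + ρ t
  map_zero : ρ 0 = 0
  concaveOn : ConcaveOn ℝ (Set.Ici 0) ρ

/-- `At = Ã[m]` and `Amm = A_{mm}` are bounded Borel fields giving a first order expansion of the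
Wasserstein gradient of `U` at `m`. Here `A ν` is the continuous representative, of at most
linear growth, of `∇_w U[ν]` for `ν` close to `m`. -/
def IsSecondOrderExpansion {d : ℕ} (U : P2 d → ℝ) (m : P2 d)
    (At : Sp d → (Sp d →L[ℝ] Sp d)) (Amm : Sp d → Sp d → (Sp d →L[ℝ] Sp d)) : Prop :=
  Measurable At ∧ Measurable (Function.uncurry Amm) ∧
  (∃ C : ℝ, (∀ x, ‖At x‖ ≤ C) ∧ ∀ x a, ‖Amm x a‖ ≤ C) ∧
  ∃ (A : P2 d → Sp d → Sp d) (r C : ℝ) (ρ ε₂ : ℝ → ℝ),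
    0 < r ∧ IsConcaveModulus ρ ∧ (∀ t, 0 ≤ t → 0 ≤ ε₂ t) ∧ Tendsto ε₂ (𝓝[>] 0) (𝓝 0) ∧
    ∀ ν : P2 d, W2 m ν < r →
      WDifferentiableAt U ν ∧ IsWGradient U ν (A ν) ∧ Continuous (A ν) ∧
      (∀ x, ‖A ν x‖ ≤ C * (1 + ‖x‖)) ∧
      ∀ γ ∈ optimalPlans m ν, ∀ x y : Sp d,
        ‖A ν y - A m x - (At x (y - x) + ∫ p, Amm x p.1 (p.2 - p.1) ∂γ)‖
          ≤ ‖x - y‖ * ρ ‖x - y‖ + W2 m ν * ε₂ (W2 m ν)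

/-- `U` is twice differentiable at `m`. -/
def WTwiceDifferentiableAt {d : ℕ} (U : P2 d → ℝ) (m : P2 d) : Prop :=
  ∃ At Amm, IsSecondOrderExpansion U m At Amm

open Classical in
/-- The field `Ã[m]` of a function that is twice differentiable at `m`. -/
def secondOrderLocal {d : ℕ} (U : P2 d → ℝ) (m : P2 d) : Sp d → (Sp d →L[ℝ] Sp d) :=
  if h : WTwiceDifferentiableAt U m then h.choose else 0

/-! ### The partial Laplacians -/

/-- The `i`-th moment `m ↦ ∫ x_i m(dx)`. -/
def moment {d : ℕ} (i : Fin d) (m : P2 d) : ℝ := ∫ x, x i ∂m.1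

open Classical in
/-- The element of `T_m` represented by the vector field `ζ`. -/
def toTangent {d : ℕ} (m : P2 d) (ζ : Sp d → Sp d) : tangentSpace m :=
  if h : ∃ f : tangentSpace m, f.1 =ᵐ[m.1] ζ then h.choose else 0

/-- `ζ_i`, the Wasserstein gradient at `m` of the `i`-th moment, as an element of `T_m`. -/
def momentGradient {d : ℕ} (m : P2 d) (i : Fin d) : tangentSpace m :=
  toTangent m (wGradient (moment i) m)

/-- The Wasserstein Laplacian `△_w U[m] = ∑ i, Hess U[m](ζ_i, ζ_i)`. -/
def wLaplacian {d : ℕ} (U : P2 d → ℝ) (m : P2 d) : ℝ :=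
  ∑ i : Fin d, wHessian U m (momentGradient m i) (momentGradient m i)

/-- The perturbed Laplacian `△_{w,ε} U[m]`. -/
def wLaplacianEps {d : ℕ} (ε : ℝ) (U : P2 d → ℝ) (m : P2 d) : ℝ :=
  ∑ i : Fin d, (wHessian U m (momentGradient m i) (momentGradient m i)
    + ε * ∫ x, inner ℝ (secondOrderLocal U m x ((momentGradient m i).1 x))
        ((momentGradient m i).1 x) ∂m.1)

/-- For a complex valued function: real and imaginary parts are twice differentiable at `m` and
have a Hessian at `m`. -/
def CTwiceDifferentiableAt {d : ℕ} (U : P2 d → ℂ) (m : P2 d) : Prop :=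
  (WTwiceDifferentiableAt (fun ν => (U ν).re) m ∧ HasWHessianAt (fun ν => (U ν).re) m) ∧
  (WTwiceDifferentiableAt (fun ν => (U ν).im) m ∧ HasWHessianAt (fun ν => (U ν).im) m)

/-- `△_w` on complex valued functions, by complex linearity. -/
def cLaplacian {d : ℕ} (U : P2 d → ℂ) (m : P2 d) : ℂ :=
  (wLaplacian (fun ν => (U ν).re) m : ℂ) + (wLaplacian (fun ν => (U ν).im) m : ℂ) * Complex.I

/-- `△_{w,ε}` on complex valued functions, by complex linearity. -/
def cLaplacianEps {d : ℕ} (ε : ℝ) (U : P2 d → ℂ) (m : P2 d) : ℂ :=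
  (wLaplacianEps ε (fun ν => (U ν).re) m : ℂ)
    + (wLaplacianEps ε (fun ν => (U ν).im) m : ℂ) * Complex.I

/-- The kernel of `△_w + β Id`. -/
def laplacianKernel (d : ℕ) (β : ℝ) : Set (P2 d → ℂ) :=
  {U | ∀ m, CTwiceDifferentiableAt U m ∧ cLaplacian U m + β * U m = 0}

/-! ### Polynomials on the Wasserstein space -/

/-- `(ℝ^d)^k` with the Euclidean norm `|x|² = ∑ j, |x_j|²`. -/
abbrev Mk (d k : ℕ) : Type := PiLp 2 (fun _ : Fin k => Sp d)

/-- `x^σ`, the `k`-tuple with entries `x_{σ(j)}`. -/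
def permute {d k : ℕ} (σ : Equiv.Perm (Fin k)) (x : Mk d k) : Mk d k :=
  WithLp.toLp 2 (fun j => x (σ j))

/-- `F_Φ[m] = k⁻¹ ∫ Φ(x₁, …, x_k) m(dx₁) ⋯ m(dx_k)`. -/
def polyF {d k : ℕ} (Φ : Mk d k → ℂ) (m : P2 d) : ℂ :=
  (k : ℂ)⁻¹ * ∫ x : Fin k → Sp d, Φ (WithLp.toLp 2 x) ∂(Measure.pi fun _ => m.1)

/-- Complex valued symmetric `C²` functions on `(ℝ^d)^k` of at most quadratic growth, with
bounded second derivative having a concave modulus of continuity. -/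
structure IsSymC2 {d k : ℕ} (Φ : Mk d k → ℂ) : Prop where
  contDiff : ContDiff ℝ 2 Φ
  growth : ∃ C : ℝ, ∀ x, ‖Φ x‖ ≤ C * (1 + ‖x‖ ^ 2)
  symm : ∀ (σ : Equiv.Perm (Fin k)) (x : Mk d k), Φ (permute σ x) = Φ x
  bounded : ∃ C : ℝ, ∀ x, ‖fderiv ℝ (fderiv ℝ Φ) x‖ ≤ C
  modulus : ∃ ρ : ℝ → ℝ, IsConcaveModulus ρ ∧
    ∀ x y, ‖fderiv ℝ (fderiv ℝ Φ) x - fderiv ℝ (fderiv ℝ Φ) y‖ ≤ ρ ‖x - y‖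

/-- The symmetrized exponential
`Φ^k_ξ(x) = (k!)⁻¹ ∑_σ exp(-2πi ∑ j, ⟨ξ_{σ(j)}, x_j⟩)`. -/
def symExp {d k : ℕ} (ξ : Mk d k) (x : Mk d k) : ℂ :=
  (k.factorial : ℂ)⁻¹ * ∑ σ : Equiv.Perm (Fin k),
    Complex.exp (-2 * Real.pi * Complex.I * ((∑ j, inner ℝ (ξ (σ j)) (x j) : ℝ) : ℂ))

/-- `F^k_ξ = F_Φ` for `Φ = Φ^k_ξ`. -/
def Fk {d k : ℕ} (ξ : Mk d k) : P2 d → ℂ := polyF (symExp ξ)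

/-- The Fourier transform `∫ exp(-2πi ⟨ξ, z⟩) m(dz)` of `m`. -/
def mHat {d : ℕ} (m : P2 d) (ξ : Sp d) : ℂ :=
  ∫ z, Complex.exp (-2 * Real.pi * Complex.I * ((inner ℝ ξ z : ℝ) : ℂ)) ∂m.1

/-- `λ_k²(ξ) = 4π² |∑ j, ξ_j|²`. -/
def lambdaSq {d k : ℕ} (ξ : Mk d k) : ℝ := 4 * Real.pi ^ 2 * ‖∑ j, ξ j‖ ^ 2

/-- The conic surface `{ξ : 4π² |∑ j, ξ_j|² = β}`. -/
def conicSurface (d k : ℕ) (β : ℝ) : Set (Mk d k) := {ξ | lambdaSq ξ = β}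

/-- The tempered distribution `(λ_k² - β) Φ̂` vanishes, i.e.
`∫ Φ 𝓕((λ_k² - β) φ) = 0` for all Schwartz functions `φ`. -/
def FourierAnnihilated {d k : ℕ} (β : ℝ) (Φ : Mk d k → ℂ) : Prop :=
  ∀ φ : 𝓢(Mk d k, ℂ),
    ∫ x, Φ x * 𝓕 (fun ξ : Mk d k => ((lambdaSq ξ - β : ℝ) : ℂ) * φ ξ) x = 0

/-- The tempered distribution `Φ̂` is supported in the set `S`, i.e. `∫ Φ 𝓕 φ = 0` for every
`φ ∈ C_c^∞` whose support does not meet `S`. -/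
def FourierSupportedIn {d k : ℕ} (S : Set (Mk d k)) (Φ : Mk d k → ℂ) : Prop :=
  ∀ φ : 𝓢(Mk d k, ℂ), HasCompactSupport φ → Disjoint (tsupport φ) S →
    ∫ x, Φ x * 𝓕 (fun ξ : Mk d k => φ ξ) x = 0

end WassersteinFourier

end

noncomputable section

namespace WassersteinFourier

/-! ### Couplings, the Wasserstein distance and optimal plans. -/

section

variable {d : ℕ}

/-! A `k`-polynomial can be differentiated under the integral. If `γ` is an optimal plan of `m` and
`ν`, then `γ^k` couples `m^k` and `ν^k` at cost `k W₂²`, and a Taylor expansion of `Φ` along `γ^k`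
gives the first and second order expansions of `poly Φ` (`IsC1Lin.isStrongGradient`,
`IsC2Mod.norm_gradField_expansion_le`). The coordinates are independent, so redrawing one of them
(`measurePreserving_update`) turns integrals over `γ^k` into integrals over `γ` against the fields
`gradField`, `hessLoc` and `hessNonloc`.

The definitions pick gradient, Hessian and `Ã` by choice, so each must be shown unique. For small
`t` the map `id + t∇φ` carries the only optimal plan between `m` and its image
(`exists_optimalPlans_pushP2`). Testing along such maps shows that every subgradient differs from a
strong gradient by a field orthogonal to `T_m`, and Pythagoras then singles out the tangent one. The
Hessian is determined by density of test gradients. The field `Ã[m]` is the derivative of the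
continuous representative of the gradient, which is pinned down at each point, and not only
`m`-almost everywhere, by perturbing `m` so that it charges that point
(`IsSecondOrderExpansion.local_unique`).

The gradient of the `i`-th moment is the constant `e_i`. Hence `△_w` acts on polynomials through `∑
i, D²Φ(E_i, E_i)` with `E_i = (e_i, …, e_i)`, and the `ε`-term adds the full Laplacian of `(ℝ^d)^k`.
Plane waves are eigenfunctions of both operators, and the eigenvalues depend on the frequency only
through `∑ ξ_j` and `∑ |ξ_j|²`, which permutations preserve.

For the kernel, a continuous symmetric `Ψ` vanishes once `∫ Ψ dm^k = 0` for all `m`; this is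
polarization on empirical measures (`eq_zero_of_forall_integral_pw_eq_zero`). Thus `F_Φ` lies in the
kernel exactly when `∑ i, D²Φ(E_i, E_i) + βΦ = 0`, and the Fourier transform turns this into the
vanishing of `(λ_k² - β)Φ̂`. That `F^k_ξ` determines `ξ` up to order is seen on mixtures of `δ_0`
and `δ_z`: there `F^k_ξ` is a multiple of `∏ (u + exp(-2πi⟨ξ_j, z⟩))`, and the roots of a polynomial
are determined up to order. -/

theorem coupling_isProbabilityMeasure {m ν : P2 d} {γ : Measure (Sp d × Sp d)}
    (h : γ ∈ couplings m ν) : IsProbabilityMeasure γ := by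
  constructor
  have := congrArg (fun μ => μ Set.univ) h.1
  simpa [Measure.map_apply measurable_fst MeasurableSet.univ] using this

theorem prod_mem_couplings (m ν : P2 d) : m.1.prod ν.1 ∈ couplings m ν := by
  constructor <;> simp

theorem measurePreserving_fst_coupling {m ν : P2 d} {γ : Measure (Sp d × Sp d)}
    (h : γ ∈ couplings m ν) : MeasurePreserving Prod.fst γ m.1 := ⟨measurable_fst, h.1⟩

theorem measurePreserving_snd_coupling {m ν : P2 d} {γ : Measure (Sp d × Sp d)}
    (h : γ ∈ couplings m ν) : MeasurePreserving Prod.snd γ ν.1 := ⟨measurable_snd, h.2⟩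

theorem memLp_two_of_lintegral_lt_top {α F : Type*} [MeasurableSpace α] [NormedAddCommGroup F]
    {μ : Measure α} {f : α → F} (hf : AEStronglyMeasurable f μ)
    (h : ∫⁻ x, ‖f x‖ₑ ^ 2 ∂μ < ⊤) : MemLp f 2 μ := by
  refine ⟨hf, ?_⟩
  rw [eLpNorm_lt_top_iff_lintegral_rpow_enorm_lt_top (by norm_num) (by norm_num)]
  simpa using h

theorem memLp_id (m : P2 d) : MemLp (fun x : Sp d => x) 2 m.1 :=
  memLp_two_of_lintegral_lt_top aestronglyMeasurable_id m.2.2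

theorem memLp_fst_coupling {m ν : P2 d} {γ : Measure (Sp d × Sp d)}
    (h : γ ∈ couplings m ν) : MemLp (fun p : Sp d × Sp d => p.1) 2 γ :=
  (memLp_id m).comp_measurePreserving (measurePreserving_fst_coupling h)

theorem memLp_snd_coupling {m ν : P2 d} {γ : Measure (Sp d × Sp d)}
    (h : γ ∈ couplings m ν) : MemLp (fun p : Sp d × Sp d => p.2) 2 γ :=
  (memLp_id ν).comp_measurePreserving (measurePreserving_snd_coupling h)

theorem memLp_sub_coupling {m ν : P2 d} {γ : Measure (Sp d × Sp d)}
    (h : γ ∈ couplings m ν) : MemLp (fun p : Sp d × Sp d => p.2 - p.1) 2 γ :=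
  (memLp_snd_coupling h).sub (memLp_fst_coupling h)

theorem lintegral_enorm_sq_eq_ofReal {α F : Type*} [MeasurableSpace α] [NormedAddCommGroup F]
    {μ : Measure α} {f : α → F} (hf : MemLp f 2 μ) :
    ∫⁻ x, ‖f x‖ₑ ^ 2 ∂μ = ENNReal.ofReal (∫ x, ‖f x‖ ^ 2 ∂μ) := by
  rw [ofReal_integral_eq_lintegral_ofReal ((memLp_two_iff_integrable_sq_norm hf.1).1 hf) (ae_of_all _ fun x => by positivity)]
  simp_rw [← ofReal_norm, ENNReal.ofReal_pow (norm_nonneg _)]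

theorem cost_eq_ofReal {m ν : P2 d} {γ : Measure (Sp d × Sp d)} (h : γ ∈ couplings m ν) :
    cost γ = ENNReal.ofReal (∫ p, ‖p.2 - p.1‖ ^ 2 ∂γ) := by
  rw [← lintegral_enorm_sq_eq_ofReal (memLp_sub_coupling h), cost]
  simp_rw [← ofReal_norm, norm_sub_rev]

theorem W2_nonneg (m ν : P2 d) : 0 ≤ W2 m ν := Real.sqrt_nonneg _

theorem W2_sq_le {m ν : P2 d} {γ : Measure (Sp d × Sp d)} (h : γ ∈ couplings m ν) :
    W2 m ν ^ 2 ≤ ∫ p, ‖p.2 - p.1‖ ^ 2 ∂γ := by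
  have hnn : 0 ≤ ∫ p, ‖p.2 - p.1‖ ^ 2 ∂γ := integral_nonneg fun _ => by positivity
  rw [W2, Real.sq_sqrt ENNReal.toReal_nonneg]
  refine ENNReal.toReal_le_of_le_ofReal hnn ?_
  rw [← cost_eq_ofReal h]
  exact iInf₂_le γ h

/-- `toReal` in the definition of `W2` would send an infinite infimum to `0`. The product coupling
has finite cost, so nothing is lost. -/
theorem iInf_cost_eq (m ν : P2 d) :
    (⨅ γ ∈ couplings m ν, cost γ) = ENNReal.ofReal (W2 m ν ^ 2) := by
  rw [W2, Real.sq_sqrt ENNReal.toReal_nonneg, ENNReal.ofReal_toReal]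
  have h := prod_mem_couplings m ν
  refine ne_top_of_le_ne_top ?_ (iInf₂_le _ h)
  rw [cost_eq_ofReal h]
  exact ENNReal.ofReal_ne_top

theorem integral_sq_optimalPlans {m ν : P2 d} {γ : Measure (Sp d × Sp d)}
    (h : γ ∈ optimalPlans m ν) : ∫ p, ‖p.2 - p.1‖ ^ 2 ∂γ = W2 m ν ^ 2 := by
  have h1 := h.2
  rw [cost_eq_ofReal h.1] at h1
  exact (ENNReal.ofReal_eq_ofReal_iff (integral_nonneg fun _ => by positivity)
    (by positivity)).1 h1

theorem mem_optimalPlans_iff {m ν : P2 d} {γ : Measure (Sp d × Sp d)} :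
    γ ∈ optimalPlans m ν ↔ γ ∈ couplings m ν ∧
      ∀ γ' ∈ couplings m ν, ∫ p, ‖p.2 - p.1‖ ^ 2 ∂γ ≤ ∫ p, ‖p.2 - p.1‖ ^ 2 ∂γ' := by
  refine ⟨fun h => ⟨h.1, fun γ' h' => ?_⟩, fun h => ⟨h.1, ?_⟩⟩
  · rw [integral_sq_optimalPlans h]
    exact W2_sq_le h'
  · rw [← iInf_cost_eq]
    refine le_antisymm (le_iInf₂ fun γ' h' => ?_) (iInf₂_le _ h.1)
    rw [cost_eq_ofReal h.1, cost_eq_ofReal h']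
    exact ENNReal.ofReal_le_ofReal (h.2 γ' h')

/-! ### Existence of optimal plans -/

/-- `|x - y|²` truncated at height `N`. -/
def truncatedCost (N : ℕ) : BoundedContinuousFunction (Sp d × Sp d) NNReal :=
  BoundedContinuousFunction.mkOfBound
    ⟨fun p => min (‖p.1 - p.2‖₊ ^ 2) N, by fun_prop⟩ N (by
      intro x y
      rw [NNReal.dist_eq, abs_le]
      have h1 : ((min (‖x.1 - x.2‖₊ ^ 2) (N : NNReal) : NNReal) : ℝ) ≤ N := by
        exact_mod_cast min_le_right (‖x.1 - x.2‖₊ ^ (2 : ℕ)) (N : NNReal)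
      have h2 : ((min (‖y.1 - y.2‖₊ ^ 2) (N : NNReal) : NNReal) : ℝ) ≤ N := by
        exact_mod_cast min_le_right (‖y.1 - y.2‖₊ ^ (2 : ℕ)) (N : NNReal)
      have h3 := (min (‖x.1 - x.2‖₊ ^ 2) (N : NNReal)).coe_nonneg
      have h4 := (min (‖y.1 - y.2‖₊ ^ 2) (N : NNReal)).coe_nonneg
      simp only [ContinuousMap.coe_mk]
      constructor <;> linarith)

theorem cost_eq_iSup (γ : Measure (Sp d × Sp d)) :
    cost γ = ⨆ N : ℕ, ∫⁻ p, (truncatedCost N p : ℝ≥0∞) ∂γ := by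
  rw [← lintegral_iSup]
  · unfold cost
    congr 1 with p
    refine le_antisymm ?_ (iSup_le fun N => ?_)
    · obtain ⟨N, hN⟩ := exists_nat_ge (‖p.1 - p.2‖₊ ^ 2)
      refine le_iSup_of_le N ?_
      have : truncatedCost N p = ‖p.1 - p.2‖₊ ^ 2 := min_eq_left hN
      rw [this]
      simp [enorm]
    · have : truncatedCost N p ≤ ‖p.1 - p.2‖₊ ^ 2 := min_le_left _ _
      calc (truncatedCost N p : ℝ≥0∞) ≤ ((‖p.1 - p.2‖₊ ^ 2 : NNReal) : ℝ≥0∞) := by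
            exact_mod_cast this
        _ = _ := by simp [enorm]
  · intro N
    exact (truncatedCost N).continuous.measurable.coe_nnreal_ennreal
  · intro N M h p
    have : truncatedCost N p ≤ truncatedCost M p :=
      min_le_min le_rfl (by exact_mod_cast h)
    exact ENNReal.coe_le_coe.2 this

/-- Weak convergence only tests bounded continuous functions. The truncations are such functions,
and the cost is the supremum of their integrals by monotone convergence. -/
theorem lowerSemicontinuous_cost :
    LowerSemicontinuous fun γ : ProbabilityMeasure (Sp d × Sp d) =>
      cost (γ : Measure (Sp d × Sp d)) := by
  simp_rw [cost_eq_iSup]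
  refine lowerSemicontinuous_iSup fun N => Continuous.lowerSemicontinuous ?_
  have h := ProbabilityMeasure.continuous_testAgainstNN_eval (Ω := Sp d × Sp d) (truncatedCost N)
  have h2 := ENNReal.continuous_coe.comp h
  refine h2.congr fun γ => ?_
  exact FiniteMeasure.testAgainstNN_coe_eq

theorem isTightMeasureSet_couplings (m ν : P2 d) :
    IsTightMeasureSet (couplings m ν) := by
  rw [isTightMeasureSet_iff_exists_isCompact_measure_compl_le]
  intro ε hε
  have hε2 : 0 < ε / 2 := ENNReal.half_pos hε.ne'
  obtain ⟨K, hK, hKm⟩ := isTightMeasureSet_iff_exists_isCompact_measure_compl_le.1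
    (isTightMeasureSet_singleton (μ := m.1)) _ hε2
  obtain ⟨L, hL, hLm⟩ := isTightMeasureSet_iff_exists_isCompact_measure_compl_le.1
    (isTightMeasureSet_singleton (μ := ν.1)) _ hε2
  refine ⟨K ×ˢ L, hK.prod hL, fun γ hγ => ?_⟩
  have : (K ×ˢ L)ᶜ ⊆ (Prod.fst ⁻¹' Kᶜ) ∪ (Prod.snd ⁻¹' Lᶜ) := by
    intro p hp
    simp only [Set.mem_compl_iff, Set.mem_prod, not_and_or] at hp
    exact hp
  calc γ (K ×ˢ L)ᶜ ≤ γ (Prod.fst ⁻¹' Kᶜ) + γ (Prod.snd ⁻¹' Lᶜ) :=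
        (measure_mono this).trans (measure_union_le _ _)
    _ = m.1 Kᶜ + ν.1 Lᶜ := by
        rw [← hγ.1, ← hγ.2, Measure.map_apply measurable_fst hK.measurableSet.compl,
          Measure.map_apply measurable_snd hL.measurableSet.compl]
    _ ≤ ε / 2 + ε / 2 := add_le_add (hKm _ rfl) (hLm _ rfl)
    _ = ε := ENNReal.add_halves ε

/-- Direct method: the couplings form a weakly closed tight set, compact by Prokhorov, on which a
lower semicontinuous cost attains its minimum. -/
theorem optimalPlans_nonempty (m ν : P2 d) : (optimalPlans m ν).Nonempty := by
  let m' : ProbabilityMeasure (Sp d) := ⟨m.1, inferInstance⟩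
  let ν' : ProbabilityMeasure (Sp d) := ⟨ν.1, inferInstance⟩
  let S : Set (ProbabilityMeasure (Sp d × Sp d)) := {γ | (γ : Measure _) ∈ couplings m ν}
  have hS : IsClosed S := by
    have h1 : S = {γ | γ.map measurable_fst.aemeasurable = m'} ∩
        {γ | γ.map measurable_snd.aemeasurable = ν'} := by
      ext γ
      simp only [S, couplings, Set.mem_ofPred_eq, Set.mem_inter_iff]
      refine and_congr ⟨fun h => Subtype.ext h, fun h => congrArg Subtype.val h⟩
        ⟨fun h => Subtype.ext h, fun h => congrArg Subtype.val h⟩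
    rw [h1]
    exact (isClosed_eq (ProbabilityMeasure.continuous_map continuous_fst) continuous_const).inter
      (isClosed_eq (ProbabilityMeasure.continuous_map continuous_snd) continuous_const)
  have hc : IsCompact S := by
    have := isCompact_closure_of_isTightMeasureSet (S := S)
      ((isTightMeasureSet_couplings m ν).subset (by rintro _ ⟨μ, hμ, rfl⟩; exact hμ))
    rwa [hS.closure_eq] at this
  have hne : S.Nonempty := ⟨⟨m.1.prod ν.1, inferInstance⟩, prod_mem_couplings m ν⟩
  obtain ⟨γ, hγ, hmin⟩ := (lowerSemicontinuous_cost.lowerSemicontinuousOn S).exists_isMinOn hne hc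
  refine ⟨γ, hγ, ?_⟩
  rw [← iInf_cost_eq]
  refine le_antisymm (le_iInf₂ fun γ' h' => ?_) (iInf₂_le (γ : Measure (Sp d × Sp d)) hγ)
  exact hmin (show (⟨γ', coupling_isProbabilityMeasure h'⟩ : ProbabilityMeasure _) ∈ S from h')

/-- Keeps the real infimum in `IsSubgradient` from being the default value `0` of an empty family.
-/
instance (m ν : P2 d) : Nonempty (optimalPlans m ν) := (optimalPlans_nonempty m ν).to_subtype

end

/-! ### Plans given by maps, mixtures with a Dirac mass, small gradient perturbations. -/

section

variable {d : ℕ}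

theorem map_id_prod_mem_couplings {m ν : P2 d} {T : Sp d → Sp d} (hT : Measurable T)
    (hν : m.1.map T = ν.1) : m.1.map (fun x => (x, T x)) ∈ couplings m ν := by
  constructor
  · rw [Measure.map_map measurable_fst (by fun_prop)]
    exact Measure.map_id
  · rw [Measure.map_map measurable_snd (by fun_prop), ← hν]
    rfl

theorem W2_self (m : P2 d) : W2 m m = 0 := by
  have h := W2_sq_le (map_id_prod_mem_couplings (m := m) (ν := m) measurable_id Measure.map_id)
  rw [integral_map (by fun_prop) (by fun_prop)] at h
  simp at h
  exact h

/-- Zero cost concentrates the plan on the diagonal. This removes the nonlocal term from a second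
order expansion when `ν = m`. -/
theorem ae_eq_of_mem_optimalPlans_self {m : P2 d} {γ : Measure (Sp d × Sp d)}
    (h : γ ∈ optimalPlans m m) : ∀ᵐ p ∂γ, p.2 - p.1 = 0 := by
  have h1 := integral_sq_optimalPlans h
  rw [W2_self, zero_pow two_ne_zero, integral_eq_zero_iff_of_nonneg (fun _ => by positivity)
    ((memLp_two_iff_integrable_sq_norm (memLp_sub_coupling h.1).1).1 (memLp_sub_coupling h.1))]
    at h1
  · filter_upwards [h1] with p hp
    simpa using hp

/-- The mixture `(1 - s) m + s δ_y`. -/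
def mixDirac (m : P2 d) (y : Sp d) (s : ℝ) (hs : s ∈ Set.Icc (0 : ℝ) 1) : P2 d :=
  ⟨ENNReal.ofReal (1 - s) • m.1 + ENNReal.ofReal s • Measure.dirac y, by
    constructor
    · constructor
      simp only [Measure.coe_add, Measure.coe_smul, Pi.add_apply, Pi.smul_apply, measure_univ,
        smul_eq_mul, mul_one]
      rw [← ENNReal.ofReal_add (by linarith [hs.2]) hs.1]
      simp
    · rw [lintegral_add_measure, lintegral_smul_measure, lintegral_smul_measure, lintegral_dirac]
      simp only [smul_eq_mul]
      exact ENNReal.add_lt_top.2 ⟨ENNReal.mul_lt_top ENNReal.ofReal_lt_top m.2.2,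
        ENNReal.mul_lt_top ENNReal.ofReal_lt_top (ENNReal.pow_lt_top enorm_lt_top)⟩⟩

/-- The competitor leaves the fraction `1 - s` of the mass in place and sends the fraction `s` to
`y`. -/
theorem W2_mixDirac_sq_le (m : P2 d) (y : Sp d) (s : ℝ) (hs : s ∈ Set.Icc (0 : ℝ) 1) :
    W2 m (mixDirac m y s hs) ^ 2 ≤ s * ∫ x, ‖y - x‖ ^ 2 ∂m.1 := by
  set γ : Measure (Sp d × Sp d) := ENNReal.ofReal (1 - s) • m.1.map (fun x => (x, x)) +
    ENNReal.ofReal s • m.1.map (fun x => (x, y)) with hγ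
  have hmem : γ ∈ couplings m (mixDirac m y s hs) := by
    constructor
    · rw [hγ, Measure.map_add _ _ measurable_fst, Measure.map_smul, Measure.map_smul,
        Measure.map_map measurable_fst (by fun_prop), Measure.map_map measurable_fst (by fun_prop)]
      change ENNReal.ofReal (1 - s) • m.1.map id + ENNReal.ofReal s • m.1.map id = _
      rw [Measure.map_id, ← add_smul, ← ENNReal.ofReal_add (by linarith [hs.2]) hs.1]
      simp
    · rw [hγ, Measure.map_add _ _ measurable_snd, Measure.map_smul, Measure.map_smul,
        Measure.map_map measurable_snd (by fun_prop), Measure.map_map measurable_snd (by fun_prop)]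
      change ENNReal.ofReal (1 - s) • m.1.map id + ENNReal.ofReal s • m.1.map (fun _ => y) = _
      rw [Measure.map_id, Measure.map_const]
      simp [mixDirac]
  refine (W2_sq_le hmem).trans (le_of_eq ?_)
  have hint : Integrable (fun x : Sp d => ‖y - x‖ ^ 2) m.1 :=
    (memLp_two_iff_integrable_sq_norm (by fun_prop)).1 ((memLp_const y).sub (memLp_id m))
  have hc : Continuous (fun p : Sp d × Sp d => ‖p.2 - p.1‖ ^ 2) := by fun_prop
  have h1 : Integrable (fun p : Sp d × Sp d => ‖p.2 - p.1‖ ^ 2) (m.1.map (fun x => (x, x))) := by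
    rw [integrable_map_measure hc.aestronglyMeasurable (by fun_prop)]
    simp [Function.comp_def]
  have h2 : Integrable (fun p : Sp d × Sp d => ‖p.2 - p.1‖ ^ 2) (m.1.map (fun x => (x, y))) := by
    rw [integrable_map_measure hc.aestronglyMeasurable (by fun_prop)]
    exact hint
  rw [hγ, integral_add_measure (h1.smul_measure ENNReal.ofReal_ne_top)
    (h2.smul_measure ENNReal.ofReal_ne_top), integral_smul_measure, integral_smul_measure,
    integral_map (by fun_prop) hc.aestronglyMeasurable,
    integral_map (by fun_prop) hc.aestronglyMeasurable, ENNReal.toReal_ofReal hs.1]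
  simp

/-- The mixture has an atom at `y`, so an almost sure statement holds at `y` itself. -/
theorem mixDirac_ae {m : P2 d} {y : Sp d} {s : ℝ} {hs : s ∈ Set.Icc (0 : ℝ) 1} (h0 : 0 < s)
    {p : Sp d → Prop} (h : ∀ᵐ x ∂(mixDirac m y s hs).1, p x) : p y := by
  have h1 : ∀ᵐ x ∂(ENNReal.ofReal s • Measure.dirac y : Measure (Sp d)), p x :=
    (Measure.absolutelyContinuous_of_le (Measure.le_add_left le_rfl)).ae_le h
  rw [ae_iff, Measure.smul_apply, smul_eq_mul, mul_eq_zero, ENNReal.ofReal_eq_zero] at h1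
  have h2 : Measure.dirac y {x | ¬ p x} = 0 := h1.resolve_left (not_le.2 h0)
  by_contra h3
  have h4 : Set.indicator {x | ¬ p x} 1 y ≤ Measure.dirac y {x | ¬ p x} := Measure.le_dirac_apply
  rw [h2, Set.indicator_of_mem h3] at h4
  simp at h4

/-! ### Transport along the gradient of a test function -/

theorem isTestMap_gradient {φ : Sp d → ℝ} (h : IsTestMap φ) : IsTestMap (gradient φ) := by
  have h1 : ContDiff ℝ ∞ (fderiv ℝ φ) := h.1.fderiv_right (by simp)
  have h2 : gradient φ = fun x => (InnerProductSpace.toDual ℝ (Sp d)).symm (fderiv ℝ φ x) := rfl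
  refine ⟨?_, ?_⟩
  · let L : StrongDual ℝ (Sp d) →L[ℝ] Sp d :=
      ((InnerProductSpace.toDual ℝ (Sp d)).symm.toLinearEquiv.toLinearMap :
        StrongDual ℝ (Sp d) →ₗ[ℝ] Sp d).toContinuousLinearMap
    exact L.contDiff.comp h1
  · exact (h.2.fderiv ℝ).comp_left (map_zero _)

theorem IsTestMap.exists_lipschitz {F : Type*} [NormedAddCommGroup F] [NormedSpace ℝ F]
    {g : Sp d → F} (h : IsTestMap g) : ∃ L : ℝ, 0 ≤ L ∧ ∀ x y, ‖g x - g y‖ ≤ L * ‖x - y‖ := by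
  obtain ⟨C, hC⟩ := (h.1.of_le (by simp : (1 : ℕ∞ω) ≤ ((⊤ : ℕ∞) : ℕ∞ω))).lipschitzWith_of_hasCompactSupport
    h.2 one_ne_zero
  exact ⟨C, C.2, fun x y => by simpa [dist_eq_norm] using hC.dist_le_mul x y⟩

theorem IsTestMap.exists_bound {F : Type*} [NormedAddCommGroup F] [NormedSpace ℝ F]
    {g : Sp d → F} (h : IsTestMap g) : ∃ C : ℝ, 0 ≤ C ∧ ∀ x, ‖g x‖ ≤ C := by
  obtain ⟨C, hC⟩ := h.2.exists_bound_of_continuous h.1.continuous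
  exact ⟨C, (norm_nonneg _).trans (hC 0), hC⟩

theorem IsTestMap.memLp {F : Type*} [NormedAddCommGroup F] [NormedSpace ℝ F]
    {g : Sp d → F} (h : IsTestMap g) (m : P2 d) : MemLp g 2 m.1 := by
  obtain ⟨C, -, hC⟩ := h.exists_bound
  exact MemLp.of_bound (h.1.continuous.aestronglyMeasurable) C (ae_of_all _ hC)

theorem inner_gradient_eq_fderiv {V : Type*} [NormedAddCommGroup V] [InnerProductSpace ℝ V]
    [CompleteSpace V] (φ : V → ℝ) (x v : V) : inner ℝ (gradient φ x) v = fderiv ℝ φ x v := by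
  simp [gradient]

/-- Taylor bound for a function whose gradient is Lipschitz. -/
theorem abs_sub_sub_inner_gradient_le {V : Type*} [NormedAddCommGroup V] [InnerProductSpace ℝ V]
    [CompleteSpace V] {φ : V → ℝ} (hφ : Differentiable ℝ φ) {K : ℝ} (x y : V)
    (hL : ∀ z ∈ segment ℝ x y, ‖gradient φ z - gradient φ x‖ ≤ K) :
    |φ y - φ x - inner ℝ (gradient φ x) (y - x)| ≤ K * ‖y - x‖ := by
  have h := (convex_segment x y).norm_image_sub_le_of_norm_fderiv_le' (𝕜 := ℝ) (f := φ)
    (φ := fderiv ℝ φ x) (C := K) (fun z _ => hφ z) (fun z hz => ?_)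
    (left_mem_segment ℝ x y) (right_mem_segment ℝ x y)
  · rwa [inner_gradient_eq_fderiv, ← Real.norm_eq_abs]
  · refine le_trans (le_of_eq ?_) (hL z hz)
    simp only [gradient]
    rw [← map_sub, LinearIsometryEquiv.norm_map]

theorem norm_sub_le_of_mem_segment {V : Type*} [NormedAddCommGroup V] [NormedSpace ℝ V]
    {x y z : V} (h : z ∈ segment ℝ x y) : ‖z - x‖ ≤ ‖y - x‖ := by
  rw [segment_eq_image'] at h
  obtain ⟨θ, hθ, rfl⟩ := h
  simp only [add_sub_cancel_left, norm_smul, Real.norm_eq_abs, abs_of_nonneg hθ.1]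
  exact mul_le_of_le_one_left (norm_nonneg _) hθ.2

/-- Push-forward of `m` under `id + t g` for bounded continuous `g`. -/
def pushP2 (m : P2 d) (g : Sp d → Sp d) (hg : IsTestMap g) (t : ℝ) : P2 d :=
  ⟨m.1.map (fun x => x + t • g x), by
    have hm : Measurable (fun x => x + t • g x) := by
      have := hg.1.continuous.measurable
      fun_prop
    constructor
    · exact Measure.isProbabilityMeasure_map hm.aemeasurable
    · rw [lintegral_map (by fun_prop) hm]
      have h1 : MemLp (fun x => x + t • g x) 2 m.1 :=
        (memLp_id m).add ((hg.memLp m).const_smul t)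
      rw [lintegral_enorm_sq_eq_ofReal h1]
      exact ENNReal.ofReal_lt_top⟩

/-- For small `t` the map `id + t∇φ` is the gradient of the uniformly convex function `|x|²/2 +
tφ(x)`. The potential `2tφ` certifies optimality as in Kantorovich duality, and the leftover
quadratic term in `key` forces uniqueness. -/
theorem exists_optimalPlans_pushP2 (m : P2 d) {φ : Sp d → ℝ} (hφ : IsTestMap φ) :
    ∃ t₀ > 0, ∀ t : ℝ, |t| ≤ t₀ →
      optimalPlans m (pushP2 m (gradient φ) (isTestMap_gradient hφ) t) =
        {m.1.map (fun x => (x, x + t • gradient φ x))} := by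
  obtain ⟨L, hL0, hL⟩ := (isTestMap_gradient hφ).exists_lipschitz
  have hgc : Continuous (gradient φ) := (isTestMap_gradient hφ).1.continuous
  -- The bound makes `t∇φ` Lipschitz with constant at most `1/4`: `T` is injective, and the Taylor
  -- error of `2tφ` uses only half of `‖x - z‖²`.
  refine ⟨1 / (4 * (L + 1)), by positivity, fun t ht => ?_⟩
  have htL : |t| * L ≤ 1 / 4 := by
    calc |t| * L ≤ 1 / (4 * (L + 1)) * (L + 1) := by gcongr; linarith
      _ = 1 / 4 := by field_simp
  set T : Sp d → Sp d := fun x => x + t • gradient φ x with hT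
  have hTc : Continuous T := by fun_prop
  have hcoup : m.1.map (fun x => (x, T x)) ∈ couplings m (pushP2 m (gradient φ) (isTestMap_gradient hφ) t) :=
    map_id_prod_mem_couplings hTc.measurable rfl
  have hinj : Function.Injective T := by
    intro x y hxy
    have h1 : x - y = t • (gradient φ y - gradient φ x) := by
      have : x + t • gradient φ x = y + t • gradient φ y := hxy
      rw [smul_sub, sub_eq_sub_iff_add_eq_add, this, add_comm]
    have h2 : ‖x - y‖ ≤ 1 / 4 * ‖x - y‖ := by
      calc ‖x - y‖ = |t| * ‖gradient φ y - gradient φ x‖ := by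
            rw [h1, norm_smul, Real.norm_eq_abs]
        _ ≤ |t| * (L * ‖x - y‖) := by gcongr; rw [norm_sub_rev]; exact hL x y
        _ = |t| * L * ‖x - y‖ := by ring
        _ ≤ _ := by gcongr
    have h3 : ‖x - y‖ = 0 := by linarith [norm_nonneg (x - y)]
    exact sub_eq_zero.1 (norm_eq_zero.1 h3)
  have hemb : MeasurableEmbedding T := hTc.measurableEmbedding hinj
  set S : Sp d → Sp d := hemb.invFun with hS
  have hSm : Measurable S := hemb.measurable_invFun
  have hST : ∀ x, S (T x) = x := hemb.leftInverse_invFun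
  -- Expand `‖(T z - z) - (x - z)‖²` and replace the cross term `2t⟨∇φ(z), x - z⟩` by `2t(φ x - φ
  -- z)`, at an error of at most `‖x - z‖² / 2`.
  have key : ∀ x z, ‖z - T z‖ ^ 2 - 2 * t * φ x + 2 * t * φ z + 1 / 2 * ‖x - z‖ ^ 2
      ≤ ‖T z - x‖ ^ 2 := by
    intro x z
    have h1 : |φ x - φ z - inner ℝ (gradient φ z) (x - z)| ≤ L * ‖x - z‖ * ‖x - z‖ := by
      refine abs_sub_sub_inner_gradient_le (hφ.1.differentiable (by simp)) z x fun w hw => ?_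
      exact (hL w z).trans (by gcongr; exact norm_sub_le_of_mem_segment hw)
    have h2 : |t * (φ x - φ z - inner ℝ (gradient φ z) (x - z))| ≤ 1 / 4 * ‖x - z‖ ^ 2 := by
      rw [abs_mul]
      calc _ ≤ |t| * (L * ‖x - z‖ * ‖x - z‖) := by gcongr
        _ = |t| * L * ‖x - z‖ ^ 2 := by ring
        _ ≤ _ := by gcongr
    have h3 := (abs_le.1 h2).1
    have h4 : T z - x = (T z - z) - (x - z) := by abel
    have h5 : T z - z = t • gradient φ z := by simp [hT]
    rw [norm_sub_rev z (T z), h4, norm_sub_sq_real (T z - z) (x - z), h5, real_inner_smul_left]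
    linarith
  have hν : (pushP2 m (gradient φ) (isTestMap_gradient hφ) t).1 = m.1.map T := rfl
  set ν := pushP2 m (gradient φ) (isTestMap_gradient hφ) t
  -- Integrate `key` at `x = p.1`, `z = S p.2`. Both have law `m`, so the potential terms cancel,
  -- and the excess cost of `γ` controls its distance from the graph of `T`.
  have hmain : ∀ γ ∈ couplings m ν, ∫ p, ‖p.2 - p.1‖ ^ 2 ∂(m.1.map (fun x => (x, T x)))
      + 1 / 2 * ∫ p, ‖p.1 - S p.2‖ ^ 2 ∂γ ≤ ∫ p, ‖p.2 - p.1‖ ^ 2 ∂γ ∧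
      Integrable (fun p : Sp d × Sp d => ‖p.1 - S p.2‖ ^ 2) γ ∧ ∀ᵐ p ∂γ, T (S p.2) = p.2 := by
    intro γ hγ
    have hpγ := coupling_isProbabilityMeasure hγ
    -- `S` is only a left inverse of `T`; it is also a right inverse on the range of `T`, which
    -- carries `ν`.
    have hTS : ∀ᵐ p ∂γ, T (S p.2) = p.2 := by
      have h1 : ∀ᵐ y ∂ν.1, T (S y) = y := by
        rw [hν, ae_map_iff hTc.measurable.aemeasurable]
        · exact ae_of_all _ fun x => by rw [hST]
        · exact measurableSet_eq_fun (hTc.measurable.comp hSm) measurable_id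
      exact (measurePreserving_snd_coupling hγ).quasiMeasurePreserving.ae h1
    have hpS : MeasurePreserving (fun p : Sp d × Sp d => S p.2) γ m.1 := by
      have h1 : MeasurePreserving S ν.1 m.1 := by
        refine ⟨hSm, ?_⟩
        rw [hν, Measure.map_map hSm hTc.measurable]
        have : S ∘ T = id := funext hST
        rw [this, Measure.map_id]
      exact h1.comp (measurePreserving_snd_coupling hγ)
    have hmS : MemLp (fun p : Sp d × Sp d => p.1 - S p.2) 2 γ :=
      (memLp_fst_coupling hγ).sub ((memLp_id m).comp_measurePreserving hpS)
    have hiS := (memLp_two_iff_integrable_sq_norm hmS.1).1 hmS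
    have hi := (memLp_two_iff_integrable_sq_norm (memLp_sub_coupling hγ).1).1
      (memLp_sub_coupling hγ)
    obtain ⟨C, -, hC⟩ := hφ.exists_bound
    have hφi : Integrable φ m.1 := ((hφ.memLp m).integrable (by norm_num))
    have hφ1 : Integrable (fun p : Sp d × Sp d => φ p.1) γ :=
      (measurePreserving_fst_coupling hγ).integrable_comp_of_integrable hφi
    have hφ2 : Integrable (fun p : Sp d × Sp d => φ (S p.2)) γ :=
      hpS.integrable_comp_of_integrable hφi
    have hTi : Integrable (fun z => ‖z - T z‖ ^ 2) m.1 := by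
      have h1 : MemLp (fun z => z - T z) 2 m.1 := by
        have := ((isTestMap_gradient hφ).memLp m).const_smul (-t)
        refine this.congr_norm (by fun_prop) (ae_of_all _ fun x => ?_)
        simp [hT]
      exact (memLp_two_iff_integrable_sq_norm h1.1).1 h1
    have hT2 : Integrable (fun p : Sp d × Sp d => ‖S p.2 - T (S p.2)‖ ^ 2) γ :=
      hpS.integrable_comp_of_integrable hTi
    refine ⟨?_, hiS, hTS⟩
    have e1 : ∫ p, φ p.1 ∂γ = ∫ x, φ x ∂m.1 := by
      rw [← (measurePreserving_fst_coupling hγ).map_eq,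
        integral_map (by fun_prop) hφ.1.continuous.aestronglyMeasurable]
    have e2 : ∫ p, φ (S p.2) ∂γ = ∫ x, φ x ∂m.1 := by
      rw [← hpS.map_eq,
        integral_map hpS.measurable.aemeasurable hφ.1.continuous.aestronglyMeasurable]
    have e3 : ∫ p, ‖S p.2 - T (S p.2)‖ ^ 2 ∂γ = ∫ x, ‖x - T x‖ ^ 2 ∂m.1 := by
      rw [← hpS.map_eq, integral_map hpS.measurable.aemeasurable
        (Continuous.aestronglyMeasurable (by fun_prop))]
    have e4 : ∫ p, ‖p.2 - p.1‖ ^ 2 ∂(m.1.map (fun x => (x, T x))) = ∫ x, ‖x - T x‖ ^ 2 ∂m.1 := by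
      rw [integral_map (by fun_prop) (Continuous.aestronglyMeasurable (by fun_prop))]
      simp_rw [norm_sub_rev]
    have hle : ∫ p, (‖S p.2 - T (S p.2)‖ ^ 2 - 2 * t * φ p.1 + 2 * t * φ (S p.2)
        + 1 / 2 * ‖p.1 - S p.2‖ ^ 2) ∂γ ≤ ∫ p, ‖p.2 - p.1‖ ^ 2 ∂γ := by
      refine integral_mono_ae ?_ hi ?_
      · exact ((hT2.sub (hφ1.const_mul _)).add (hφ2.const_mul _)).add (hiS.const_mul _)
      · filter_upwards [hTS] with p hp
        have := key p.1 (S p.2)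
        rw [hp] at this ⊢
        exact this
    have i1 : Integrable (fun p : Sp d × Sp d => ‖S p.2 - T (S p.2)‖ ^ 2 - 2 * t * φ p.1) γ :=
      hT2.sub (hφ1.const_mul _)
    have i2 : Integrable (fun p : Sp d × Sp d => ‖S p.2 - T (S p.2)‖ ^ 2 - 2 * t * φ p.1
      + 2 * t * φ (S p.2)) γ := i1.add (hφ2.const_mul _)
    rw [integral_add i2 (hiS.const_mul _), integral_add i1 (hφ2.const_mul _),
      integral_sub hT2 (hφ1.const_mul _), integral_const_mul, integral_const_mul,
      integral_const_mul, e1, e2, e3] at hle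
    rw [e4]
    linarith
  have hopt : m.1.map (fun x => (x, T x)) ∈ optimalPlans m ν := by
    refine mem_optimalPlans_iff.2 ⟨hcoup, fun γ' hγ' => ?_⟩
    have h1 := (hmain γ' hγ').1
    have h2 : 0 ≤ ∫ p, ‖p.1 - S p.2‖ ^ 2 ∂γ' := integral_nonneg fun _ => by positivity
    linarith
  refine Set.eq_singleton_iff_unique_mem.2 ⟨hopt, fun γ hγ => ?_⟩
  obtain ⟨h1, h2, h3⟩ := hmain γ hγ.1
  have h4 : ∫ p, ‖p.1 - S p.2‖ ^ 2 ∂γ = 0 := by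
    have h5 := (mem_optimalPlans_iff.1 hγ).2 _ hcoup
    have h6 : 0 ≤ ∫ p, ‖p.1 - S p.2‖ ^ 2 ∂γ := integral_nonneg fun _ => by positivity
    linarith
  rw [integral_eq_zero_iff_of_nonneg (fun _ => by positivity) h2] at h4
  -- An optimal plan has no excess cost, so its first coordinate is `S` of the second; such a plan
  -- is determined by `ν`.
  have h5 : (fun p => p) =ᵐ[γ] (fun p : Sp d × Sp d => (S p.2, p.2)) := by
    filter_upwards [h4] with p hp
    have : p.1 - S p.2 = 0 := by simpa using hp
    exact Prod.ext (sub_eq_zero.1 this) rfl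
  calc γ = γ.map (fun p => p) := Measure.map_id.symm
    _ = γ.map (fun p => (S p.2, p.2)) := Measure.map_congr h5
    _ = ν.1.map (fun y => (S y, y)) := by
        rw [← hγ.1.2, Measure.map_map (by fun_prop) measurable_snd]
        rfl
    _ = m.1.map (fun x => (x, T x)) := by
        rw [hν, Measure.map_map (by fun_prop) hTc.measurable]
        congr 1 with x
        · simp [hST]
        · simp

end

/-! ### Strong gradients, and uniqueness of the Wasserstein gradient. -/

section

variable {d : ℕ}

/-- First order expansion of `U` at `m` along all optimal plans, with `L²(m)` gradient `ζ`. -/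
def IsStrongGradient (U : P2 d → ℝ) (m : P2 d) (ζ : Sp d → Sp d) : Prop :=
  MemLp ζ 2 m.1 ∧ ∀ ε > 0, ∃ δ > 0, ∀ ν : P2 d, W2 m ν < δ → ∀ γ ∈ optimalPlans m ν,
    |U ν - U m - ∫ p, inner ℝ (ζ p.1) (p.2 - p.1) ∂γ| ≤ ε * W2 m ν

/-- Cauchy–Schwarz for norms of square integrable functions. -/
theorem integral_norm_mul_norm_le {α F G : Type*} [MeasurableSpace α] [NormedAddCommGroup F]
    [NormedAddCommGroup G] {μ : Measure α} {f : α → F} {g : α → G} (hf : MemLp f 2 μ)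
    (hg : MemLp g 2 μ) :
    ∫ x, ‖f x‖ * ‖g x‖ ∂μ ≤ √(∫ x, ‖f x‖ ^ 2 ∂μ) * √(∫ x, ‖g x‖ ^ 2 ∂μ) := by
  have h := integral_mul_norm_le_Lp_mul_Lq (μ := μ) (f := fun x => ‖f x‖) (g := fun x => ‖g x‖)
    (Real.HolderConjugate.two_two) (by simpa using hf.norm) (by simpa using hg.norm)
  simpa [Real.sqrt_eq_rpow] using h

theorem integrable_norm_mul_norm {α F G : Type*} [MeasurableSpace α] [NormedAddCommGroup F]
    [NormedAddCommGroup G] {μ : Measure α} {f : α → F} {g : α → G} (hf : MemLp f 2 μ)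
    (hg : MemLp g 2 μ) : Integrable (fun x => ‖f x‖ * ‖g x‖) μ :=
  hf.norm.integrable_mul hg.norm

theorem abs_integral_inner_le {α F : Type*} [MeasurableSpace α] [NormedAddCommGroup F]
    [InnerProductSpace ℝ F] {μ : Measure α} {f g : α → F} (hf : MemLp f 2 μ)
    (hg : MemLp g 2 μ) :
    |∫ x, inner ℝ (f x) (g x) ∂μ| ≤ √(∫ x, ‖f x‖ ^ 2 ∂μ) * √(∫ x, ‖g x‖ ^ 2 ∂μ) := by
  refine le_trans ?_ (integral_norm_mul_norm_le hf hg)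
  rw [← Real.norm_eq_abs]
  exact norm_integral_le_of_norm_le (integrable_norm_mul_norm hf hg)
    (ae_of_all _ fun x => norm_inner_le_norm _ _)

theorem integrable_inner_of_memLp {α F : Type*} [MeasurableSpace α] [NormedAddCommGroup F]
    [InnerProductSpace ℝ F] {μ : Measure α} {f g : α → F} (hf : MemLp f 2 μ)
    (hg : MemLp g 2 μ) : Integrable (fun x => inner ℝ (f x) (g x)) μ :=
  (integrable_norm_mul_norm hf hg).mono (hf.1.inner hg.1)
    (ae_of_all _ fun x => by simpa using abs_real_inner_le_norm (f x) (g x))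

/-- By Cauchy–Schwarz the pairing along any optimal plan is at least `-‖ζ‖ W₂`. The real infimum
over plans is then a genuine one, so it lies below each of its terms. -/
theorem bddBelow_range_optimalPlans {m ν : P2 d} {ζ : Sp d → Sp d} (hζ : MemLp ζ 2 m.1) :
    BddBelow (Set.range fun γ : optimalPlans m ν =>
      ∫ p, inner ℝ (ζ p.1) (p.2 - p.1) ∂γ.1) := by
  refine ⟨-(√(∫ x, ‖ζ x‖ ^ 2 ∂m.1) * W2 m ν), ?_⟩
  rintro _ ⟨γ, rfl⟩
  have h1 : MemLp (fun p : Sp d × Sp d => ζ p.1) 2 γ.1 :=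
    hζ.comp_measurePreserving (measurePreserving_fst_coupling γ.2.1)
  have h2 := abs_integral_inner_le h1 (memLp_sub_coupling γ.2.1)
  rw [integral_sq_optimalPlans γ.2, Real.sqrt_sq (W2_nonneg _ _)] at h2
  have h3 : ∫ p, ‖ζ p.1‖ ^ 2 ∂γ.1 = ∫ x, ‖ζ x‖ ^ 2 ∂m.1 := by
    have hm := measurePreserving_fst_coupling γ.2.1
    rw [← hm.map_eq, integral_map hm.measurable.aemeasurable]
    rw [hm.map_eq]
    exact (hζ.1.norm.pow 2)
  rw [h3] at h2
  exact (abs_le.1 h2).1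

theorem IsStrongGradient.isSubgradient {U : P2 d → ℝ} {m : P2 d} {ζ : Sp d → Sp d}
    (h : IsStrongGradient U m ζ) : IsSubgradient U m ζ := by
  refine ⟨h.1, fun ε hε => ?_⟩
  obtain ⟨δ, hδ, H⟩ := h.2 ε hε
  refine ⟨δ, hδ, fun ν hν => ?_⟩
  obtain ⟨γ, hγ⟩ := optimalPlans_nonempty m ν
  have h1 := (abs_le.1 (H ν hν γ hγ)).1
  have h2 := ciInf_le (bddBelow_range_optimalPlans (ν := ν) h.1) ⟨γ, hγ⟩
  simp only at h2
  linarith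

theorem IsStrongGradient.neg {U : P2 d → ℝ} {m : P2 d} {ζ : Sp d → Sp d}
    (h : IsStrongGradient U m ζ) : IsStrongGradient (fun ν => -U ν) m (fun x => -ζ x) := by
  refine ⟨h.1.neg, fun ε hε => ?_⟩
  obtain ⟨δ, hδ, H⟩ := h.2 ε hε
  refine ⟨δ, hδ, fun ν hν γ hγ => ?_⟩
  have h1 := H ν hν γ hγ
  simp_rw [inner_neg_left, integral_neg]
  rw [← abs_neg]
  convert h1 using 2
  ring

theorem IsStrongGradient.wDifferentiableAt {U : P2 d → ℝ} {m : P2 d} {ζ : Sp d → Sp d}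
    (h : IsStrongGradient U m ζ) : WDifferentiableAt U m :=
  ⟨⟨ζ, h.isSubgradient⟩, ⟨ζ, h.neg.isSubgradient⟩⟩

/-- Move `m` along `id + t∇φ`. The optimal plan is unique, so the infimum for `η` is a single value,
and comparing it with the expansion by `ζ` gives `t⟨η - ζ, ∇φ⟩ ≤ o(|t|)`. Both signs of `t` are
allowed, so the pairing vanishes. -/
theorem IsStrongGradient.pairing_sub_gradient_eq_zero {U : P2 d → ℝ} {m : P2 d}
    {ζ η : Sp d → Sp d} (h : IsStrongGradient U m ζ) (hη : IsSubgradient U m η)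
    {φ : Sp d → ℝ} (hφ : IsTestMap φ) : ∫ x, inner ℝ (η x - ζ x) (gradient φ x) ∂m.1 = 0 := by
  obtain ⟨t₀, ht₀, ht⟩ := exists_optimalPlans_pushP2 m hφ
  have hg := (isTestMap_gradient hφ).memLp m
  have hgc := (isTestMap_gradient hφ).1.continuous
  set I := ∫ x, inner ℝ (η x - ζ x) (gradient φ x) ∂m.1 with hI
  set N := √(∫ x, ‖gradient φ x‖ ^ 2 ∂m.1) with hN
  have hN0 : 0 ≤ N := Real.sqrt_nonneg _
  set ν : ℝ → P2 d := pushP2 m (gradient φ) (isTestMap_gradient hφ) with hν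
  have hW : ∀ t, |t| ≤ t₀ → W2 m (ν t) = |t| * N := by
    intro t h1
    have h2 : m.1.map (fun x => (x, x + t • gradient φ x)) ∈ optimalPlans m (ν t) := by
      rw [ht t h1]
      rfl
    have h3 := integral_sq_optimalPlans h2
    rw [integral_map (by fun_prop) (Continuous.aestronglyMeasurable (by fun_prop))] at h3
    simp only [add_sub_cancel_left, norm_smul, mul_pow, Real.norm_eq_abs] at h3
    rw [integral_const_mul] at h3
    rw [← Real.sqrt_sq (W2_nonneg m (ν t)), ← h3, Real.sqrt_mul (by positivity),
      Real.sqrt_sq (abs_nonneg t)]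
  have hpair : ∀ (ξ : Sp d → Sp d), MemLp ξ 2 m.1 → ∀ t : ℝ,
      ∫ p, inner ℝ (ξ p.1) (p.2 - p.1) ∂(m.1.map (fun x => (x, x + t • gradient φ x)))
        = t * ∫ x, inner ℝ (ξ x) (gradient φ x) ∂m.1 := by
    intro ξ hξ t
    have hmp : MeasurePreserving Prod.fst (m.1.map (fun x => (x, x + t • gradient φ x))) m.1 := by
      refine ⟨measurable_fst, ?_⟩
      rw [Measure.map_map measurable_fst (by fun_prop)]
      exact Measure.map_id
    rw [integral_map (by fun_prop)]
    · simp only [add_sub_cancel_left, inner_smul_right]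
      rw [integral_const_mul]
    · exact ((hξ.comp_measurePreserving hmp).1).inner
        (Continuous.aestronglyMeasurable (by fun_prop))
  have hle : ∀ ε > 0, |I| ≤ 2 * ε * N := by
    intro ε hε
    obtain ⟨δ₁, hδ₁, H₁⟩ := h.2 ε hε
    obtain ⟨δ₂, hδ₂, H₂⟩ := hη.2 ε hε
    -- Keeps `s` within the range of uniqueness of the plan, and `W2 m (ν (±s)) = s * N` below both
    -- radii.
    set s := min t₀ (min δ₁ δ₂ / (2 * (N + 1))) with hs
    have hs0 : 0 < s := by positivity
    have hst : ∀ t, |t| = s → t * I ≤ 2 * ε * (s * N) := by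
      intro t hts
      have h1 : |t| ≤ t₀ := hts ▸ min_le_left _ _
      have h2 : W2 m (ν t) < min δ₁ δ₂ := by
        rw [hW t h1, hts]
        calc s * N ≤ min δ₁ δ₂ / (2 * (N + 1)) * (N + 1) := by
              gcongr
              · exact min_le_right _ _
              · linarith
          _ = min δ₁ δ₂ / 2 := by field_simp
          _ < _ := half_lt_self (by positivity)
      have h3 : m.1.map (fun x => (x, x + t • gradient φ x)) ∈ optimalPlans m (ν t) := by
        rw [ht t h1]
        rfl
      have h4 := (abs_le.1 (H₁ _ (h2.trans_le (min_le_left _ _)) _ h3)).2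
      have h5 := H₂ _ (h2.trans_le (min_le_right _ _))
      have h6 : (⨅ γ : optimalPlans m (ν t), ∫ p, inner ℝ (η p.1) (p.2 - p.1) ∂γ.1)
          = ∫ p, inner ℝ (η p.1) (p.2 - p.1)
            ∂(m.1.map (fun x => (x, x + t • gradient φ x))) := by
        have : ∀ γ : optimalPlans m (ν t), ∫ p, inner ℝ (η p.1) (p.2 - p.1) ∂γ.1 =
            ∫ p, inner ℝ (η p.1) (p.2 - p.1)
              ∂(m.1.map (fun x => (x, x + t • gradient φ x))) := by
          intro γ
          rw [Set.mem_singleton_iff.1 ((ht t h1).subset γ.2)]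
        rw [iInf_congr this, ciInf_const]
      rw [h6, hpair η hη.1] at h5
      rw [hpair ζ h.1] at h4
      have h8 : I = ∫ x, inner ℝ (η x) (gradient φ x) ∂m.1
          - ∫ x, inner ℝ (ζ x) (gradient φ x) ∂m.1 := by
        rw [hI, ← integral_sub (integrable_inner_of_memLp hη.1 hg)
          (integrable_inner_of_memLp h.1 hg)]
        simp_rw [inner_sub_left]
      rw [hW t h1, hts] at h4 h5
      rw [h8]
      linarith
    have h1 := hst s (abs_of_pos hs0)
    have h2 := hst (-s) (by rw [abs_neg, abs_of_pos hs0])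
    have h3 : s * |I| ≤ s * (2 * ε * N) := by
      rcases abs_cases I with ⟨h, -⟩ | ⟨h, -⟩ <;> rw [h] <;> linarith
    exact le_of_mul_le_mul_left h3 hs0
  by_contra hne
  have hpos : 0 < |I| := abs_pos.2 hne
  have h1 := hle (|I| / (4 * (N + 1))) (by positivity)
  have h2 : 2 * (|I| / (4 * (N + 1))) * N ≤ |I| / 2 := by
    calc _ ≤ 2 * (|I| / (4 * (N + 1))) * (N + 1) := by gcongr; linarith
      _ = |I| / 2 := by field_simp; norm_num
  linarith

/-- `ζ` represents an element of `T_m`. -/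
def IsTangentField (m : P2 d) (ζ : Sp d → Sp d) : Prop := ∃ f : tangentSpace m, f.1 =ᵐ[m.1] ζ

/-- The orthogonal complement of a single field is a closed subspace; once it contains all test
gradients it contains `T_m`. -/
theorem inner_eq_zero_of_mem_tangentSpace {m : P2 d} {ξ : Sp d → Sp d} (hξ : MemLp ξ 2 m.1)
    (h : ∀ φ : Sp d → ℝ, IsTestMap φ → ∫ x, inner ℝ (ξ x) (gradient φ x) ∂m.1 = 0)
    {ζ : Sp d → Sp d} (hζ : IsTangentField m ζ) : ∫ x, inner ℝ (ξ x) (ζ x) ∂m.1 = 0 := by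
  obtain ⟨f, hf⟩ := hζ
  let e : Lp (Sp d) 2 m.1 := hξ.toLp ξ
  have h1 : tangentSpace m ≤ (Submodule.span ℝ {e})ᗮ := by
    refine Submodule.topologicalClosure_minimal _ (Submodule.span_le.2 ?_)
      (Submodule.isClosed_orthogonal _)
    rintro g ⟨φ, hφ, hg⟩
    rw [SetLike.mem_coe, Submodule.mem_orthogonal_singleton_iff_inner_right, L2.inner_def,
      ← h φ hφ]
    refine integral_congr_ae ?_
    filter_upwards [hg, hξ.coeFn_toLp] with x hx hx'
    rw [hx, hx']
  have h2 := Submodule.mem_orthogonal_singleton_iff_inner_right.1 (h1 f.2)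
  rw [L2.inner_def] at h2
  rw [← h2]
  refine integral_congr_ae ?_
  filter_upwards [hf, hξ.coeFn_toLp] with x hx hx'
  rw [hx, hx']

theorem IsTangentField.memLp {m : P2 d} {ζ : Sp d → Sp d} (h : IsTangentField m ζ) :
    MemLp ζ 2 m.1 := by
  obtain ⟨f, hf⟩ := h
  exact (memLp_congr_ae hf).1 (Lp.memLp _)

/-- Pythagoras: `η - ζ` is orthogonal to `T_m`, which contains `ζ`. Both the minimality of `ζ` and
its almost everywhere uniqueness among minimizers are read off from this identity. -/
theorem IsStrongGradient.pairing_eq {U : P2 d → ℝ} {m : P2 d} {ζ η : Sp d → Sp d}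
    (h : IsStrongGradient U m ζ) (hT : IsTangentField m ζ) (hη : IsSubgradient U m η) :
    pairing m η η = pairing m ζ ζ + ∫ x, ‖η x - ζ x‖ ^ 2 ∂m.1 := by
  have h1 := inner_eq_zero_of_mem_tangentSpace (hη.1.sub h.1)
    (fun φ hφ => h.pairing_sub_gradient_eq_zero hη hφ) hT
  have h2 : ∀ x, inner ℝ (η x) (η x) =
      (inner ℝ (ζ x) (ζ x) + ‖η x - ζ x‖ ^ 2) + 2 * inner ℝ (η x - ζ x) (ζ x) := by
    intro x
    rw [real_inner_self_eq_norm_sq, real_inner_self_eq_norm_sq, norm_sub_sq_real, inner_sub_left,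
      real_inner_self_eq_norm_sq]
    ring
  have i1 := integrable_inner_of_memLp h.1 h.1
  have i2 : Integrable (fun x => ‖η x - ζ x‖ ^ 2) m.1 :=
    (memLp_two_iff_integrable_sq_norm (hη.1.sub h.1).1).1 (hη.1.sub h.1)
  have i3 : Integrable (fun x => inner ℝ (ζ x) (ζ x) + ‖η x - ζ x‖ ^ 2) m.1 := i1.add i2
  have i4 : Integrable (fun x => inner ℝ (η x - ζ x) (ζ x)) m.1 :=
    integrable_inner_of_memLp (hη.1.sub h.1) h.1
  have h1' : ∫ x, inner ℝ (η x - ζ x) (ζ x) ∂m.1 = 0 := h1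
  unfold pairing
  simp_rw [h2]
  rw [integral_add i3 (i4.const_mul _), integral_add i1 i2, integral_const_mul, h1']
  ring

theorem IsStrongGradient.isWGradient {U : P2 d → ℝ} {m : P2 d} {ζ : Sp d → Sp d}
    (h : IsStrongGradient U m ζ) (hT : IsTangentField m ζ) : IsWGradient U m ζ := by
  refine ⟨h.isSubgradient, fun η hη => ?_⟩
  rw [h.pairing_eq hT hη]
  exact le_add_of_nonneg_right (integral_nonneg fun _ => by positivity)

theorem IsStrongGradient.ae_eq_of_isWGradient {U : P2 d → ℝ} {m : P2 d} {ζ η : Sp d → Sp d}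
    (h : IsStrongGradient U m ζ) (hT : IsTangentField m ζ) (hη : IsWGradient U m η) :
    η =ᵐ[m.1] ζ := by
  have h1 := hη.2 ζ h.isSubgradient
  rw [h.pairing_eq hT hη.1] at h1
  have h2 : ∫ x, ‖η x - ζ x‖ ^ 2 ∂m.1 = 0 :=
    le_antisymm (by linarith) (integral_nonneg fun _ => by positivity)
  have i1 : Integrable (fun x => ‖η x - ζ x‖ ^ 2) m.1 :=
    (memLp_two_iff_integrable_sq_norm (hη.1.1.sub h.1).1).1 (hη.1.1.sub h.1)
  rw [integral_eq_zero_iff_of_nonneg (fun _ => by positivity) i1] at h2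
  filter_upwards [h2] with x hx
  have : ‖η x - ζ x‖ ^ 2 = 0 := hx
  exact sub_eq_zero.1 (norm_eq_zero.1 (pow_eq_zero_iff two_ne_zero |>.1 this))

theorem IsStrongGradient.wGradient_ae_eq {U : P2 d → ℝ} {m : P2 d} {ζ : Sp d → Sp d}
    (h : IsStrongGradient U m ζ) (hT : IsTangentField m ζ) : wGradient U m =ᵐ[m.1] ζ := by
  have hex : ∃ η, IsWGradient U m η := ⟨ζ, h.isWGradient hT⟩
  refine h.ae_eq_of_isWGradient hT ?_
  rw [wGradient, dif_pos hex]
  exact hex.choose_spec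

/-- Replaces the chosen `wGradient` by an explicit field; all later computations of derivatives rest
on it. -/
theorem IsStrongGradient.dirDeriv_eq {U : P2 d → ℝ} {m : P2 d} {ζ : Sp d → Sp d}
    (h : IsStrongGradient U m ζ) (hT : IsTangentField m ζ) (η : Sp d → Sp d) :
    dirDeriv U η m = pairing m ζ η := by
  refine integral_congr_ae ?_
  filter_upwards [h.wGradient_ae_eq hT] with x hx
  rw [hx]

end

/-! ### Gradients of linear growth are tangent fields. -/

section

/-- `C¹` functions with gradient of at most linear growth. -/
structure IsC1Lin {V : Type*} [NormedAddCommGroup V] [InnerProductSpace ℝ V] [CompleteSpace V]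
    (Φ : V → ℝ) : Prop where
  contDiff : ContDiff ℝ 1 Φ
  growth : ∃ C, 0 ≤ C ∧ ∀ x, ‖gradient Φ x‖ ≤ C * (1 + ‖x‖)

section

variable {V : Type*} [NormedAddCommGroup V] [InnerProductSpace ℝ V] [CompleteSpace V] {Φ : V → ℝ}

theorem IsC1Lin.differentiable (h : IsC1Lin Φ) : Differentiable ℝ Φ :=
  h.contDiff.differentiable one_ne_zero

theorem continuous_gradient_of_contDiff (h : ContDiff ℝ 1 Φ) : Continuous (gradient Φ) :=
  (InnerProductSpace.toDual ℝ V).symm.continuous.comp (h.continuous_fderiv one_ne_zero)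

theorem IsC1Lin.continuous_gradient (h : IsC1Lin Φ) : Continuous (gradient Φ) :=
  continuous_gradient_of_contDiff h.contDiff

theorem IsC1Lin.exists_norm_le (h : IsC1Lin Φ) :
    ∃ D, 0 ≤ D ∧ ∀ x, |Φ x| ≤ D * (1 + ‖x‖ ^ 2) := by
  obtain ⟨C, hC, hg⟩ := h.growth
  refine ⟨|Φ 0| + 4 * C, by positivity, fun x => ?_⟩
  have h1 : |Φ x - Φ 0 - inner ℝ (gradient Φ 0) (x - 0)| ≤ (C * (1 + ‖x‖) + C) * ‖x - 0‖ := by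
    refine abs_sub_sub_inner_gradient_le h.differentiable 0 x fun z hz => ?_
    have h2 := norm_sub_le_of_mem_segment hz
    simp only [sub_zero] at h2
    calc ‖gradient Φ z - gradient Φ 0‖ ≤ ‖gradient Φ z‖ + ‖gradient Φ 0‖ := norm_sub_le _ _
      _ ≤ C * (1 + ‖z‖) + C * (1 + ‖(0 : V)‖) := add_le_add (hg z) (hg 0)
      _ ≤ C * (1 + ‖x‖) + C := by rw [norm_zero, add_zero, mul_one]; gcongr
  have h3 : |inner ℝ (gradient Φ 0) x| ≤ C * ‖x‖ := by
    refine (abs_real_inner_le_norm _ _).trans ?_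
    gcongr
    simpa using hg 0
  rw [sub_zero] at h1
  have h4 := abs_le.1 h1
  have h5 := abs_le.1 h3
  have h6 : ‖x‖ ≤ 1 + ‖x‖ ^ 2 := by nlinarith [sq_nonneg (‖x‖ - 1), norm_nonneg x]
  have h7 : (C * (1 + ‖x‖) + C) * ‖x‖ + C * ‖x‖ ≤ 4 * C * (1 + ‖x‖ ^ 2) := by
    nlinarith [norm_nonneg x]
  have h8 : |Φ 0| ≤ |Φ 0| * (1 + ‖x‖ ^ 2) := le_mul_of_one_le_right (abs_nonneg _)
    (by nlinarith [norm_nonneg x])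
  rw [add_mul]
  exact abs_le.2 ⟨by linarith [neg_abs_le (Φ 0)], by linarith [le_abs_self (Φ 0)]⟩

end

variable {d : ℕ}

theorem IsTestMap.isTangentField_gradient {φ : Sp d → ℝ} (h : IsTestMap φ) (m : P2 d) :
    IsTangentField m (gradient φ) := by
  have hm := (isTestMap_gradient h).memLp m
  refine ⟨⟨hm.toLp _, Submodule.le_topologicalClosure _ (Submodule.subset_span
    ⟨φ, h, hm.coeFn_toLp⟩)⟩, hm.coeFn_toLp⟩

theorem norm_sq_eq_integral {α F : Type*} [MeasurableSpace α] [NormedAddCommGroup F]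
    [InnerProductSpace ℝ F] {μ : Measure α} (f : Lp F 2 μ) : ‖f‖ ^ 2 = ∫ x, ‖f x‖ ^ 2 ∂μ := by
  rw [← real_inner_self_eq_norm_sq, L2.inner_def]
  simp_rw [real_inner_self_eq_norm_sq]

theorem isTangentField_of_approx {m : P2 d} {g : Sp d → Sp d} (hg : MemLp g 2 m.1)
    (h : ∀ ε > 0, ∃ η, IsTangentField m η ∧ ∫ x, ‖g x - η x‖ ^ 2 ∂m.1 ≤ ε ^ 2) :
    IsTangentField m g := by
  refine ⟨⟨hg.toLp g, ?_⟩, hg.coeFn_toLp⟩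
  have hcl : IsClosed (tangentSpace m : Set (Lp (Sp d) 2 m.1)) :=
    Submodule.isClosed_topologicalClosure _
  rw [← SetLike.mem_coe, ← hcl.closure_eq, Metric.mem_closure_iff]
  intro ε hε
  obtain ⟨η, ⟨f, hf⟩, hle⟩ := h (ε / 2) (by positivity)
  refine ⟨f.1, f.2, ?_⟩
  have h1 : ‖hg.toLp g - f.1‖ ^ 2 ≤ (ε / 2) ^ 2 := by
    rw [norm_sq_eq_integral]
    refine le_trans (le_of_eq (integral_congr_ae ?_)) hle
    filter_upwards [Lp.coeFn_sub (hg.toLp g) f.1, hg.coeFn_toLp, hf] with x h1 h2 h3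
    rw [h1, Pi.sub_apply, h2, h3]
  rw [dist_eq_norm]
  have h2 := abs_le_of_sq_le_sq h1 (by positivity)
  rw [abs_norm] at h2
  linarith

/-- Mollify `f`. The derivative of the mollification is the mollification of `fderiv ℝ f`, and the
latter is uniformly continuous because it has compact support. -/
theorem abs_le_of_hasCompactSupport_convolution {f : Sp d → ℝ} (hf : ContDiff ℝ 1 f)
    (hc : HasCompactSupport f) {ε : ℝ} (hε : 0 < ε) :
    ∃ φ : Sp d → ℝ, IsTestMap φ ∧ ∀ x, ‖gradient f x - gradient φ x‖ ≤ ε := by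
  have huc : UniformContinuous (fderiv ℝ f) :=
    (hf.continuous_fderiv one_ne_zero).uniformContinuous_of_tendsto_cocompact
      (hc.fderiv ℝ).is_zero_at_infty
  obtain ⟨δ, hδ, H⟩ := Metric.uniformContinuous_iff.1 huc ε hε
  let b : ContDiffBump (0 : Sp d) := ⟨δ / 2, δ, by positivity, by linarith⟩
  let φ : Sp d → ℝ := convolution (b.normed volume) f (ContinuousLinearMap.lsmul ℝ ℝ) volume
  have hbi : LocallyIntegrable (b.normed volume) volume :=
    (b.contDiff_normed (n := 1)).continuous.locallyIntegrable
  have hd : ∀ x, HasFDerivAt φ (convolution (b.normed volume) (fderiv ℝ f)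
      (ContinuousLinearMap.lsmul ℝ ℝ) volume x) x := by
    intro x
    have h1 := hc.hasFDerivAt_convolution_right (ContinuousLinearMap.lsmul ℝ ℝ) hbi hf x
    refine h1.congr_fderiv (integral_congr_ae (ae_of_all _ fun t => ?_))
    ext v
    simp [ContinuousLinearMap.precompR_apply]
  refine ⟨φ, ⟨?_, ?_⟩, fun x => ?_⟩
  · exact b.hasCompactSupport_normed.contDiff_convolution_left _ b.contDiff_normed
      hf.continuous.locallyIntegrable
  · exact b.hasCompactSupport_normed.convolution _ hc
  · simp only [gradient]
    rw [← map_sub, LinearIsometryEquiv.norm_map, (hd x).fderiv, ← dist_eq_norm, dist_comm]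
    refine b.dist_normed_convolution_le
      (hf.continuous_fderiv one_ne_zero).aestronglyMeasurable fun y hy => ?_
    exact (H (Metric.mem_ball.1 hy)).le

theorem isTangentField_gradient_of_hasCompactSupport {f : Sp d → ℝ} (hf : ContDiff ℝ 1 f)
    (hc : HasCompactSupport f) (m : P2 d) : IsTangentField m (gradient f) := by
  have hgc : HasCompactSupport (gradient f) := (hc.fderiv ℝ).comp_left (map_zero _)
  obtain ⟨C, hC⟩ := hgc.exists_bound_of_continuous (continuous_gradient_of_contDiff hf)
  refine isTangentField_of_approx (MemLp.of_bound (continuous_gradient_of_contDiff hf).aestronglyMeasurable C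
    (ae_of_all _ hC)) fun ε hε => ?_
  obtain ⟨φ, hφ, hle⟩ := abs_le_of_hasCompactSupport_convolution hf hc hε
  refine ⟨gradient φ, hφ.isTangentField_gradient m, ?_⟩
  have h1 : ∫ x, ‖gradient f x - gradient φ x‖ ^ 2 ∂m.1 ≤ ∫ _, ε ^ 2 ∂m.1 := by
    refine integral_mono_of_nonneg (ae_of_all _ fun _ => by positivity) (integrable_const _)
      (ae_of_all _ fun x => ?_)
    have := hle x
    simp only
    gcongr
  simpa using h1

theorem memLp_of_linear_growth {m : P2 d} {F : Type*} [NormedAddCommGroup F] {g : Sp d → F}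
    (hg : AEStronglyMeasurable g m.1) {C : ℝ} (h : ∀ x, ‖g x‖ ≤ C * (1 + ‖x‖)) :
    MemLp g 2 m.1 :=
  MemLp.of_le_mul ((memLp_const (1 : ℝ)).add (memLp_id m).norm) hg
    (ae_of_all _ fun x => (h x).trans (le_of_eq (by
      simp only [Pi.add_apply, Real.norm_eq_abs]
      rw [abs_of_nonneg (by positivity)])))

/-- Cut `f` off by `b(x/R)`. The error term `R⁻¹ f(x) ∇b(x/R)` lives where `‖x‖ ≤ 2R`, and there the
quadratic growth of `f` divided by `R` is at most linear in `‖x‖`. Thus the errors are dominated by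
a square integrable function, and at each point they vanish for large `R`. -/
theorem IsC1Lin.isTangentField_gradient {f : Sp d → ℝ} (h : IsC1Lin f) (m : P2 d) :
    IsTangentField m (gradient f) := by
  obtain ⟨C, hC0, hC⟩ := h.growth
  obtain ⟨D, hD0, hD⟩ := h.exists_norm_le
  let b : ContDiffBump (0 : Sp d) := ⟨1, 2, by norm_num, by norm_num⟩
  have hb1 : ContDiff ℝ 1 b := b.contDiff
  obtain ⟨B, hB⟩ := (b.hasCompactSupport.fderiv ℝ).exists_bound_of_continuous
    (hb1.continuous_fderiv one_ne_zero)
  have hB0 : 0 ≤ B := (norm_nonneg _).trans (hB 0)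
  set R : ℕ → ℝ := fun n => n + 1 with hR
  have hR1 : ∀ n, 1 ≤ R n := fun n => by simp [hR]
  have hR0 : ∀ n, 0 < R n := fun n => by linarith [hR1 n]
  set F : ℕ → Sp d → ℝ := fun n x => b ((R n)⁻¹ • x) * f x with hF
  have hbn : ∀ n x, HasFDerivAt (fun x : Sp d => b ((R n)⁻¹ • x))
      ((R n)⁻¹ • fderiv ℝ b ((R n)⁻¹ • x)) x := by
    intro n x
    have h1 : HasFDerivAt (fun x : Sp d => (R n)⁻¹ • x)
        ((R n)⁻¹ • ContinuousLinearMap.id ℝ (Sp d)) x :=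
      ((R n)⁻¹ • ContinuousLinearMap.id ℝ (Sp d)).hasFDerivAt
    have h2 := ((hb1.differentiable one_ne_zero ((R n)⁻¹ • x)).hasFDerivAt).comp x h1
    refine h2.congr_fderiv ?_
    ext v
    simp
  have hFd : ∀ n x, HasFDerivAt (F n) (b ((R n)⁻¹ • x) • fderiv ℝ f x +
      f x • ((R n)⁻¹ • fderiv ℝ b ((R n)⁻¹ • x))) x := fun n x =>
    (hbn n x).mul (h.differentiable x).hasFDerivAt
  have hFc : ∀ n, ContDiff ℝ 1 (F n) := fun n =>
    (hb1.comp (contDiff_const_smul _)).mul h.contDiff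
  have hFs : ∀ n, HasCompactSupport (F n) := by
    intro n
    have h1 : HasCompactSupport (fun x : Sp d => b ((R n)⁻¹ • x)) :=
      b.hasCompactSupport.comp_smul (inv_ne_zero (hR0 n).ne')
    exact h1.mul_right
  have hdiff : ∀ n x, ‖gradient f x - gradient (F n) x‖ =
      ‖(1 - b ((R n)⁻¹ • x)) • fderiv ℝ f x - f x • ((R n)⁻¹ • fderiv ℝ b ((R n)⁻¹ • x))‖ := by
    intro n x
    simp only [gradient]
    rw [← map_sub, LinearIsometryEquiv.norm_map, (hFd n x).fderiv, sub_smul, one_smul]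
    congr 1
    abel
  have hzero : ∀ x, ∀ᶠ n in atTop, ‖gradient f x - gradient (F n) x‖ = 0 := by
    intro x
    obtain ⟨N, hN⟩ := exists_nat_gt ‖x‖
    filter_upwards [eventually_ge_atTop N] with n hn
    have hx : (R n)⁻¹ • x ∈ Metric.ball (0 : Sp d) 1 := by
      rw [mem_ball_zero_iff, norm_smul, norm_inv, Real.norm_eq_abs, abs_of_pos (hR0 n),
        inv_mul_lt_iff₀ (hR0 n), mul_one]
      have : (N : ℝ) ≤ n := by exact_mod_cast hn
      simp only [hR]
      linarith
    have h1 : (b : Sp d → ℝ) =ᶠ[𝓝 ((R n)⁻¹ • x)] fun _ => 1 := by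
      filter_upwards [Metric.isOpen_ball.mem_nhds hx] with y hy
      exact b.one_of_mem_closedBall (Metric.ball_subset_closedBall hy)
    rw [hdiff, h1.fderiv_eq, h1.eq_of_nhds]
    simp
  have hbound : ∀ n x, ‖gradient f x - gradient (F n) x‖ ≤ (C + 6 * B * D) * (1 + ‖x‖) := by
    intro n x
    have h1 : ‖(1 - b ((R n)⁻¹ • x)) • fderiv ℝ f x‖ ≤ C * (1 + ‖x‖) := by
      rw [norm_smul, Real.norm_eq_abs, abs_of_nonneg (by linarith [b.le_one (x := (R n)⁻¹ • x)])]
      have h2 : ‖fderiv ℝ f x‖ = ‖gradient f x‖ := by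
        simp only [gradient, LinearIsometryEquiv.norm_map]
      rw [h2]
      refine (mul_le_of_le_one_left (norm_nonneg _) ?_).trans (hC x)
      linarith [b.nonneg (x := (R n)⁻¹ • x)]
    have h2 : ‖f x • ((R n)⁻¹ • fderiv ℝ b ((R n)⁻¹ • x))‖ ≤ 6 * B * D * (1 + ‖x‖) := by
      by_cases hx : ‖x‖ ≤ 2 * R n
      · rw [norm_smul, norm_smul, norm_inv, Real.norm_eq_abs, Real.norm_eq_abs,
          abs_of_pos (hR0 n)]
        -- From `1 ≤ R` and `‖x‖ ≤ 2R` one gets `1 + ‖x‖² ≤ R + 2R‖x‖`.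
        have h3 : (R n)⁻¹ * (1 + ‖x‖ ^ 2) ≤ 3 * (1 + ‖x‖) := by
          rw [inv_mul_le_iff₀ (hR0 n)]
          nlinarith [hR1 n, norm_nonneg x, mul_nonneg (norm_nonneg x) (sub_nonneg.2 hx)]
        calc |f x| * ((R n)⁻¹ * ‖fderiv ℝ b ((R n)⁻¹ • x)‖)
            ≤ (D * (1 + ‖x‖ ^ 2)) * ((R n)⁻¹ * B) := by
              have := (hR0 n).le
              gcongr
              · exact hD x
              · exact hB _
          _ = B * D * ((R n)⁻¹ * (1 + ‖x‖ ^ 2)) := by ring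
          _ ≤ B * D * (3 * (1 + ‖x‖)) := by gcongr
          _ ≤ _ := by nlinarith [mul_nonneg (mul_nonneg hB0 hD0) (norm_nonneg x),
            mul_nonneg hB0 hD0]
      · have h3 : (R n)⁻¹ • x ∉ tsupport b := by
          rw [b.tsupport_eq, mem_closedBall_zero_iff, norm_smul, norm_inv, Real.norm_eq_abs,
            abs_of_pos (hR0 n), inv_mul_le_iff₀ (hR0 n)]
          intro h4
          exact hx (by linarith [h4, (show b.rOut = 2 from rfl), (show R n * b.rOut = R n * 2 from rfl)])
        have h4 : fderiv ℝ b ((R n)⁻¹ • x) = 0 := by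
          have : (R n)⁻¹ • x ∉ Function.support (fderiv ℝ b) := fun h5 =>
            h3 (support_fderiv_subset ℝ h5)
          simpa using this
        rw [h4]
        simp only [smul_zero, norm_zero]
        positivity
    rw [hdiff]
    refine (norm_sub_le _ _).trans ?_
    linarith
  have hlim : Tendsto (fun n => ∫ x, ‖gradient f x - gradient (F n) x‖ ^ 2 ∂m.1) atTop
      (𝓝 (∫ _, (0 : ℝ) ∂m.1)) := by
    refine tendsto_integral_of_dominated_convergence
      (fun x => ((C + 6 * B * D) * (1 + ‖x‖)) ^ 2) (fun n => ?_) ?_ (fun n => ae_of_all _ fun x => ?_)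
      (ae_of_all _ fun x => ?_)
    · have h1 := h.continuous_gradient
      have h2 := continuous_gradient_of_contDiff (hFc n)
      exact Continuous.aestronglyMeasurable (by fun_prop)
    · have h1 : MemLp (fun x : Sp d => (C + 6 * B * D) * (1 + ‖x‖)) 2 m.1 :=
        ((memLp_const (1 : ℝ)).add (memLp_id m).norm).const_mul _
      exact h1.integrable_sq
    · rw [Real.norm_eq_abs, abs_of_nonneg (by positivity)]
      gcongr
      exact hbound n x
    · refine tendsto_const_nhds.congr' ?_
      filter_upwards [hzero x] with n hn
      rw [hn]
      simp
  rw [integral_zero] at hlim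
  refine isTangentField_of_approx
    (memLp_of_linear_growth h.continuous_gradient.aestronglyMeasurable hC) fun ε hε => ?_
  obtain ⟨n, hn⟩ := (hlim.eventually (ge_mem_nhds (show (0 : ℝ) < ε ^ 2 by positivity))).exists
  exact ⟨gradient (F n), isTangentField_gradient_of_hasCompactSupport (hFc n) (hFs n) m, hn⟩

end

section

/-! ### Tuples and product measures -/

variable {d k : ℕ}

/-- The inclusion of the `j`-th factor. -/
def inj (j : Fin k) : Sp d →L[ℝ] Mk d k :=
  ((PiLp.continuousLinearEquiv 2 ℝ (fun _ : Fin k => Sp d)).symm :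
    (Fin k → Sp d) →L[ℝ] Mk d k).comp (ContinuousLinearMap.single ℝ (fun _ => Sp d) j)

/-- The projection to the `j`-th factor. -/
def prj (j : Fin k) : Mk d k →L[ℝ] Sp d := PiLp.proj 2 (fun _ : Fin k => Sp d) j

@[simp] theorem prj_apply (j : Fin k) (X : Mk d k) : prj j X = X j := rfl

theorem inj_eq (j : Fin k) (v : Sp d) : inj j v = PiLp.single 2 j v := rfl

@[simp] theorem inj_apply (j i : Fin k) (v : Sp d) :
    (inj j v : Mk d k) i = if i = j then v else 0 := by
  rw [inj_eq]
  simp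

theorem inner_inj_right (X : Mk d k) (j : Fin k) (v : Sp d) :
    inner ℝ X (inj j v) = inner ℝ (X j) v := by
  simp only [PiLp.inner_apply, inj_apply]
  rw [Finset.sum_eq_single j]
  · simp
  · intro i _ hi
    simp [hi]
  · simp

@[simp] theorem norm_inj (j : Fin k) (v : Sp d) : ‖(inj j v : Mk d k)‖ = ‖v‖ := by
  have h : ‖(inj j v : Mk d k)‖ ^ 2 = ‖v‖ ^ 2 := by
    rw [← real_inner_self_eq_norm_sq, inner_inj_right, inj_apply, if_pos rfl,
      real_inner_self_eq_norm_sq]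
  exact (sq_eq_sq₀ (norm_nonneg _) (norm_nonneg _)).1 h

theorem sum_inj (X : Mk d k) : ∑ j, inj j (X j) = X := by
  ext i : 1
  rw [← prj_apply, map_sum]
  simp

theorem norm_apply_le_norm (X : Mk d k) (j : Fin k) : ‖X j‖ ≤ ‖X‖ := PiLp.norm_apply_le X j

/-- Replace the `j`-th entry of `X` by `x`. -/
def upd (j : Fin k) (X : Mk d k) (x : Sp d) : Mk d k := X + inj j (x - X j)

theorem norm_upd_le (j : Fin k) (X : Mk d k) (x : Sp d) : ‖upd j X x‖ ≤ 2 * ‖X‖ + ‖x‖ := by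
  have h1 := norm_add_le X (inj j (x - X j))
  have h2 := norm_sub_le x (X j)
  have h3 := norm_apply_le_norm X j
  rw [norm_inj] at h1
  unfold upd
  linarith

theorem continuous_upd (j : Fin k) :
    Continuous fun q : Mk d k × Sp d => upd j q.1 q.2 := by
  have h1 : Continuous fun X : Mk d k => X j := (prj j).continuous
  unfold upd
  have h2 := (inj j : Sp d →L[ℝ] Mk d k).continuous
  fun_prop

section Tup

variable {S : Type*}

/-- The tuple with entries `π (P j)`. -/
def tup (π : S → Sp d) (P : Fin k → S) : Mk d k := WithLp.toLp 2 (fun j => π (P j))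

@[simp] theorem tup_apply (π : S → Sp d) (P : Fin k → S) (j : Fin k) : tup π P j = π (P j) := rfl

theorem tup_update (π : S → Sp d) (P : Fin k → S) (j : Fin k) (s : S) :
    tup π (Function.update P j s) = upd j (tup π P) (π s) := by
  ext i : 1
  unfold upd
  rw [PiLp.add_apply, inj_apply, tup_apply, tup_apply]
  by_cases h : i = j
  · subst h
    simp
  · simp [h]

/-- Replacing one of `k` independent coordinates by a fresh independent copy does not change the
joint law. This is how a single coordinate is separated from the others in all Fubini arguments
below. -/
theorem measurePreserving_update [MeasurableSpace S] (γ : Measure S) [IsProbabilityMeasure γ]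
    (j : Fin k) : MeasurePreserving (fun q : (Fin k → S) × S => Function.update q.1 j q.2)
      ((Measure.pi fun _ => γ).prod γ) (Measure.pi fun _ => γ) := by
  have hm : Measurable (fun q : (Fin k → S) × S => Function.update q.1 j q.2) := by
    rw [measurable_pi_iff]
    intro i
    by_cases h : i = j
    · subst h
      simpa using measurable_snd
    · simp only [Function.update_of_ne h]
      fun_prop
  refine ⟨hm, (Measure.pi_eq fun s hs => ?_).symm⟩
  rw [Measure.map_apply hm (MeasurableSet.univ_pi hs)]
  have h1 : (fun q : (Fin k → S) × S => Function.update q.1 j q.2) ⁻¹' Set.univ.pi s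
      = (Set.univ.pi (Function.update s j Set.univ)) ×ˢ s j := by
    ext q
    simp only [Set.mem_preimage, Set.mem_pi, Set.mem_univ, true_imp_iff, Set.mem_prod]
    constructor
    · intro h
      refine ⟨fun i => ?_, by simpa using h j⟩
      by_cases hi : i = j
      · subst hi
        simp
      · simpa [Function.update_of_ne hi] using h i
    · rintro ⟨h, h'⟩ i
      by_cases hi : i = j
      · subst hi
        simpa using h'
      · simpa [Function.update_of_ne hi] using h i
  rw [h1, Measure.prod_prod, Measure.pi_pi]
  have h2 : ∀ i, γ (Function.update s j Set.univ i) =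
      Function.update (fun i => γ (s i)) j 1 i := by
    intro i
    by_cases hi : i = j
    · subst hi
      simp
    · simp [Function.update_of_ne hi]
  simp_rw [h2]
  rw [Finset.prod_update_of_mem (Finset.mem_univ j), one_mul, mul_comm,
    ← Finset.mul_prod_erase _ _ (Finset.mem_univ j), Finset.sdiff_singleton_eq_erase]

end Tup

/-- The `k`-fold product of `μ` as a measure on `(ℝ^d)^k`. -/
def pw (μ : Measure (Sp d)) (k : ℕ) : Measure (Mk d k) :=
  (Measure.pi fun _ : Fin k => μ).map (WithLp.toLp 2)

theorem measurePreserving_tup {S : Type*} [MeasurableSpace S] {γ : Measure S} [SigmaFinite γ]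
    {μ : Measure (Sp d)} [SigmaFinite μ] {π : S → Sp d} (h : MeasurePreserving π γ μ) :
    MeasurePreserving (tup π) (Measure.pi fun _ : Fin k => γ) (pw μ k) := by
  have h1 := measurePreserving_pi (fun _ : Fin k => γ) (fun _ : Fin k => μ) (fun _ => h)
  have h2 : MeasurePreserving (WithLp.toLp 2) (Measure.pi fun _ : Fin k => μ) (pw μ k) :=
    ⟨WithLp.measurable_toLp 2 _, rfl⟩
  exact h2.comp h1

instance {μ : Measure (Sp d)} [IsProbabilityMeasure μ] : IsProbabilityMeasure (pw μ k) :=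
  Measure.isProbabilityMeasure_map (WithLp.measurable_toLp 2 _).aemeasurable

theorem measurePreserving_prj {μ : Measure (Sp d)} [IsProbabilityMeasure μ] (j : Fin k) :
    MeasurePreserving (fun X : Mk d k => X j) (pw μ k) μ := by
  have hm : Measurable fun X : Mk d k => X j := (prj j).continuous.measurable
  refine ⟨hm, ?_⟩
  rw [pw, Measure.map_map hm (WithLp.measurable_toLp 2 _)]
  exact (measurePreserving_eval (fun _ : Fin k => μ) j).map_eq

theorem memLp_pw_id (m : P2 d) : MemLp (fun X : Mk d k => X) 2 (pw m.1 k) := by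
  have h : (fun X : Mk d k => X) = fun X => ∑ j, inj j (X j) := funext fun X => (sum_inj X).symm
  rw [h]
  exact memLp_finsetSum _ fun j _ =>
    (inj j).comp_memLp' ((memLp_id m).comp_measurePreserving (measurePreserving_prj j))

theorem memLp_comp_of_linear_growth {α V F : Type*} [MeasurableSpace α] {μ : Measure α}
    [IsFiniteMeasure μ] [NormedAddCommGroup V] [NormedAddCommGroup F] {X : α → V}
    (hX : MemLp X 2 μ) {g : V → F} (hg : Continuous g) {C : ℝ} (h : ∀ x, ‖g x‖ ≤ C * (1 + ‖x‖)) :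
    MemLp (fun a => g (X a)) 2 μ :=
  MemLp.of_le_mul ((memLp_const (1 : ℝ)).add hX.norm) (hg.comp_aestronglyMeasurable hX.1)
    (ae_of_all _ fun x => (h _).trans (le_of_eq (by
      simp only [Pi.add_apply, Real.norm_eq_abs]
      rw [abs_of_nonneg (by positivity)])))

/-! ### First order expansion of integrals -/

/-- The oscillation of `∇Φ` on the segment is at most `ε` when `‖x‖ ≤ M` and `y` is near, by uniform
continuity on a ball. It is absorbed by `K‖y - x‖` when `y` is not near, and bounded by linear
growth when `‖x‖ > M`. -/
theorem IsC1Lin.taylor_pointwise {V : Type*} [NormedAddCommGroup V] [InnerProductSpace ℝ V]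
    [CompleteSpace V] [ProperSpace V] {Φ : V → ℝ} (h : IsC1Lin Φ) {C : ℝ} (hC0 : 0 ≤ C)
    (hC : ∀ x, ‖gradient Φ x‖ ≤ C * (1 + ‖x‖)) {ε : ℝ} (hε : 0 < ε) {M : ℝ} (hM : 0 ≤ M) :
    ∃ K, 0 ≤ K ∧ ∀ x y, |Φ y - Φ x - inner ℝ (gradient Φ x) (y - x)| ≤
      (ε + K * ‖y - x‖ + (if M < ‖x‖ then 2 * C * (1 + ‖x‖) else 0)) * ‖y - x‖ := by
  have huc := (isCompact_closedBall (0 : V) (M + 1)).uniformContinuousOn_of_continuous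
    h.continuous_gradient.continuousOn
  obtain ⟨δ, hδ, H⟩ := Metric.uniformContinuousOn_iff.1 huc ε hε
  have hδ' : 0 < min δ 1 := by positivity
  -- When `‖y - x‖ ≥ min δ 1`, the second summand times `‖y - x‖` is at least `2C(1 + M)`.
  refine ⟨C + 2 * C * (1 + M) / min δ 1, by positivity, fun x y => ?_⟩
  refine abs_sub_sub_inner_gradient_le h.differentiable x y fun z hz => ?_
  have hz1 := norm_sub_le_of_mem_segment hz
  have hgen : ‖gradient Φ z - gradient Φ x‖ ≤ 2 * C * (1 + ‖x‖) + C * ‖y - x‖ := by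
    have h1 : ‖z‖ ≤ ‖x‖ + ‖y - x‖ := by
      calc ‖z‖ = ‖x + (z - x)‖ := by rw [add_sub_cancel]
        _ ≤ ‖x‖ + ‖z - x‖ := norm_add_le _ _
        _ ≤ _ := by gcongr
    calc ‖gradient Φ z - gradient Φ x‖ ≤ ‖gradient Φ z‖ + ‖gradient Φ x‖ := norm_sub_le _ _
      _ ≤ C * (1 + ‖z‖) + C * (1 + ‖x‖) := add_le_add (hC z) (hC x)
      _ ≤ C * (1 + (‖x‖ + ‖y - x‖)) + C * (1 + ‖x‖) := by gcongr
      _ = _ := by ring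
  have hq : 0 ≤ 2 * C * (1 + M) / min δ 1 * ‖y - x‖ := by positivity
  by_cases hx : M < ‖x‖
  · rw [if_pos hx]
    linarith
  · rw [if_neg hx]
    push Not at hx
    by_cases hxy : ‖y - x‖ < min δ 1
    · have h1 : dist z x < δ := by
        rw [dist_eq_norm]
        exact hz1.trans_lt (hxy.trans_le (min_le_left _ _))
      have h2 : x ∈ Metric.closedBall (0 : V) (M + 1) := by
        rw [mem_closedBall_zero_iff]
        linarith
      have h3 : z ∈ Metric.closedBall (0 : V) (M + 1) := by
        rw [mem_closedBall_zero_iff]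
        have h4 : ‖z‖ ≤ ‖x‖ + ‖z - x‖ := by
          simpa using norm_add_le x (z - x)
        have h5 := hxy.trans_le (min_le_right δ 1)
        linarith
      have h4 := (H z h3 x h2 h1).le
      rw [dist_eq_norm] at h4
      have : 0 ≤ C * ‖y - x‖ := by positivity
      linarith
    · push Not at hxy
      have h1 : 2 * C * (1 + ‖x‖) ≤ 2 * C * (1 + M) / min δ 1 * ‖y - x‖ := by
        rw [div_mul_eq_mul_div, le_div_iff₀ hδ']
        gcongr
      linarith

theorem tendsto_integral_tail_sq {V : Type*} [NormedAddCommGroup V] [MeasurableSpace V]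
    [OpensMeasurableSpace V] {μ : Measure V} [IsProbabilityMeasure μ]
    (hμ : MemLp (fun x : V => x) 2 μ) (C : ℝ) :
    Tendsto (fun M : ℕ => ∫ x, (if (M : ℝ) < ‖x‖ then C * (1 + ‖x‖) else 0) ^ 2 ∂μ) atTop
      (𝓝 0) := by
  have h1 : MemLp (fun x : V => C * (1 + ‖x‖)) 2 μ :=
    ((memLp_const (1 : ℝ)).add hμ.norm).const_mul _
  have h2 : Tendsto (fun M : ℕ => ∫ x, (if (M : ℝ) < ‖x‖ then C * (1 + ‖x‖) else 0) ^ 2 ∂μ) atTop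
      (𝓝 (∫ _, (0 : ℝ) ∂μ)) := by
    refine tendsto_integral_of_dominated_convergence (fun x => (C * (1 + ‖x‖)) ^ 2)
      (fun M => ?_) h1.integrable_sq (fun M => ae_of_all _ fun x => ?_) (ae_of_all _ fun x => ?_)
    · refine (Measurable.aestronglyMeasurable ?_)
      refine Measurable.pow_const ?_ 2
      refine Measurable.ite (measurableSet_lt measurable_const measurable_norm) ?_ measurable_const
      exact (measurable_const.add measurable_norm).const_mul C
    · rw [Real.norm_eq_abs, abs_of_nonneg (by positivity)]
      split_ifs
      · exact le_rfl
      · rw [zero_pow two_ne_zero]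
        positivity
    · refine tendsto_const_nhds.congr' ?_
      obtain ⟨N, hN⟩ := exists_nat_ge ‖x‖
      filter_upwards [eventually_ge_atTop N] with M hM
      have : (N : ℝ) ≤ M := by exact_mod_cast hM
      rw [if_neg (by linarith)]
      simp
  simpa using h2

theorem integral_norm_le_sqrt {α F : Type*} [MeasurableSpace α] [NormedAddCommGroup F]
    {μ : Measure α} [IsProbabilityMeasure μ] {f : α → F} (hf : MemLp f 2 μ) :
    ∫ x, ‖f x‖ ∂μ ≤ √(∫ x, ‖f x‖ ^ 2 ∂μ) := by
  have h := integral_norm_mul_norm_le hf (memLp_const (1 : ℝ) : MemLp (fun _ => (1 : ℝ)) 2 μ)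
  simpa using h

/-- The three terms of `taylor_pointwise` are at most `ε's`, `Ks²` and, by Cauchy–Schwarz, the
`L²(μ)` tail of `∇Φ` times `s`, where `s` is the root mean square distance of `X` and `Y`. Only the
law of `X` matters, so `δ` can be fixed before `Ω` and serves all `ν` and all plans at once. -/
theorem IsC1Lin.taylor_integral {V : Type*} [NormedAddCommGroup V] [InnerProductSpace ℝ V]
    [CompleteSpace V] [ProperSpace V] [MeasurableSpace V] [BorelSpace V] {Φ : V → ℝ}
    (h : IsC1Lin Φ) {μ : Measure V} [IsProbabilityMeasure μ] (hμ : MemLp (fun x : V => x) 2 μ)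
    {ε : ℝ} (hε : 0 < ε) : ∃ δ > 0, ∀ {Ω : Type} [MeasurableSpace Ω] (P : Measure Ω)
      [IsProbabilityMeasure P] (X Y : Ω → V), MeasurePreserving X P μ →
      MemLp (fun a => Y a - X a) 2 P → √(∫ a, ‖Y a - X a‖ ^ 2 ∂P) < δ →
      |∫ a, (Φ (Y a) - Φ (X a) - inner ℝ (gradient Φ (X a)) (Y a - X a)) ∂P|
        ≤ ε * √(∫ a, ‖Y a - X a‖ ^ 2 ∂P) := by
  obtain ⟨C, hC0, hC⟩ := h.growth
  set ε' := ε / 3 with hε'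
  have hε'0 : 0 < ε' := by positivity
  obtain ⟨M, hM⟩ := ((tendsto_integral_tail_sq hμ (2 * C)).eventually
    (ge_mem_nhds (show (0 : ℝ) < ε' ^ 2 by positivity))).exists
  obtain ⟨K, hK0, hK⟩ := h.taylor_pointwise hC0 hC hε'0 (M := M) (by positivity)
  refine ⟨ε' / (K + 1), by positivity, fun {Ω} _ P _ X Y hX hYX hs => ?_⟩
  set s := √(∫ a, ‖Y a - X a‖ ^ 2 ∂P) with hsdef
  have hs0 : 0 ≤ s := Real.sqrt_nonneg _
  set t : V → ℝ := fun x => if (M : ℝ) < ‖x‖ then 2 * C * (1 + ‖x‖) else 0 with ht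
  have htn : ∀ x, 0 ≤ t x := fun x => by
    simp only [ht]
    split_ifs <;> positivity
  have htm : Measurable t := by
    refine Measurable.ite (measurableSet_lt measurable_const measurable_norm) ?_ measurable_const
    exact (measurable_const.add measurable_norm).const_mul _
  have htL : MemLp t 2 μ := by
    refine MemLp.of_le (((memLp_const (1 : ℝ)).add hμ.norm).const_mul (2 * C))
      htm.aestronglyMeasurable (ae_of_all _ fun x => ?_)
    rw [Real.norm_eq_abs, abs_of_nonneg (htn x)]
    simp only [ht, Pi.add_apply]
    split_ifs
    · exact le_abs_self _
    · positivity
  have htX : MemLp (fun a => t (X a)) 2 P := htL.comp_measurePreserving hX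
  have hi1 : Integrable (fun a => ‖Y a - X a‖) P := (hYX.integrable (by norm_num)).norm
  have hi2 : Integrable (fun a => ‖Y a - X a‖ ^ 2) P :=
    (memLp_two_iff_integrable_sq_norm hYX.1).1 hYX
  have hi3 : Integrable (fun a => ‖t (X a)‖ * ‖Y a - X a‖) P := integrable_norm_mul_norm htX hYX
  have hi4 : Integrable (fun a => ε' * ‖Y a - X a‖ + K * ‖Y a - X a‖ ^ 2) P :=
    (hi1.const_mul _).add (hi2.const_mul _)
  have hi5 : Integrable (fun a => ε' * ‖Y a - X a‖ + K * ‖Y a - X a‖ ^ 2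
      + ‖t (X a)‖ * ‖Y a - X a‖) P := hi4.add hi3
  have hle := norm_integral_le_of_norm_le (μ := P) hi5 (ae_of_all _ fun a =>
    (show ‖Φ (Y a) - Φ (X a) - inner ℝ (gradient Φ (X a)) (Y a - X a)‖ ≤ _ from by
      rw [Real.norm_eq_abs, Real.norm_eq_abs, abs_of_nonneg (htn _)]
      refine (hK (X a) (Y a)).trans (le_of_eq ?_)
      simp only [ht]
      ring))
  rw [Real.norm_eq_abs] at hle
  refine hle.trans ?_
  rw [integral_add hi4 hi3, integral_add (hi1.const_mul _) (hi2.const_mul _), integral_const_mul,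
    integral_const_mul]
  have e1 : ∫ a, ‖Y a - X a‖ ∂P ≤ s := integral_norm_le_sqrt hYX
  have e2 : ∫ a, ‖Y a - X a‖ ^ 2 ∂P = s ^ 2 := by
    rw [hsdef, Real.sq_sqrt (integral_nonneg fun _ => by positivity)]
  have e3 : ∫ a, ‖t (X a)‖ * ‖Y a - X a‖ ∂P ≤ ε' * s := by
    refine (integral_norm_mul_norm_le htX hYX).trans ?_
    refine mul_le_mul_of_nonneg_right ?_ hs0
    refine Real.sqrt_le_iff.2 ⟨hε'0.le, ?_⟩
    refine le_trans (le_of_eq ?_) hM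
    rw [← hX.map_eq, integral_map hX.measurable.aemeasurable
      (htm.pow_const 2).aestronglyMeasurable]
    simp only [ht, Real.norm_eq_abs, sq_abs]
  have e4 : K * s ≤ ε' := by
    have : K * s ≤ (K + 1) * (ε' / (K + 1)) := by gcongr; linarith
    rwa [mul_div_cancel₀ _ (by positivity)] at this
  rw [e2]
  have h3 : ε = 3 * ε' := by rw [hε']; ring
  rw [h3]
  nlinarith

end

section

/-! ### Polynomials: gradients -/

variable {d k : ℕ}

theorem integrable_comp_of_linear_growth {V F : Type*} [NormedAddCommGroup V]
    [MeasurableSpace V] [BorelSpace V] [SecondCountableTopology V] [NormedAddCommGroup F]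
    {μ : Measure V} [IsFiniteMeasure μ] (hμ : MemLp (fun x : V => x) 2 μ)
    {g : V → F} (hg : Continuous g) {C : ℝ} (hC0 : 0 ≤ C) (hC : ∀ x, ‖g x‖ ≤ C * (1 + ‖x‖))
    {u : V → V} (hu : Continuous u) {A B : ℝ} (hb : ∀ X, ‖u X‖ ≤ A * ‖X‖ + B) :
    Integrable (fun X => g (u X)) μ := by
  have h1 : Integrable (fun X : V => C * (1 + (A * ‖X‖ + B))) μ :=
    ((integrable_const 1).add (((hμ.integrable (by norm_num)).norm.const_mul A).add
      (integrable_const B))).const_mul C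
  refine h1.mono' (hg.comp hu).aestronglyMeasurable (ae_of_all _ fun X => ?_)
  exact (hC _).trans (by gcongr; exact hb X)

theorem continuous_integral_of_linear_growth {Z V F : Type*} [NormedAddCommGroup Z]
    [NormedAddCommGroup V] [MeasurableSpace V] [BorelSpace V] [SecondCountableTopology V]
    [NormedAddCommGroup F] [NormedSpace ℝ F] {μ : Measure V} [IsFiniteMeasure μ]
    (hμ : MemLp (fun x : V => x) 2 μ)
    {g : V → F} (hg : Continuous g) {C : ℝ} (hC0 : 0 ≤ C) (hC : ∀ x, ‖g x‖ ≤ C * (1 + ‖x‖))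
    {u : Z → V → V} (hu : Continuous (Function.uncurry u)) {A B : ℝ} (hB : 0 ≤ B)
    (hb : ∀ z X, ‖u z X‖ ≤ A * ‖X‖ + B * ‖z‖) : Continuous fun z => ∫ X, g (u z X) ∂μ := by
  rw [continuous_iff_continuousAt]
  intro z₀
  have h1 : Integrable (fun X : V => C * (1 + (A * ‖X‖ + B * (‖z₀‖ + 1)))) μ :=
    ((integrable_const 1).add (((hμ.integrable (by norm_num)).norm.const_mul A).add
      (integrable_const (B * (‖z₀‖ + 1))))).const_mul C
  refine continuousAt_of_dominated (bound := fun X => C * (1 + (A * ‖X‖ + B * (‖z₀‖ + 1))))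
    (Eventually.of_forall fun z => ?_) ?_ h1 (ae_of_all _ fun X => ?_)
  · exact (hg.comp (hu.comp (continuous_const.prodMk continuous_id))).aestronglyMeasurable
  · filter_upwards [Metric.ball_mem_nhds z₀ one_pos] with z hz
    refine ae_of_all _ fun X => (hC _).trans ?_
    have h2 : ‖z‖ ≤ ‖z₀‖ + 1 := by
      have := norm_le_norm_add_norm_sub z₀ z
      rw [mem_ball_iff_norm] at hz
      linarith [norm_sub_rev z z₀]
    gcongr
    exact (hb z X).trans (by gcongr)
  · exact (hg.comp (hu.comp (continuous_id.prodMk continuous_const))).continuousAt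

/-- `∫ Φ(x₁, …, x_k) m(dx₁) ⋯ m(dx_k)`. -/
def poly (Φ : Mk d k → ℝ) (m : P2 d) : ℝ := ∫ X, Φ X ∂(pw m.1 k)

/-- The Wasserstein gradient of `poly Φ`. -/
def gradField (Φ : Mk d k → ℝ) (m : P2 d) (x : Sp d) : Sp d :=
  ∑ j, ∫ X, (gradient Φ (upd j X x)) j ∂(pw m.1 k)

/-- The field `X ↦ (ζ(X_j))_j`. -/
def lift (ζ : Sp d → Sp d) (X : Mk d k) : Mk d k := WithLp.toLp 2 (fun j => ζ (X j))

theorem lift_eq_sum (ζ : Sp d → Sp d) (X : Mk d k) : lift ζ X = ∑ j, inj j (ζ (X j)) :=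
  (sum_inj _).symm

theorem memLp_tup {S : Type*} [MeasurableSpace S] {γ : Measure S} [IsProbabilityMeasure γ]
    {w : S → Sp d} (hw : MemLp w 2 γ) : MemLp (tup w) 2 (Measure.pi fun _ : Fin k => γ) := by
  have h : (tup w : (Fin k → S) → Mk d k) = fun P => ∑ j, inj j (w (P j)) :=
    funext fun P => (sum_inj _).symm
  rw [h]
  exact memLp_finsetSum _ fun j _ =>
    (inj j).comp_memLp' (hw.comp_measurePreserving (measurePreserving_eval (fun _ => γ) j))

theorem memLp_lift {m : P2 d} {ζ : Sp d → Sp d} (hζ : MemLp ζ 2 m.1) :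
    MemLp (lift ζ : Mk d k → Mk d k) 2 (pw m.1 k) := by
  have h : (lift ζ : Mk d k → Mk d k) = fun X => ∑ j, inj j (ζ (X j)) :=
    funext fun X => lift_eq_sum ζ X
  rw [h]
  exact memLp_finsetSum _ fun j _ =>
    (inj j).comp_memLp' (hζ.comp_measurePreserving (measurePreserving_prj j))

variable {Φ : Mk d k → ℝ}

theorem IsC1Lin.integrable_gradient_upd (hΦ : IsC1Lin Φ) (m : P2 d) (j : Fin k) (x : Sp d) :
    Integrable (fun X => (gradient Φ (upd j X x)) j) (pw m.1 k) := by
  obtain ⟨C, hC0, hC⟩ := hΦ.growth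
  refine integrable_comp_of_linear_growth (g := fun Y => (gradient Φ Y) j) (memLp_pw_id m)
    ((prj j).continuous.comp hΦ.continuous_gradient) hC0
    (fun Y => (norm_apply_le_norm _ _).trans (hC Y)) (u := fun X => upd j X x)
    ((continuous_upd j).comp (continuous_id.prodMk continuous_const)) (fun X => norm_upd_le j X x)

theorem IsC1Lin.continuous_gradField (hΦ : IsC1Lin Φ) (m : P2 d) : Continuous (gradField Φ m) := by
  obtain ⟨C, hC0, hC⟩ := hΦ.growth
  refine continuous_finsetSum _ fun j _ => ?_
  refine continuous_integral_of_linear_growth (g := fun Y => (gradient Φ Y) j) (memLp_pw_id m)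
    ((prj j).continuous.comp hΦ.continuous_gradient) hC0
    (fun Y => (norm_apply_le_norm _ _).trans (hC Y)) (u := fun x X => upd j X x)
    ((continuous_upd j).comp continuous_swap) (A := 2) zero_le_one (fun x X => ?_)
  rw [one_mul]
  exact norm_upd_le j X x

theorem norm_gradField_le {C : ℝ} (hC0 : 0 ≤ C)
    (hC : ∀ x, ‖gradient Φ x‖ ≤ C * (1 + ‖x‖)) (m : P2 d) (x : Sp d) :
    ‖gradField Φ m x‖ ≤ k * (C * (1 + 2 * ∫ X : Mk d k, ‖X‖ ∂(pw m.1 k) + ‖x‖)) := by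
  have hX : Integrable (fun X : Mk d k => ‖X‖) (pw m.1 k) :=
    ((memLp_pw_id m).integrable (by norm_num)).norm
  have h1 : ∀ j : Fin k, ‖∫ X, (gradient Φ (upd j X x)) j ∂(pw m.1 k)‖ ≤
      C * (1 + 2 * ∫ X : Mk d k, ‖X‖ ∂(pw m.1 k) + ‖x‖) := by
    intro j
    have h2 : Integrable (fun X : Mk d k => 1 + 2 * ‖X‖ + ‖x‖) (pw m.1 k) :=
      ((integrable_const 1).add (hX.const_mul 2)).add (integrable_const _)
    have h2' : Integrable (fun X : Mk d k => 1 + 2 * ‖X‖) (pw m.1 k) :=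
      (integrable_const 1).add (hX.const_mul 2)
    have h3 := norm_integral_le_of_norm_le (f := fun X => (gradient Φ (upd j X x)) j)
      (h2.const_mul C) (ae_of_all _ fun X => ?_)
    · rw [integral_const_mul, integral_add h2' (integrable_const _),
        integral_add (integrable_const _) (hX.const_mul 2), integral_const_mul] at h3
      simpa using h3
    · refine (norm_apply_le_norm _ _).trans ((hC _).trans ?_)
      rw [add_assoc]
      gcongr
      exact norm_upd_le j X x
  refine (norm_sum_le _ _).trans ((Finset.sum_le_sum fun j _ => h1 j).trans ?_)
  simp

/-- The `j`-th term of the inner product sees `w` only through `P j`. Redraw that coordinate and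
integrate out the others: what remains is the `j`-th summand of `gradField`. With a plan for `γ` and
the displacement for `w`, this is the first order term of the expansion. -/
theorem IsC1Lin.integral_inner_gradField (hΦ : IsC1Lin Φ) {S : Type*} [MeasurableSpace S]
    {γ : Measure S} [IsProbabilityMeasure γ] {m : P2 d} {π : S → Sp d}
    (hπ : MeasurePreserving π γ m.1) {w : S → Sp d} (hw : MemLp w 2 γ) :
    ∫ s, inner ℝ (gradField Φ m (π s)) (w s) ∂γ =
      ∫ P : Fin k → S, inner ℝ (gradient Φ (tup π P)) (tup w P) ∂(Measure.pi fun _ => γ) := by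
  obtain ⟨C, hC0, hC⟩ := hΦ.growth
  have hG : MemLp (fun P : Fin k → S => gradient Φ (tup π P)) 2 (Measure.pi fun _ => γ) :=
    memLp_comp_of_linear_growth
      ((memLp_pw_id m).comp_measurePreserving (measurePreserving_tup hπ))
      hΦ.continuous_gradient hC
  have hint : ∀ j : Fin k, Integrable (fun P : Fin k → S =>
      inner ℝ ((gradient Φ (tup π P)) j) (w (P j))) (Measure.pi fun _ => γ) := fun j =>
    integrable_inner_of_memLp ((prj j).comp_memLp' hG)
      (hw.comp_measurePreserving (measurePreserving_eval (fun _ => γ) j))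
  have key : ∀ j : Fin k, Integrable (fun s => inner ℝ
      (∫ X, (gradient Φ (upd j X (π s))) j ∂(pw m.1 k)) (w s)) γ ∧
      ∫ s, inner ℝ (∫ X, (gradient Φ (upd j X (π s))) j ∂(pw m.1 k)) (w s) ∂γ =
      ∫ P : Fin k → S, inner ℝ ((gradient Φ (tup π P)) j) (w (P j)) ∂(Measure.pi fun _ => γ) := by
    intro j
    have hmp := measurePreserving_update γ j
    have hI := hmp.integrable_comp_of_integrable (hint j)
    have h1 : ∀ s, ∫ P : Fin k → S, inner ℝ ((gradient Φ (tup π (Function.update P j s))) j)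
        (w (Function.update P j s j)) ∂(Measure.pi fun _ => γ) =
        inner ℝ (∫ X, (gradient Φ (upd j X (π s))) j ∂(pw m.1 k)) (w s) := by
      intro s
      have ht : MeasurePreserving (tup π) (Measure.pi fun _ : Fin k => γ) (pw m.1 k) :=
        measurePreserving_tup hπ
      have hm : AEStronglyMeasurable (fun X => (gradient Φ (upd j X (π s))) j) (pw m.1 k) :=
        (hΦ.integrable_gradient_upd m j (π s)).1
      rw [← ht.map_eq, integral_map ht.measurable.aemeasurable (by rwa [ht.map_eq]),
        real_inner_comm, ← integral_inner]
      · refine integral_congr_ae (ae_of_all _ fun P => ?_)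
        simp only
        rw [tup_update, Function.update_self, real_inner_comm]
      · exact ht.integrable_comp_of_integrable (hΦ.integrable_gradient_upd m j (π s))
    constructor
    · refine hI.integral_prod_right.congr (ae_of_all _ fun s => ?_)
      exact h1 s
    · rw [← hmp.map_eq, integral_map hmp.measurable.aemeasurable
        (by rw [hmp.map_eq]; exact (hint j).1)]
      refine Eq.symm ((integral_prod_symm _ hI).trans ?_)
      refine integral_congr_ae (ae_of_all _ fun s => ?_)
      exact h1 s
  have e1 : ∀ s, inner ℝ (gradField Φ m (π s)) (w s) =
      ∑ j, inner ℝ (∫ X, (gradient Φ (upd j X (π s))) j ∂(pw m.1 k)) (w s) := fun s => by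
    rw [gradField, sum_inner]
  have e2 : ∀ P : Fin k → S, inner ℝ (gradient Φ (tup π P)) (tup w P) =
      ∑ j, inner ℝ ((gradient Φ (tup π P)) j) (w (P j)) := fun P => by
    rw [PiLp.inner_apply]
    rfl
  simp_rw [e1, e2]
  rw [integral_finsetSum _ fun j _ => (key j).1, integral_finsetSum _ fun j _ => hint j]
  exact Finset.sum_congr rfl fun j _ => (key j).2

theorem IsC1Lin.pairing_gradField (hΦ : IsC1Lin Φ) (m : P2 d) {ζ : Sp d → Sp d}
    (hζ : MemLp ζ 2 m.1) :
    pairing m (gradField Φ m) ζ = ∫ X, inner ℝ (gradient Φ X) (lift ζ X) ∂(pw m.1 k) := by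
  have h := hΦ.integral_inner_gradField (MeasurePreserving.id m.1) hζ
  rw [pairing]
  refine h.trans ?_
  have hm : AEStronglyMeasurable (fun X => inner ℝ (gradient Φ X) (lift ζ X)) (pw m.1 k) :=
    hΦ.continuous_gradient.aestronglyMeasurable.inner (memLp_lift hζ).1
  rw [pw] at hm ⊢
  rw [integral_map (WithLp.measurable_toLp 2 _).aemeasurable hm]
  rfl

/-- The field is the gradient of `x ↦ ∑ j, ∫ Φ(upd j X x)`, the first variation of `poly Φ`, and
this function is `C¹` with gradient of linear growth. -/
theorem IsC1Lin.isTangentField_gradField (hΦ : IsC1Lin Φ) (m : P2 d) :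
    IsTangentField m (gradField Φ m) := by
  obtain ⟨C, hC0, hC⟩ := hΦ.growth
  obtain ⟨D, hD0, hD⟩ := hΦ.exists_norm_le
  have hd : ∀ j : Fin k, ∀ x, HasFDerivAt (fun x => ∫ X, Φ (upd j X x) ∂(pw m.1 k))
      (innerSL ℝ (∫ X, (gradient Φ (upd j X x)) j ∂(pw m.1 k))) x := by
    intro j x
    have hu : ∀ x : Sp d, Continuous fun X : Mk d k => upd j X x := fun x =>
      (continuous_upd j).comp (continuous_id.prodMk continuous_const)
    have hX : Integrable (fun X : Mk d k => ‖X‖) (pw m.1 k) :=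
      ((memLp_pw_id m).integrable (by norm_num)).norm
    have hX2 : Integrable (fun X : Mk d k => ‖X‖ ^ 2) (pw m.1 k) :=
      (memLp_two_iff_integrable_sq_norm (memLp_pw_id m).1).1 (memLp_pw_id m)
    have hnx : ∀ y ∈ Metric.ball x 1, ‖y‖ ≤ ‖x‖ + 1 := fun y hy => by
      have := norm_le_norm_add_norm_sub x y
      rw [mem_ball_iff_norm] at hy
      linarith [norm_sub_rev x y]
    have h := hasFDerivAt_integral_of_dominated_of_fderiv_le (μ := pw m.1 k) (𝕜 := ℝ)
      (F := fun x X => Φ (upd j X x)) (x₀ := x) (s := Metric.ball x 1)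
      (F' := fun x X => innerSL ℝ ((gradient Φ (upd j X x)) j))
      (bound := fun X => C * (1 + (2 * ‖X‖ + (‖x‖ + 1)))) (Metric.ball_mem_nhds x one_pos)
      (Eventually.of_forall fun y => (hΦ.contDiff.continuous.comp (hu y)).aestronglyMeasurable)
      ?_ ?_ ?_ ?_ ?_
    · refine h.congr_fderiv ?_
      exact ((innerSL ℝ).integral_comp_comm (hΦ.integrable_gradient_upd m j x))
    · have h1 : Integrable (fun X : Mk d k => D * (1 + (2 * ‖X‖ + ‖x‖) ^ 2)) (pw m.1 k) := by
        have : Integrable (fun X : Mk d k => D * (1 + (4 * ‖X‖ ^ 2 + (4 * ‖x‖) * ‖X‖ + ‖x‖ ^ 2)))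
            (pw m.1 k) := ((integrable_const 1).add (((hX2.const_mul 4).add
              (hX.const_mul _)).add (integrable_const _))).const_mul D
        refine this.congr (ae_of_all _ fun X => ?_)
        simp only
        ring
      refine h1.mono' (hΦ.contDiff.continuous.comp (hu x)).aestronglyMeasurable
        (ae_of_all _ fun X => (hD _).trans ?_)
      gcongr
      exact norm_upd_le j X x
    · exact ((innerSL ℝ).continuous.comp ((prj j).continuous.comp
        (hΦ.continuous_gradient.comp (hu x)))).aestronglyMeasurable
    · refine ae_of_all _ fun X y hy => ?_
      rw [innerSL_apply_norm]
      refine (norm_apply_le_norm _ _).trans ((hC _).trans ?_)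
      gcongr
      exact (norm_upd_le j X y).trans (by gcongr; exact hnx y hy)
    · exact ((integrable_const 1).add ((hX.const_mul 2).add
        (integrable_const (‖x‖ + 1)))).const_mul C
    · refine ae_of_all _ fun X y _ => ?_
      have h1 : HasFDerivAt (fun y => upd j X y) (inj j : Sp d →L[ℝ] Mk d k) y := by
        have h2 : (fun y => upd j X y) = fun y => inj j y + (X - inj j (X j)) := by
          funext y
          rw [upd, map_sub]
          abel
        rw [h2]
        exact (inj j).hasFDerivAt.add_const _
      have h3 := (hΦ.differentiable (upd j X y)).hasFDerivAt.comp y h1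
      refine h3.congr_fderiv ?_
      ext v
      rw [ContinuousLinearMap.comp_apply, ← inner_gradient_eq_fderiv, inner_inj_right]
      rfl
  have hsum : ∀ x, HasFDerivAt (fun x => ∑ j, ∫ X, Φ (upd j X x) ∂(pw m.1 k))
      (innerSL ℝ (gradField Φ m x)) x := by
    intro x
    have := HasFDerivAt.fun_sum (u := Finset.univ) fun j _ => hd j x
    refine this.congr_fderiv ?_
    rw [gradField, map_sum]
  have hgr : gradient (fun x => ∑ j, ∫ X, Φ (upd j X x) ∂(pw m.1 k)) = gradField Φ m := by
    funext x
    refine ext_inner_right ℝ fun v => ?_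
    rw [inner_gradient_eq_fderiv, (hsum x).fderiv]
    rfl
  have hC1 : IsC1Lin (fun x => ∑ j, ∫ X, Φ (upd j X x) ∂(pw m.1 k)) := by
    constructor
    · rw [contDiff_one_iff_fderiv]
      refine ⟨fun x => (hsum x).differentiableAt, ?_⟩
      have : fderiv ℝ (fun x => ∑ j, ∫ X, Φ (upd j X x) ∂(pw m.1 k)) =
          fun x => innerSL ℝ (gradField Φ m x) := funext fun x => (hsum x).fderiv
      rw [this]
      exact (innerSL ℝ).continuous.comp (hΦ.continuous_gradField m)
    · rw [hgr]
      have hI0 : 0 ≤ ∫ X : Mk d k, ‖X‖ ∂(pw m.1 k) := integral_nonneg fun _ => norm_nonneg _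
      refine ⟨k * (C * (1 + 2 * ∫ X : Mk d k, ‖X‖ ∂(pw m.1 k))), by positivity, fun x => ?_⟩
      refine (norm_gradField_le hC0 hC m x).trans ?_
      rw [mul_assoc, mul_assoc]
      gcongr
      nlinarith [mul_nonneg hI0 (norm_nonneg x), norm_nonneg x]
  rw [← hgr]
  exact hC1.isTangentField_gradient m

theorem integral_norm_sq_tup {S : Type*} [MeasurableSpace S] {γ : Measure S}
    [IsProbabilityMeasure γ] {w : S → Sp d} (hw : MemLp w 2 γ) :
    ∫ P : Fin k → S, ‖tup w P‖ ^ 2 ∂(Measure.pi fun _ => γ) = k * ∫ s, ‖w s‖ ^ 2 ∂γ := by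
  have hi : Integrable (fun s => ‖w s‖ ^ 2) γ := (memLp_two_iff_integrable_sq_norm hw.1).1 hw
  have hsq : ∀ P : Fin k → S, ‖tup w P‖ ^ 2 = ∑ j, ‖w (P j)‖ ^ 2 := fun P =>
    PiLp.norm_sq_eq_of_L2 _ (tup w P)
  simp_rw [hsq]
  rw [integral_finsetSum]
  · have : ∀ j : Fin k, ∫ P : Fin k → S, ‖w (P j)‖ ^ 2 ∂(Measure.pi fun _ => γ) =
        ∫ s, ‖w s‖ ^ 2 ∂γ := by
      intro j
      have hmp := measurePreserving_eval (fun _ : Fin k => γ) j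
      have hm : AEStronglyMeasurable (fun s => ‖w s‖ ^ 2)
          ((Measure.pi fun _ : Fin k => γ).map (Function.eval j)) := by
        rw [hmp.map_eq]
        exact hi.1
      rw [← integral_map hmp.measurable.aemeasurable hm, hmp.map_eq]
    simp [this]
  · intro j _
    exact (measurePreserving_eval (fun _ : Fin k => γ) j).integrable_comp_of_integrable hi

theorem tup_sub {S : Type*} (v w : S → Sp d) (P : Fin k → S) :
    tup (fun s => v s - w s) P = tup v P - tup w P := rfl

theorem IsC1Lin.integrable_pw (hΦ : IsC1Lin Φ) (m : P2 d) : Integrable Φ (pw m.1 k) := by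
  obtain ⟨D, hD0, hD⟩ := hΦ.exists_norm_le
  have hX2 : Integrable (fun X : Mk d k => ‖X‖ ^ 2) (pw m.1 k) :=
    (memLp_two_iff_integrable_sq_norm (memLp_pw_id m).1).1 (memLp_pw_id m)
  have h1 : Integrable (fun X : Mk d k => D * (1 + ‖X‖ ^ 2)) (pw m.1 k) :=
    ((integrable_const 1).add hX2).const_mul D
  exact h1.mono' hΦ.contDiff.continuous.aestronglyMeasurable (ae_of_all _ hD)

theorem integral_comp_tup {F : Type*} [NormedAddCommGroup F] [NormedSpace ℝ F] {S : Type*}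
    [MeasurableSpace S] {γ : Measure S}
    [IsProbabilityMeasure γ] {m : P2 d} {π : S → Sp d} (hπ : MeasurePreserving π γ m.1)
    {g : Mk d k → F} (hg : AEStronglyMeasurable g (pw m.1 k)) :
    ∫ P : Fin k → S, g (tup π P) ∂(Measure.pi fun _ => γ) = ∫ X, g X ∂(pw m.1 k) := by
  have ht : MeasurePreserving (tup π) (Measure.pi fun _ : Fin k => γ) (pw m.1 k) :=
    measurePreserving_tup hπ
  rw [← integral_map ht.measurable.aemeasurable (by rwa [ht.map_eq]), ht.map_eq]

/-- Apply `taylor_integral` to the two projections under `γ^k`; their root mean square distance is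
`√k W₂`. -/
theorem IsC1Lin.isStrongGradient (hΦ : IsC1Lin Φ) (m : P2 d) :
    IsStrongGradient (poly Φ) m (gradField Φ m) := by
  refine ⟨(hΦ.isTangentField_gradField m).memLp, fun ε hε => ?_⟩
  obtain ⟨C, hC0, hC⟩ := hΦ.growth
  have hk : 0 < √(k : ℝ) + 1 := by positivity
  obtain ⟨δ, hδ, H⟩ := hΦ.taylor_integral (memLp_pw_id m)
    (show 0 < ε / (√(k : ℝ) + 1) by positivity)
  -- The summand `1` keeps the denominator positive also for `k = 0`.
  refine ⟨δ / (√(k : ℝ) + 1), by positivity, fun ν hν γ hγ => ?_⟩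
  have hp := coupling_isProbabilityMeasure hγ.1
  have hfst := measurePreserving_fst_coupling hγ.1
  have hsnd := measurePreserving_snd_coupling hγ.1
  have hsub := memLp_sub_coupling hγ.1
  have hΔ : MemLp (fun P : Fin k → Sp d × Sp d => tup Prod.snd P - tup Prod.fst P) 2
      (Measure.pi fun _ => γ) := memLp_tup hsub
  have hsq : √(∫ P : Fin k → Sp d × Sp d, ‖tup Prod.snd P - tup Prod.fst P‖ ^ 2
      ∂(Measure.pi fun _ => γ)) = √(k : ℝ) * W2 m ν := by
    have := integral_norm_sq_tup (k := k) hsub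
    simp_rw [tup_sub] at this
    rw [this, integral_sq_optimalPlans hγ, Real.sqrt_mul (by positivity),
      Real.sqrt_sq (W2_nonneg _ _)]
  have hlt : √(k : ℝ) * W2 m ν < δ := by
    have h1 : W2 m ν * (√(k : ℝ) + 1) < δ := (lt_div_iff₀ hk).1 hν
    nlinarith [W2_nonneg m ν]
  have h1 := H (Measure.pi fun _ : Fin k => γ) (tup Prod.fst) (tup Prod.snd)
    (measurePreserving_tup hfst) hΔ (by rwa [hsq])
  have i1 : Integrable (fun P : Fin k → Sp d × Sp d => Φ (tup Prod.fst P))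
      (Measure.pi fun _ => γ) :=
    (measurePreserving_tup hfst).integrable_comp_of_integrable (hΦ.integrable_pw m)
  have i2 : Integrable (fun P : Fin k → Sp d × Sp d => Φ (tup Prod.snd P))
      (Measure.pi fun _ => γ) :=
    (measurePreserving_tup hsnd).integrable_comp_of_integrable (hΦ.integrable_pw ν)
  have hG : MemLp (fun P : Fin k → Sp d × Sp d => gradient Φ (tup Prod.fst P)) 2
      (Measure.pi fun _ => γ) := memLp_comp_of_linear_growth
    ((memLp_pw_id m).comp_measurePreserving (measurePreserving_tup hfst)) hΦ.continuous_gradient hC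
  have i3 := integrable_inner_of_memLp hG hΔ
  have i4 : Integrable (fun P : Fin k → Sp d × Sp d => Φ (tup Prod.snd P) - Φ (tup Prod.fst P))
      (Measure.pi fun _ => γ) := i2.sub i1
  rw [integral_sub i4 i3, integral_sub i2 i1, hsq,
    integral_comp_tup hsnd hΦ.contDiff.continuous.aestronglyMeasurable,
    integral_comp_tup hfst hΦ.contDiff.continuous.aestronglyMeasurable] at h1
  rw [hΦ.integral_inner_gradField hfst hsub]
  refine h1.trans ?_
  rw [← mul_assoc, div_mul_eq_mul_div]
  refine mul_le_mul_of_nonneg_right ?_ (W2_nonneg _ _)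
  rw [div_le_iff₀ hk]
  nlinarith

end

section

/-! ### Polynomials: Hessians -/

/-- `C²` functions with bounded second derivative having a concave modulus of continuity. -/
structure IsC2Mod {V : Type*} [NormedAddCommGroup V] [InnerProductSpace ℝ V] [CompleteSpace V]
    (Φ : V → ℝ) : Prop where
  contDiff : ContDiff ℝ 2 Φ
  bounded : ∃ C, 0 ≤ C ∧ ∀ x, ‖fderiv ℝ (gradient Φ) x‖ ≤ C
  modulus : ∃ ρ : ℝ → ℝ, IsConcaveModulus ρ ∧
    ∀ x y, ‖fderiv ℝ (gradient Φ) x - fderiv ℝ (gradient Φ) y‖ ≤ ρ ‖x - y‖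

/-- The inverse Riesz map as a continuous linear map over `ℝ`. -/
def rieszSymm (V : Type*) [NormedAddCommGroup V] [InnerProductSpace ℝ V] [CompleteSpace V] :
    StrongDual ℝ V →L[ℝ] V :=
  LinearMap.mkContinuous
    { toFun := fun f => (InnerProductSpace.toDual ℝ V).symm f
      map_add' := fun f g => map_add _ f g
      map_smul' := fun c f => by
        refine ext_inner_right ℝ fun v => ?_
        simp [inner_smul_left] } 1 (fun f => by simp)

section

variable {V : Type*} [NormedAddCommGroup V] [InnerProductSpace ℝ V] [CompleteSpace V] {Φ : V → ℝ}

theorem gradient_eq_rieszSymm : gradient Φ = fun x => rieszSymm V (fderiv ℝ Φ x) := rfl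

theorem inner_rieszSymm (f : StrongDual ℝ V) (v : V) : inner ℝ (rieszSymm V f) v = f v :=
  InnerProductSpace.toDual_symm_apply

theorem IsC2Mod.contDiff_gradient (h : IsC2Mod Φ) : ContDiff ℝ 1 (gradient Φ) :=
  (rieszSymm V).contDiff.comp (h.contDiff.fderiv_right (m := 1) (by norm_num))

theorem IsC2Mod.differentiable_gradient (h : IsC2Mod Φ) : Differentiable ℝ (gradient Φ) :=
  h.contDiff_gradient.differentiable one_ne_zero

theorem IsC2Mod.continuous_fderiv_gradient (h : IsC2Mod Φ) :
    Continuous (fderiv ℝ (gradient Φ)) := h.contDiff_gradient.continuous_fderiv one_ne_zero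

theorem IsC2Mod.isC1Lin (h : IsC2Mod Φ) : IsC1Lin Φ := by
  refine ⟨h.contDiff.of_le one_le_two, ?_⟩
  obtain ⟨C, hC0, hC⟩ := h.bounded
  refine ⟨‖gradient Φ 0‖ + C, by positivity, fun x => ?_⟩
  have h1 := Convex.norm_image_sub_le_of_norm_fderiv_le (𝕜 := ℝ) (f := gradient Φ)
    (fun y _ => h.differentiable_gradient y) (fun y _ => hC y) convex_univ (Set.mem_univ 0)
    (Set.mem_univ x)
  have h2 := norm_le_norm_add_norm_sub (gradient Φ 0) (gradient Φ x)
  rw [norm_sub_rev] at h2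
  rw [sub_zero] at h1
  nlinarith [norm_nonneg (gradient Φ 0), norm_nonneg x,
    mul_nonneg (norm_nonneg (gradient Φ 0)) (norm_nonneg x)]

end

variable {d k : ℕ} {Φ : Mk d k → ℝ}

/-- `X ↦ ⟨∇Φ(X), (ζ(X_j))_j⟩`. -/
def along (Φ : Mk d k → ℝ) (ζ : Sp d → Sp d) (X : Mk d k) : ℝ :=
  inner ℝ (gradient Φ X) (lift ζ X)

/-- A directional derivative of a polynomial is again a polynomial, so the first order theory can be
applied a second time. -/
theorem IsC1Lin.dirDeriv_poly (hΦ : IsC1Lin Φ) {ζ : Sp d → Sp d} (hζ : IsTestMap ζ) :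
    dirDeriv (poly Φ) ζ = poly (along Φ ζ) := by
  funext ν
  rw [(hΦ.isStrongGradient ν).dirDeriv_eq (hΦ.isTangentField_gradField ν),
    hΦ.pairing_gradField ν (hζ.memLp ν)]
  rfl

theorem hasFDerivAt_lift {ζ : Sp d → Sp d} (hζ : Differentiable ℝ ζ) (X : Mk d k) :
    HasFDerivAt (lift ζ : Mk d k → Mk d k)
      (∑ j, (inj j).comp ((fderiv ℝ ζ (X j)).comp (prj j))) X := by
  have h : (lift ζ : Mk d k → Mk d k) = fun X => ∑ j, inj j (ζ (prj j X)) :=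
    funext fun X => lift_eq_sum ζ X
  rw [h]
  refine HasFDerivAt.fun_sum fun j _ => ?_
  exact (inj j).hasFDerivAt.comp X ((hζ (prj j X)).hasFDerivAt.comp X (prj j).hasFDerivAt)

/-- `HasFDerivAt.fderiv` for normed spaces, where the instances are found by unification. -/
theorem fderiv_eq_of_hasFDerivAt {V W : Type*} [NormedAddCommGroup V] [NormedSpace ℝ V]
    [NormedAddCommGroup W] [NormedSpace ℝ W] {f : V → W} {L : V →L[ℝ] W} {x : V}
    (h : HasFDerivAt f L x) : fderiv ℝ f x = L := h.fderiv

theorem fderiv_lift_apply {ζ : Sp d → Sp d} (hζ : Differentiable ℝ ζ) (X v : Mk d k) :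
    fderiv ℝ (lift ζ : Mk d k → Mk d k) X v =
      (WithLp.toLp 2 (fun j => fderiv ℝ ζ (X j) (v j)) : Mk d k) := by
  rw [fderiv_eq_of_hasFDerivAt (hasFDerivAt_lift hζ X), _root_.sum_apply]
  exact sum_inj (WithLp.toLp 2 (fun j => fderiv ℝ ζ (X j) (v j)) : Mk d k)

theorem fderiv_along_apply (hΦ : IsC2Mod Φ) {ζ : Sp d → Sp d} (hζ : Differentiable ℝ ζ)
    (X v : Mk d k) : fderiv ℝ (along Φ ζ) X v =
      inner ℝ (fderiv ℝ (gradient Φ) X v) (lift ζ X) +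
      inner ℝ (gradient Φ X) (WithLp.toLp 2 (fun j => fderiv ℝ ζ (X j) (v j)) : Mk d k) := by
  have h := fderiv_inner_apply ℝ (hΦ.differentiable_gradient X)
    (hasFDerivAt_lift hζ X).differentiableAt v
  rw [fderiv_lift_apply hζ, add_comm] at h
  exact h

theorem norm_lift_le {ζ : Sp d → Sp d} {C : ℝ} (hC : ∀ x, ‖ζ x‖ ≤ C) (X : Mk d k) :
    ‖(lift ζ X : Mk d k)‖ ≤ k * C := by
  rw [lift_eq_sum]
  refine (norm_sum_le _ _).trans ?_
  refine (Finset.sum_le_sum fun j _ => (norm_inj j (ζ (X j))).le.trans (hC _)).trans ?_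
  simp

/-- In the product rule one term is a bounded Hessian times a bounded field, the other a gradient of
linear growth times a bounded derivative; the total has linear growth. -/
theorem IsC2Mod.isC1Lin_along (hΦ : IsC2Mod Φ) {ζ : Sp d → Sp d} (hζ : IsTestMap ζ) :
    IsC1Lin (along Φ ζ) := by
  have hζ1 : ContDiff ℝ 1 ζ := hζ.1.of_le (by simp)
  have hζd : Differentiable ℝ ζ := hζ1.differentiable one_ne_zero
  constructor
  · have h1 : ContDiff ℝ 1 (lift ζ : Mk d k → Mk d k) := by
      have h : (lift ζ : Mk d k → Mk d k) = fun X => ∑ j, inj j (ζ (prj j X)) :=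
        funext fun X => lift_eq_sum ζ X
      rw [h]
      exact ContDiff.sum fun j _ => (inj j).contDiff.comp (hζ1.comp (prj j).contDiff)
    exact hΦ.contDiff_gradient.inner ℝ h1
  · obtain ⟨C, hC0, hC⟩ := hΦ.bounded
    obtain ⟨A, hA0, hA⟩ := hΦ.isC1Lin.growth
    obtain ⟨B, hB0, hB⟩ := hζ.exists_bound
    obtain ⟨D, hD⟩ := (hζ.2.fderiv ℝ).exists_bound_of_continuous
      (hζ1.continuous_fderiv one_ne_zero)
    have hD0 : 0 ≤ D := (norm_nonneg _).trans (hD 0)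
    refine ⟨C * (k * B) + A * (k * D), by positivity, fun X => ?_⟩
    rw [gradient_eq_rieszSymm]
    have h0 : ‖rieszSymm (Mk d k) (fderiv ℝ (along Φ ζ) X)‖ = ‖fderiv ℝ (along Φ ζ) X‖ :=
      LinearIsometryEquiv.norm_map _ _
    rw [h0]
    refine ContinuousLinearMap.opNorm_le_bound _ (by positivity) fun v => ?_
    rw [fderiv_along_apply hΦ hζd]
    have h1 : ‖inner ℝ (fderiv ℝ (gradient Φ) X v) (lift ζ X)‖ ≤ C * ‖v‖ * (k * B) := by
      refine (norm_inner_le_norm _ _).trans ?_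
      refine mul_le_mul ?_ (norm_lift_le hB X) (norm_nonneg _) (by positivity)
      exact ((fderiv ℝ (gradient Φ) X).le_opNorm v).trans (by gcongr; exact hC X)
    have h2 : ‖inner ℝ (gradient Φ X)
        (WithLp.toLp 2 (fun j => fderiv ℝ ζ (X j) (v j)) : Mk d k)‖ ≤
        A * (1 + ‖X‖) * (k * (D * ‖v‖)) := by
      refine (norm_inner_le_norm _ _).trans ?_
      refine mul_le_mul (hA X) ?_ (norm_nonneg _) (by positivity)
      have h3 : (WithLp.toLp 2 (fun j => fderiv ℝ ζ (X j) (v j)) : Mk d k) =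
        ∑ j, inj j (fderiv ℝ ζ (X j) (v j)) := (sum_inj _).symm
      rw [h3]
      refine (norm_sum_le _ _).trans ?_
      refine (Finset.sum_le_sum (g := fun _ => D * ‖v‖) fun j _ => ?_).trans (by simp)
      rw [norm_inj]
      refine ((fderiv ℝ ζ (X j)).le_opNorm _).trans ?_
      exact mul_le_mul (hD _) (norm_apply_le_norm v j) (norm_nonneg _) hD0
    refine (norm_add_le _ _).trans ((add_le_add h1 h2).trans ?_)
    have h4 : 0 ≤ C * ‖v‖ * (k * B) * ‖X‖ := by positivity
    nlinarith

theorem lift_congr_ae {m : P2 d} {f g : Sp d → Sp d} (h : f =ᵐ[m.1] g) :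
    (lift f : Mk d k → Mk d k) =ᵐ[pw m.1 k] lift g := by
  have h1 : ∀ j : Fin k, ∀ᵐ X ∂(pw m.1 k), f (X j) = g (X j) := fun j =>
    (measurePreserving_prj j).quasiMeasurePreserving.ae h
  filter_upwards [ae_all_iff.2 h1] with X hX
  ext j : 1
  exact hX j

theorem integral_norm_sq_lift {m : P2 d} {f : Sp d → Sp d} (hf : MemLp f 2 m.1) :
    ∫ X, ‖lift f X‖ ^ 2 ∂(pw m.1 k) = k * ∫ x, ‖f x‖ ^ 2 ∂m.1 := by
  rw [← integral_norm_sq_tup hf]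
  exact (integral_comp_tup (MeasurePreserving.id m.1) (g := fun X => ‖lift f X‖ ^ 2)
    ((memLp_lift hf).1.norm.pow 2)).symm

/-- A bounded operator field applied to a square integrable field. -/
theorem memLp_clm_apply {V : Type*} [NormedAddCommGroup V] [NormedSpace ℝ V]
    {α : Type*} [MeasurableSpace α] {μ : Measure α} {A : α → V →L[ℝ] V}
    (hA : AEStronglyMeasurable A μ) {C : ℝ} (hC : ∀ x, ‖A x‖ ≤ C) {f : α → V}
    (hf : MemLp f 2 μ) : MemLp (fun x => A x (f x)) 2 μ :=
  hf.of_le_mul ((ContinuousLinearMap.id ℝ (V →L[ℝ] V)).aestronglyMeasurable_comp₂ hA hf.1) (ae_of_all _ fun x =>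
    ((A x).le_opNorm _).trans (by gcongr; exact hC x))

/-- `∫ ⟨D²Φ (f(X_j))_j, (g(X_j))_j⟩ dm^k`. -/
def hessInt (Φ : Mk d k → ℝ) (m : P2 d) (f g : Sp d → Sp d) : ℝ :=
  ∫ X, inner ℝ (fderiv ℝ (gradient Φ) X (lift f X)) (lift g X) ∂(pw m.1 k)

theorem hessInt_congr {m : P2 d} {f f' g g' : Sp d → Sp d} (hf : f =ᵐ[m.1] f')
    (hg : g =ᵐ[m.1] g') : hessInt Φ m f g = hessInt Φ m f' g' := by
  refine integral_congr_ae ?_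
  filter_upwards [lift_congr_ae (k := k) hf, lift_congr_ae (k := k) hg] with X h1 h2
  rw [h1, h2]

theorem IsC2Mod.memLp_fderiv_lift (hΦ : IsC2Mod Φ) {m : P2 d} {f : Sp d → Sp d}
    (hf : MemLp f 2 m.1) :
    MemLp (fun X => fderiv ℝ (gradient Φ) X (lift f X)) 2 (pw m.1 k) := by
  obtain ⟨C, hC0, hC⟩ := hΦ.bounded
  exact memLp_clm_apply hΦ.continuous_fderiv_gradient.aestronglyMeasurable hC (memLp_lift hf)

theorem IsC2Mod.integrable_hess (hΦ : IsC2Mod Φ) {m : P2 d} {f g : Sp d → Sp d}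
    (hf : MemLp f 2 m.1) (hg : MemLp g 2 m.1) :
    Integrable (fun X => inner ℝ (fderiv ℝ (gradient Φ) X (lift f X)) (lift g X)) (pw m.1 k) :=
  integrable_inner_of_memLp (hΦ.memLp_fderiv_lift hf) (memLp_lift hg)

/-- The integral does not depend on the representatives, and Cauchy–Schwarz with
`integral_norm_sq_lift` bounds it by `C k ‖f‖ ‖g‖`. -/
theorem exists_hessForm (hΦ : IsC2Mod Φ) (m : P2 d) :
    ∃ H : tangentSpace m →L[ℝ] tangentSpace m →L[ℝ] ℝ, ∀ f g, H f g = hessInt Φ m f.1 g.1 := by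
  obtain ⟨C, hC0, hC⟩ := hΦ.bounded
  let B : tangentSpace m →ₗ[ℝ] tangentSpace m →ₗ[ℝ] ℝ := LinearMap.mk₂ ℝ
    (fun f g => hessInt Φ m f.1 g.1)
    (fun f f' g => by
      refine (hessInt_congr (Lp.coeFn_add f.1 f'.1) (ae_eq_refl _)).trans ?_
      rw [hessInt, hessInt, hessInt,
        ← integral_add (hΦ.integrable_hess (Lp.memLp f.1) (Lp.memLp g.1))
          (hΦ.integrable_hess (Lp.memLp f'.1) (Lp.memLp g.1))]
      refine integral_congr_ae (ae_of_all _ fun X => ?_)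
      have : (lift (⇑f.1 + ⇑f'.1) X : Mk d k) = lift f.1 X + lift f'.1 X := rfl
      simp only [this, map_add, inner_add_left])
    (fun c f g => by
      refine (hessInt_congr (Lp.coeFn_smul c f.1) (ae_eq_refl _)).trans ?_
      rw [hessInt, hessInt, smul_eq_mul,
        ← integral_const_mul]
      refine integral_congr_ae (ae_of_all _ fun X => ?_)
      have : (lift (c • ⇑f.1) X : Mk d k) = c • lift f.1 X := rfl
      simp only [this, map_smul, real_inner_smul_left])
    (fun f g g' => by
      refine (hessInt_congr (ae_eq_refl _) (Lp.coeFn_add g.1 g'.1)).trans ?_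
      rw [hessInt, hessInt, hessInt,
        ← integral_add (hΦ.integrable_hess (Lp.memLp f.1) (Lp.memLp g.1))
          (hΦ.integrable_hess (Lp.memLp f.1) (Lp.memLp g'.1))]
      refine integral_congr_ae (ae_of_all _ fun X => ?_)
      have : (lift (⇑g.1 + ⇑g'.1) X : Mk d k) = lift g.1 X + lift g'.1 X := rfl
      simp only [this, inner_add_right])
    (fun c f g => by
      refine (hessInt_congr (ae_eq_refl _) (Lp.coeFn_smul c g.1)).trans ?_
      rw [hessInt, hessInt, smul_eq_mul,
        ← integral_const_mul]
      refine integral_congr_ae (ae_of_all _ fun X => ?_)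
      have : (lift (c • ⇑g.1) X : Mk d k) = c • lift g.1 X := rfl
      simp only [this, real_inner_smul_right])
  refine ⟨B.mkContinuous₂ (C * k) fun f g => ?_, fun f g => rfl⟩
  have hsq : ∀ f : tangentSpace m, √(∫ X, ‖lift f.1 X‖ ^ 2 ∂(pw m.1 k)) = √(k : ℝ) * ‖f‖ := by
    intro f
    rw [integral_norm_sq_lift (Lp.memLp f.1), Real.sqrt_mul (by positivity),
      ← norm_sq_eq_integral, Real.sqrt_sq (norm_nonneg _)]
    rfl
  change ‖hessInt Φ m f.1 g.1‖ ≤ _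
  have h1 := norm_integral_le_of_norm_le (μ := pw m.1 k)
    (f := fun X => inner ℝ (fderiv ℝ (gradient Φ) X (lift f.1 X)) (lift g.1 X))
    ((integrable_norm_mul_norm (memLp_lift (k := k) (Lp.memLp f.1))
      (memLp_lift (k := k) (Lp.memLp g.1))).const_mul C) (ae_of_all _ fun X => by
      refine (norm_inner_le_norm _ _).trans ?_
      rw [← mul_assoc]
      gcongr
      exact ((fderiv ℝ (gradient Φ) X).le_opNorm _).trans (by gcongr; exact hC X))
  rw [integral_const_mul] at h1
  refine h1.trans ?_
  have h2 := integral_norm_mul_norm_le (memLp_lift (k := k) (Lp.memLp f.1))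
    (memLp_lift (k := k) (Lp.memLp g.1))
  rw [hsq, hsq] at h2
  calc _ ≤ C * (√(k : ℝ) * ‖f‖ * (√(k : ℝ) * ‖g‖)) := by gcongr
    _ = C * (√(k : ℝ) * √(k : ℝ)) * ‖f‖ * ‖g‖ := by ring
    _ = _ := by rw [Real.mul_self_sqrt (by positivity)]

theorem IsTestMap.fderiv_apply {ζ η : Sp d → Sp d} (hζ : IsTestMap ζ) (hη : IsTestMap η) :
    IsTestMap (fun x => fderiv ℝ ζ x (η x)) := by
  refine ⟨(hζ.1.fderiv_right (m := ∞) (by simp)).clm_apply hη.1, ?_⟩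
  refine (hζ.2.fderiv ℝ).mono fun x hx => ?_
  rw [Function.mem_support] at hx ⊢
  intro h
  rw [h] at hx
  simp at hx

/-- Differentiating `⟨∇Φ, lift ∇ψ⟩` along `∇φ` produces the Hessian term and a term `⟨∇Φ, D(∇ψ)∇φ⟩`;
the correction in `hessBar` removes exactly the latter. -/
theorem IsC2Mod.hessBar_eq (hΦ : IsC2Mod Φ) (m : P2 d) {φ ψ : Sp d → ℝ} (hφ : IsTestMap φ)
    (hψ : IsTestMap ψ) : hessBar (poly Φ) m φ ψ = hessInt Φ m (gradient φ) (gradient ψ) := by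
  have gφ := isTestMap_gradient hφ
  have gψ := isTestMap_gradient hψ
  have hψd : Differentiable ℝ (gradient ψ) := gψ.1.differentiable (by simp)
  have hal := hΦ.isC1Lin_along gψ
  have hζ := gψ.fderiv_apply gφ
  obtain ⟨A, hA0, hA⟩ := hΦ.isC1Lin.growth
  have hG : MemLp (gradient Φ) 2 (pw m.1 k) :=
    memLp_comp_of_linear_growth (memLp_pw_id m) hΦ.isC1Lin.continuous_gradient hA
  rw [hessBar, hΦ.isC1Lin.dirDeriv_poly gψ, hal.dirDeriv_poly gφ, hΦ.isC1Lin.dirDeriv_poly hζ,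
    poly, poly, sub_eq_iff_eq_add, hessInt]
  refine Eq.trans ?_ (integral_add (hΦ.integrable_hess (gφ.memLp m) (gψ.memLp m))
    (integrable_inner_of_memLp hG (memLp_lift (hζ.memLp m))))
  refine integral_congr_ae (ae_of_all _ fun X => ?_)
  simp only [along]
  rw [inner_gradient_eq_fderiv, fderiv_along_apply hΦ hψd]
  rfl

theorem IsC2Mod.isWHessian (hΦ : IsC2Mod Φ) {m : P2 d}
    {H : tangentSpace m →L[ℝ] tangentSpace m →L[ℝ] ℝ}
    (hH : ∀ f g, H f g = hessInt Φ m f.1 g.1) : IsWHessian (poly Φ) m H := by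
  refine ⟨⟨1, one_pos, fun ν _ => (hΦ.isC1Lin.isStrongGradient ν).wDifferentiableAt⟩,
    fun ζ hζ => ?_, fun φ ψ hφ hψ f g hf hg => ?_⟩
  · rw [hΦ.isC1Lin.dirDeriv_poly hζ]
    exact ((hΦ.isC1Lin_along hζ).isStrongGradient m).wDifferentiableAt
  · rw [hH, hΦ.hessBar_eq m hφ hψ]
    exact hessInt_congr hf hg

/-- Density of test gradients in `T_m`. The closure is taken in `Lp` while `K` lives in the subtype,
so `K` is pushed forward by the inclusion, which is a closed embedding. -/
theorem tangentSpace_eq_top_of_isClosed {m : P2 d} (K : Submodule ℝ (tangentSpace m))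
    (hK : IsClosed (K : Set (tangentSpace m)))
    (h : ∀ φ : Sp d → ℝ, IsTestMap φ → ∀ f : tangentSpace m, f.1 =ᵐ[m.1] gradient φ → f ∈ K)
    (f : tangentSpace m) : f ∈ K := by
  have hT : IsClosed (tangentSpace m : Set (Lp (Sp d) 2 m.1)) :=
    Submodule.isClosed_topologicalClosure _
  have hcl : IsClosed (K.map (tangentSpace m).subtype : Set (Lp (Sp d) 2 m.1)) := by
    rw [Submodule.map_coe]
    exact hT.isClosedEmbedding_subtypeVal.isClosedMap _ hK
  have hle : tangentSpace m ≤ K.map (tangentSpace m).subtype := by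
    refine Submodule.topologicalClosure_minimal _ (Submodule.span_le.2 ?_) hcl
    rintro g ⟨φ, hφ, hg⟩
    have hgT : g ∈ tangentSpace m :=
      Submodule.le_topologicalClosure _ (Submodule.subset_span ⟨φ, hφ, hg⟩)
    exact ⟨⟨g, hgT⟩, h φ hφ ⟨g, hgT⟩ hg, rfl⟩
  obtain ⟨f', hf', he⟩ := hle f.2
  rwa [← Subtype.ext he]

/-- Continuous bilinear forms that agree on test gradients agree on `T_m`, one variable at a time.
Hence the chosen `wHessian` is the explicit form. -/
theorem IsWHessian.unique {U : P2 d → ℝ} {m : P2 d}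
    {H H' : tangentSpace m →L[ℝ] tangentSpace m →L[ℝ] ℝ} (h : IsWHessian U m H)
    (h' : IsWHessian U m H') : H = H' := by
  ext f g
  let K (g : tangentSpace m) : Submodule ℝ (tangentSpace m) :=
    LinearMap.ker ((H - H').flip g).toLinearMap
  let K' (f : tangentSpace m) : Submodule ℝ (tangentSpace m) :=
    LinearMap.ker ((H - H') f).toLinearMap
  have hK : ∀ g, IsClosed (K g : Set (tangentSpace m)) := fun g =>
    ((H - H').flip g).isClosed_ker
  have hK' : ∀ f, IsClosed (K' f : Set (tangentSpace m)) := fun f =>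
    ((H - H') f).isClosed_ker
  have key : g ∈ K' f := by
    refine tangentSpace_eq_top_of_isClosed (K' f) (hK' f) (fun ψ hψ g hg => ?_) g
    have : f ∈ K g := by
      refine tangentSpace_eq_top_of_isClosed (K g) (hK g) (fun φ hφ f hf => ?_) f
      have e1 := h.2.2 φ ψ hφ hψ f g hf hg
      have e2 := h'.2.2 φ ψ hφ hψ f g hf hg
      change H f g - H' f g = 0
      rw [e1, e2, sub_self]
    exact this
  exact sub_eq_zero.1 (show H f g - H' f g = 0 from key)

theorem IsC2Mod.hasWHessianAt (hΦ : IsC2Mod Φ) (m : P2 d) : HasWHessianAt (poly Φ) m := by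
  obtain ⟨H, hH⟩ := exists_hessForm hΦ m
  exact ⟨H, hΦ.isWHessian hH⟩

theorem IsC2Mod.wHessian_apply (hΦ : IsC2Mod Φ) (m : P2 d) (f g : tangentSpace m) :
    wHessian (poly Φ) m f g = hessInt Φ m f.1 g.1 := by
  obtain ⟨H, hH⟩ := exists_hessForm hΦ m
  have h1 := hΦ.hasWHessianAt m
  rw [wHessian, dif_pos h1, h1.choose_spec.unique (hΦ.isWHessian hH), hH]

/-! ### The moments and the Laplacian -/

/-- The `i`-th coordinate vector. -/
def stdVec (i : Fin d) : Sp d := EuclideanSpace.single i 1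

theorem inner_stdVec (i : Fin d) (x : Sp d) : inner ℝ (stdVec i) x = x i := by
  simp [stdVec, EuclideanSpace.inner_single_left]

/-- A constant field is the gradient of a linear function. Such a function has no compact support in
general, which is why the cutoff result for linear growth is needed. -/
theorem isTangentField_const (m : P2 d) (v : Sp d) : IsTangentField m (fun _ => v) := by
  have h1 : gradient (fun x : Sp d => inner ℝ v x) = fun _ => v := by
    funext x
    refine ext_inner_right ℝ fun w => ?_
    rw [inner_gradient_eq_fderiv]
    have : HasFDerivAt (fun x : Sp d => inner ℝ v x) (innerSL ℝ v) x :=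
      (innerSL ℝ v).hasFDerivAt
    rw [this.fderiv]
    rfl
  have h2 : IsC1Lin (fun x : Sp d => inner ℝ v x) := by
    refine ⟨(innerSL ℝ v).contDiff, ⟨‖v‖, norm_nonneg _, fun x => ?_⟩⟩
    rw [h1]
    nlinarith [norm_nonneg v, norm_nonneg x, mul_nonneg (norm_nonneg v) (norm_nonneg x)]
  have := h2.isTangentField_gradient m
  rwa [h1] at this

/-- The expansion is exact along every coupling, because the moment is linear in the measure with a
linear integrand. -/
theorem isStrongGradient_moment (i : Fin d) (m : P2 d) :
    IsStrongGradient (moment i) m (fun _ => stdVec i) := by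
  refine ⟨memLp_const _, fun ε hε => ⟨1, one_pos, fun ν _ γ hγ => ?_⟩⟩
  have hp := coupling_isProbabilityMeasure hγ.1
  have hfst := measurePreserving_fst_coupling hγ.1
  have hsnd := measurePreserving_snd_coupling hγ.1
  have hc : Continuous fun x : Sp d => x i := by fun_prop
  have e1 : moment i m = ∫ p, p.1 i ∂γ := by
    rw [moment, ← hfst.map_eq, integral_map hfst.measurable.aemeasurable hc.aestronglyMeasurable]
  have e2 : moment i ν = ∫ p, p.2 i ∂γ := by
    rw [moment, ← hsnd.map_eq, integral_map hsnd.measurable.aemeasurable hc.aestronglyMeasurable]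
  have hi : ∀ {ν : P2 d}, Integrable (fun x : Sp d => x i) ν.1 := fun {ν} =>
    ((memLp_id ν).integrable (by norm_num)).mono hc.aestronglyMeasurable
      (ae_of_all _ fun x => PiLp.norm_apply_le x i)
  have i1 : Integrable (fun p : Sp d × Sp d => p.1 i) γ := hfst.integrable_comp_of_integrable hi
  have i2 : Integrable (fun p : Sp d × Sp d => p.2 i) γ := hsnd.integrable_comp_of_integrable hi
  have e3 : ∫ p, inner ℝ (stdVec i) (p.2 - p.1) ∂γ = moment i ν - moment i m := by
    rw [e1, e2, ← integral_sub i2 i1]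
    refine integral_congr_ae (ae_of_all _ fun p => ?_)
    simp [inner_stdVec]
  rw [e3, sub_self, abs_zero]
  exact mul_nonneg hε.le (W2_nonneg _ _)

theorem momentGradient_ae_eq (m : P2 d) (i : Fin d) :
    (momentGradient m i).1 =ᵐ[m.1] fun _ => stdVec i := by
  have h1 := (isStrongGradient_moment i m).wGradient_ae_eq (isTangentField_const m _)
  have h2 : ∃ f : tangentSpace m, f.1 =ᵐ[m.1] wGradient (moment i) m := by
    obtain ⟨f, hf⟩ := isTangentField_const m (stdVec i)
    exact ⟨f, hf.trans h1.symm⟩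
  rw [momentGradient, toTangent, dif_pos h2]
  exact h2.choose_spec.trans h1

/-- The vector `(v, …, v)`. -/
def diagVec (k : ℕ) (v : Sp d) : Mk d k := WithLp.toLp 2 (fun _ => v)

/-- `∑ i, ⟨D²Φ (e_i, …, e_i), (e_i, …, e_i)⟩`. -/
def lapDiag (Φ : Mk d k → ℝ) (X : Mk d k) : ℝ :=
  ∑ i : Fin d, inner ℝ (fderiv ℝ (gradient Φ) X (diagVec k (stdVec i))) (diagVec k (stdVec i))

theorem IsC2Mod.wHessian_momentGradient (hΦ : IsC2Mod Φ) (m : P2 d) (i : Fin d) :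
    wHessian (poly Φ) m (momentGradient m i) (momentGradient m i) =
      ∫ X, inner ℝ (fderiv ℝ (gradient Φ) X (diagVec k (stdVec i))) (diagVec k (stdVec i))
        ∂(pw m.1 k) := by
  rw [hΦ.wHessian_apply, hessInt_congr (momentGradient_ae_eq m i) (momentGradient_ae_eq m i)]
  rfl

theorem IsC2Mod.integrable_fderiv_gradient (hΦ : IsC2Mod Φ) (m : P2 d) (v w : Mk d k) :
    Integrable (fun X => inner ℝ (fderiv ℝ (gradient Φ) X v) w) (pw m.1 k) := by
  obtain ⟨C, hC0, hC⟩ := hΦ.bounded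
  exact integrable_inner_of_memLp
    (memLp_clm_apply hΦ.continuous_fderiv_gradient.aestronglyMeasurable hC (memLp_const v))
    (memLp_const w)

/-- The moment gradients are constant, and `lift` of the constant `e_i` is the diagonal vector
`(e_i, …, e_i)`. -/
theorem IsC2Mod.wLaplacian_poly (hΦ : IsC2Mod Φ) (m : P2 d) :
    wLaplacian (poly Φ) m = poly (lapDiag Φ) m := by
  rw [wLaplacian, poly]
  simp_rw [hΦ.wHessian_momentGradient]
  unfold lapDiag
  rw [integral_finsetSum]
  exact fun i _ => hΦ.integrable_fderiv_gradient m _ _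

end

section

/-! ### Polynomials: second order expansion -/

variable {d k : ℕ} {Φ : Mk d k → ℝ}

/-- The block `∂_j ∂_i Φ` of the second derivative. -/
def blk (Φ : Mk d k → ℝ) (j i : Fin k) (X : Mk d k) : Sp d →L[ℝ] Sp d :=
  (prj j).comp ((fderiv ℝ (gradient Φ) X).comp (inj i))

theorem blk_apply (j i : Fin k) (X : Mk d k) (v : Sp d) :
    blk Φ j i X v = (fderiv ℝ (gradient Φ) X (inj i v)) j := rfl

theorem norm_blk_le {C : ℝ} (hC0 : 0 ≤ C) (hC : ∀ x, ‖fderiv ℝ (gradient Φ) x‖ ≤ C)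
    (j i : Fin k) (X : Mk d k) : ‖blk Φ j i X‖ ≤ C := by
  refine ContinuousLinearMap.opNorm_le_bound _ hC0 fun v => ?_
  rw [blk_apply]
  refine (norm_apply_le_norm _ j).trans (((fderiv ℝ (gradient Φ) X).le_opNorm _).trans ?_)
  rw [norm_inj]
  gcongr
  exact hC X

theorem IsC2Mod.continuous_blk (hΦ : IsC2Mod Φ) (j i : Fin k) : Continuous (blk Φ j i) :=
  continuous_const.clm_comp (hΦ.continuous_fderiv_gradient.clm_comp continuous_const)

/-- The field `Ã[m]` of `poly Φ`. -/
def hessLoc (Φ : Mk d k → ℝ) (m : P2 d) (x : Sp d) : Sp d →L[ℝ] Sp d :=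
  ∑ j, ∫ X, blk Φ j j (upd j X x) ∂(pw m.1 k)

/-- The field `A_{mm}` of `poly Φ`. -/
def hessNonloc (Φ : Mk d k → ℝ) (m : P2 d) (x a : Sp d) : Sp d →L[ℝ] Sp d :=
  ∑ j, ∑ i ∈ Finset.univ.erase j, ∫ X, blk Φ j i (upd j (upd i X a) x) ∂(pw m.1 k)

theorem IsC2Mod.continuous_integral_blk (hΦ : IsC2Mod Φ) (m : P2 d) (j i : Fin k) {Z : Type*}
    [NormedAddCommGroup Z] {u : Z → Mk d k → Mk d k} (hu : Continuous (Function.uncurry u))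
    {A B : ℝ} (hB : 0 ≤ B) (hb : ∀ z X, ‖u z X‖ ≤ A * ‖X‖ + B * ‖z‖) :
    Continuous fun z => ∫ X, blk Φ j i (u z X) ∂(pw m.1 k) := by
  obtain ⟨C, hC0, hC⟩ := hΦ.bounded
  refine continuous_integral_of_linear_growth (memLp_pw_id m) (hΦ.continuous_blk j i) hC0
    (fun X => (norm_blk_le hC0 hC j i X).trans ?_) hu hB hb
  nlinarith [norm_nonneg X]

theorem IsC2Mod.continuous_hessLoc (hΦ : IsC2Mod Φ) (m : P2 d) : Continuous (hessLoc Φ m) := by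
  refine continuous_finsetSum _ fun j _ => ?_
  refine hΦ.continuous_integral_blk m j j (u := fun x X => upd j X x)
    ((continuous_upd j).comp continuous_swap) (A := 2) zero_le_one (fun x X => ?_)
  rw [one_mul]
  exact norm_upd_le j X x

theorem IsC2Mod.continuous_hessNonloc (hΦ : IsC2Mod Φ) (m : P2 d) :
    Continuous (Function.uncurry (hessNonloc Φ m)) := by
  suffices h : Continuous fun z : Sp d × Sp d => ∑ j, ∑ i ∈ Finset.univ.erase j,
      ∫ X, blk Φ j i (upd j (upd i X z.2) z.1) ∂(pw m.1 k) from h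
  refine continuous_finsetSum _ fun j _ => ?_
  refine continuous_finsetSum _ fun i _ => ?_
  refine hΦ.continuous_integral_blk m j i
    (u := fun (z : Sp d × Sp d) X => upd j (upd i X z.2) z.1)
    ?_ (A := 4) (show (0 : ℝ) ≤ 3 by norm_num) (fun z X => ?_)
  · have h1 : Continuous fun q : (Sp d × Sp d) × Mk d k => upd i q.2 q.1.2 :=
      (continuous_upd i).comp (continuous_snd.prodMk (continuous_snd.comp continuous_fst))
    exact (continuous_upd j).comp (h1.prodMk (continuous_fst.comp continuous_fst))
  · have h1 := norm_upd_le j (upd i X z.2) z.1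
    have h2 := norm_upd_le i X z.2
    linarith [norm_fst_le z, norm_snd_le z]

theorem norm_integral_blk_le {C : ℝ} (hC0 : 0 ≤ C) (hC : ∀ x, ‖fderiv ℝ (gradient Φ) x‖ ≤ C)
    (m : P2 d) (j i : Fin k) (u : Mk d k → Mk d k) :
    ‖∫ X, blk Φ j i (u X) ∂(pw m.1 k)‖ ≤ C := by
  have := norm_integral_le_of_norm_le_const (μ := pw m.1 k)
    (ae_of_all _ fun X => norm_blk_le hC0 hC j i (u X))
  simpa using this

theorem norm_hessLoc_le {C : ℝ} (hC0 : 0 ≤ C) (hC : ∀ x, ‖fderiv ℝ (gradient Φ) x‖ ≤ C)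
    (m : P2 d) (x : Sp d) : ‖hessLoc Φ m x‖ ≤ k * C := by
  refine (norm_sum_le _ _).trans ((Finset.sum_le_sum fun j _ =>
    norm_integral_blk_le hC0 hC m j j _).trans ?_)
  simp

theorem norm_hessNonloc_le {C : ℝ} (hC0 : 0 ≤ C) (hC : ∀ x, ‖fderiv ℝ (gradient Φ) x‖ ≤ C)
    (m : P2 d) (x a : Sp d) : ‖hessNonloc Φ m x a‖ ≤ k * (k * C) := by
  refine (norm_sum_le _ _).trans ((Finset.sum_le_sum (g := fun _ => k * C) fun j _ => ?_).trans ?_)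
  · refine (norm_sum_le _ _).trans ((Finset.sum_le_sum fun i _ =>
      norm_integral_blk_le hC0 hC m j i _).trans ?_)
    rw [Finset.sum_const, nsmul_eq_mul]
    gcongr
    simp
  · simp

theorem IsConcaveModulus.nonneg {ρ : ℝ → ℝ} (h : IsConcaveModulus ρ) {t : ℝ} (ht : 0 ≤ t) :
    0 ≤ ρ t := by
  rw [← h.map_zero]
  exact h.monotoneOn Set.self_mem_Ici ht ht

/-- The larger of the two arguments dominates: for `a ≤ b`, `a + b ≤ 2b` and `ρ(a + b) ≤ 2ρ(b)`. -/
theorem IsConcaveModulus.mul_add_le {ρ : ℝ → ℝ} (h : IsConcaveModulus ρ) {a b : ℝ} (ha : 0 ≤ a)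
    (hb : 0 ≤ b) : ρ (a + b) * (a + b) ≤ a * (4 * ρ a) + 4 * (b * ρ b) := by
  have key : ∀ {a b : ℝ}, 0 ≤ a → a ≤ b → ρ (a + b) * (a + b) ≤ 4 * (b * ρ b) := by
    intro a b ha hab
    have hb := ha.trans hab
    have h1 : ρ (a + b) ≤ 2 * ρ b := by
      have h2 := h.monotoneOn (show a + b ∈ Set.Ici (0 : ℝ) from by
        rw [Set.mem_Ici]; positivity) (show b + b ∈ Set.Ici (0 : ℝ) from by
        rw [Set.mem_Ici]; positivity) (by linarith)
      linarith [h.subadditive b b hb hb]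
    calc ρ (a + b) * (a + b) ≤ (2 * ρ b) * (2 * b) :=
          mul_le_mul h1 (by linarith) (by linarith) (by linarith [h.nonneg hb])
      _ = _ := by ring
  have na := mul_nonneg ha (h.nonneg ha)
  have nb := mul_nonneg hb (h.nonneg hb)
  rcases le_total a b with hab | hab
  · linarith [key ha hab]
  · have := key hb hab
    rw [add_comm b a] at this
    linarith

/-- For `b ≤ s` use monotonicity; for `b > s` concavity and `ρ 0 = 0` give `ρ(b)/b ≤ ρ(s)/s`. The
right side is quadratic in `b`, so it can be integrated knowing only second moments; with `s` the
root mean square the result is at most `2sρ(s)`. -/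
theorem IsConcaveModulus.le_of_pos {ρ : ℝ → ℝ} (h : IsConcaveModulus ρ) {b s : ℝ} (hb : 0 ≤ b)
    (hs : 0 < s) : b * ρ b ≤ ρ s * (b + b ^ 2 / s) := by
  have hρs := h.nonneg hs.le
  rcases le_or_gt b s with hbs | hbs
  · have h1 : ρ b ≤ ρ s := h.monotoneOn hb hs.le hbs
    have h2 : 0 ≤ ρ s * (b ^ 2 / s) := by positivity
    nlinarith
  · have hb' : 0 < b := hs.trans hbs
    have h1 := h.concaveOn.2 (show b ∈ Set.Ici (0 : ℝ) from hb) (show (0 : ℝ) ∈ Set.Ici (0 : ℝ) from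
      Set.self_mem_Ici) (show 0 ≤ s / b by positivity)
      (show 0 ≤ 1 - s / b by rw [sub_nonneg, div_le_one hb']; exact hbs.le) (by ring)
    simp only [smul_eq_mul, h.map_zero, mul_zero, add_zero] at h1
    rw [div_mul_cancel₀ _ hb'.ne'] at h1
    have h2 : ρ b ≤ b / s * ρ s := by
      calc ρ b = b / s * (s / b * ρ b) := by field_simp
        _ ≤ _ := by gcongr
    have h3 : 0 ≤ ρ s * b := by positivity
    calc b * ρ b ≤ b * (b / s * ρ s) := by gcongr
      _ = ρ s * (b ^ 2 / s) := by ring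
      _ ≤ _ := by linarith

theorem IsConcaveModulus.const_mul {ρ : ℝ → ℝ} (h : IsConcaveModulus ρ) {c : ℝ} (hc : 0 ≤ c) :
    IsConcaveModulus fun t => c * ρ t where
  continuousOn := continuousOn_const.mul h.continuousOn
  monotoneOn := fun _ hs _ ht hst => mul_le_mul_of_nonneg_left (h.monotoneOn hs ht hst) hc
  subadditive := fun s t hs ht => by
    rw [← mul_add]
    exact mul_le_mul_of_nonneg_left (h.subadditive s t hs ht) hc
  map_zero := by rw [h.map_zero, mul_zero]
  concaveOn := h.concaveOn.smul hc

/-- Integrating a remainder controlled by a concave modulus. -/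
theorem IsConcaveModulus.norm_integral_le {ρ : ℝ → ℝ} (h : IsConcaveModulus ρ) {α V F : Type*}
    [MeasurableSpace α] {μ : Measure α} [IsProbabilityMeasure μ] [NormedAddCommGroup V]
    [NormedAddCommGroup F] [NormedSpace ℝ F] {f : α → V} (hf : MemLp f 2 μ) {E : α → F} {a : ℝ}
    (ha : 0 ≤ a) (hE : ∀ x, ‖E x‖ ≤ ρ (a + ‖f x‖) * (a + ‖f x‖)) :
    ‖∫ x, E x ∂μ‖ ≤ a * (4 * ρ a) +
      8 * (√(∫ x, ‖f x‖ ^ 2 ∂μ) * ρ (√(∫ x, ‖f x‖ ^ 2 ∂μ))) := by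
  set s := √(∫ x, ‖f x‖ ^ 2 ∂μ) with hs
  have hs0 : 0 ≤ s := Real.sqrt_nonneg _
  have hi1 : Integrable (fun x => ‖f x‖) μ := (hf.integrable (by norm_num)).norm
  have hi2 : Integrable (fun x => ‖f x‖ ^ 2) μ := (memLp_two_iff_integrable_sq_norm hf.1).1 hf
  have hsq : ∫ x, ‖f x‖ ^ 2 ∂μ = s ^ 2 := by
    rw [hs, Real.sq_sqrt (integral_nonneg fun _ => by positivity)]
  -- For `s = 0` the bound `le_of_pos` is not available, but then `f` vanishes almost everywhere.
  have hae : ∀ᵐ x ∂μ, ‖f x‖ * ρ ‖f x‖ ≤ ρ s * (‖f x‖ + ‖f x‖ ^ 2 / s) := by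
    rcases hs0.eq_or_lt with h0 | h0
    · rw [← h0, zero_pow two_ne_zero, integral_eq_zero_iff_of_nonneg (fun _ => by positivity) hi2]
        at hsq
      filter_upwards [hsq] with x hx
      have : ‖f x‖ = 0 := pow_eq_zero_iff two_ne_zero |>.1 hx
      simp [this]
    · exact ae_of_all _ fun x => h.le_of_pos (norm_nonneg _) h0
  have hi3 : Integrable (fun x => ‖f x‖ + ‖f x‖ ^ 2 / s) μ := hi1.add (hi2.div_const _)
  have h1 := norm_integral_le_of_norm_le (f := E)
    (g := fun x => a * (4 * ρ a) + 4 * (ρ s * (‖f x‖ + ‖f x‖ ^ 2 / s)))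
    ((integrable_const _).add ((hi3.const_mul _).const_mul _)) (by
      filter_upwards [hae] with x hx
      refine (hE x).trans ((h.mul_add_le ha (norm_nonneg _)).trans ?_)
      linarith)
  refine h1.trans ?_
  have h5 : ∫ x, 4 * (ρ s * (‖f x‖ + ‖f x‖ ^ 2 / s)) ∂μ =
      4 * (ρ s * (∫ x, ‖f x‖ ∂μ + s ^ 2 / s)) := by
    rw [integral_const_mul, integral_const_mul, integral_add hi1 (hi2.div_const _), integral_div,
      hsq]
  rw [integral_add (integrable_const _) ((hi3.const_mul _).const_mul _), h5]
  have h2 : ∫ x, ‖f x‖ ∂μ ≤ s := integral_norm_le_sqrt hf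
  have h3 : s ^ 2 / s = s := by rw [pow_two, mul_self_div_self]
  rw [h3]
  have h4 := mul_le_mul_of_nonneg_left h2 (h.nonneg hs0)
  simp only [integral_const, probReal_univ, one_smul]
  nlinarith

theorem upd_sub (j : Fin k) (X Y : Mk d k) (x y : Sp d) :
    upd j Y y - upd j X x = upd j (Y - X) (y - x) := by
  unfold upd
  have h : y - x - (Y - X : Mk d k) j = (y - Y j) - (x - X j) := by
    rw [PiLp.sub_apply]
    abel
  rw [h, map_sub (inj j) (y - Y j)]
  abel

theorem upd_eq_add_sum (j : Fin k) (Z : Mk d k) (z : Sp d) :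
    upd j Z z = inj j z + ∑ i ∈ Finset.univ.erase j, inj i (Z i) := by
  have h := sum_inj Z
  rw [← Finset.add_sum_erase _ _ (Finset.mem_univ j)] at h
  rw [upd, map_sub]
  nth_rewrite 1 [← h]
  abel

theorem IsC2Mod.norm_taylor_le (hΦ : IsC2Mod Φ) {ρ : ℝ → ℝ} (hρ : IsConcaveModulus ρ)
    (hmod : ∀ x y, ‖fderiv ℝ (gradient Φ) x - fderiv ℝ (gradient Φ) y‖ ≤ ρ ‖x - y‖)
    (X Y : Mk d k) {t : ℝ} (ht : ‖Y - X‖ ≤ t) :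
    ‖gradient Φ Y - gradient Φ X - fderiv ℝ (gradient Φ) X (Y - X)‖ ≤ ρ t * t := by
  have ht0 := (norm_nonneg _).trans ht
  have h := (convex_segment X Y).norm_image_sub_le_of_norm_fderiv_le' (𝕜 := ℝ) (f := gradient Φ)
    (φ := fderiv ℝ (gradient Φ) X) (C := ρ t)
    (fun z _ => hΦ.differentiable_gradient z) (fun z hz => (hmod z X).trans
      (hρ.monotoneOn (norm_nonneg _) ht0 ((norm_sub_le_of_mem_segment hz).trans ht)))
    (left_mem_segment ℝ X Y) (right_mem_segment ℝ X Y)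
  exact h.trans (mul_le_mul_of_nonneg_left ht (hρ.nonneg ht0))

/-- The redrawing argument of `integral_inner_gradField`, now for operator kernels: coordinate `i`
is separated and the remaining ones are averaged inside the kernel. -/
theorem integral_clm_redraw {K : Mk d k → Sp d →L[ℝ] Sp d} (hK : Continuous K) {C : ℝ}
    (hC : ∀ X, ‖K X‖ ≤ C) {S : Type*} [MeasurableSpace S] {γ : Measure S}
    [IsProbabilityMeasure γ] {m : P2 d} {π : S → Sp d} (hπ : MeasurePreserving π γ m.1)
    {w : S → Sp d} (hw : MemLp w 2 γ) (i : Fin k) :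
    Integrable (fun P : Fin k → S => K (tup π P) (w (P i))) (Measure.pi fun _ => γ) ∧
    Integrable (fun s => (∫ X, K (upd i X (π s)) ∂(pw m.1 k)) (w s)) γ ∧
    ∫ s, (∫ X, K (upd i X (π s)) ∂(pw m.1 k)) (w s) ∂γ =
      ∫ P : Fin k → S, K (tup π P) (w (P i)) ∂(Measure.pi fun _ => γ) := by
  have ht : MeasurePreserving (tup π) (Measure.pi fun _ : Fin k => γ) (pw m.1 k) :=
    measurePreserving_tup hπ
  have hint : Integrable (fun P : Fin k → S => K (tup π P) (w (P i))) (Measure.pi fun _ => γ) :=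
    (memLp_clm_apply (hK.comp_aestronglyMeasurable ht.measurable.aestronglyMeasurable)
      (fun P => hC _) (hw.comp_measurePreserving
        (measurePreserving_eval (fun _ => γ) i))).integrable (by norm_num)
  have hmp := measurePreserving_update γ i
  have hI := hmp.integrable_comp_of_integrable hint
  have h1 : ∀ s, ∫ P : Fin k → S, K (tup π (Function.update P i s))
      (w (Function.update P i s i)) ∂(Measure.pi fun _ => γ) =
      (∫ X, K (upd i X (π s)) ∂(pw m.1 k)) (w s) := by
    intro s
    have hm : AEStronglyMeasurable (fun X => K (upd i X (π s))) (pw m.1 k) :=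
      (hK.comp ((continuous_upd i).comp
        (continuous_id.prodMk continuous_const))).aestronglyMeasurable
    have hi : Integrable (fun X => K (upd i X (π s))) (pw m.1 k) :=
      (integrable_const C).mono' hm (ae_of_all _ fun X => hC _)
    have hi' : Integrable (fun P : Fin k → S => K (upd i (tup π P) (π s)))
        (Measure.pi fun _ => γ) := ht.integrable_comp_of_integrable hi
    rw [← integral_comp_tup hπ hm, ContinuousLinearMap.integral_apply hi']
    refine integral_congr_ae (ae_of_all _ fun P => ?_)
    simp only
    rw [tup_update, Function.update_self]
  refine ⟨hint, hI.integral_prod_right.congr (ae_of_all _ fun s => h1 s), ?_⟩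
  rw [← hmp.map_eq, integral_map hmp.measurable.aemeasurable (by rw [hmp.map_eq]; exact hint.1)]
  refine Eq.symm ((integral_prod_symm _ hI).trans ?_)
  exact integral_congr_ae (ae_of_all _ fun s => h1 s)

/-- The factor `2` anticipates `norm_upd_le`, where replacing an entry costs twice the norm of the
tuple. -/
theorem sqrt_integral_norm_sq_two_tup {m ν : P2 d} {γ : Measure (Sp d × Sp d)}
    (hγ : γ ∈ optimalPlans m ν) :
    √(∫ P : Fin k → Sp d × Sp d, ‖(2 : ℝ) • (tup Prod.snd P - tup Prod.fst P : Mk d k)‖ ^ 2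
      ∂(Measure.pi fun _ => γ)) = 2 * √(k : ℝ) * W2 m ν := by
  have hp := coupling_isProbabilityMeasure hγ.1
  have := integral_norm_sq_tup (k := k) (memLp_sub_coupling hγ.1)
  simp_rw [tup_sub] at this
  simp_rw [norm_smul, mul_pow]
  rw [integral_const_mul, this, integral_sq_optimalPlans hγ, Real.sqrt_mul (by positivity),
    Real.sqrt_mul (by positivity), Real.sqrt_sq (W2_nonneg _ _), Real.sqrt_sq (by positivity)]
  norm_num [mul_assoc]

/-- Under `γ^k`, expand the `j`-th block of `∇Φ` between the tuples with `j`-th entry replaced by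
`x` and by `y`. The block `(j, j)` acts on `y - x` and averages to `hessLoc`; the blocks `(j, i)`,
`i ≠ j`, act on the displacements of the plan and average to `hessNonloc`. The remainder is
integrated by `IsConcaveModulus.norm_integral_le`. -/
theorem IsC2Mod.norm_gradField_expansion_le (hΦ : IsC2Mod Φ) {ρ : ℝ → ℝ} (hρ : IsConcaveModulus ρ)
    (hmod : ∀ x y, ‖fderiv ℝ (gradient Φ) x - fderiv ℝ (gradient Φ) y‖ ≤ ρ ‖x - y‖)
    {m ν : P2 d} {γ : Measure (Sp d × Sp d)} (hγ : γ ∈ optimalPlans m ν) (x y : Sp d) :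
    ‖gradField Φ ν y - gradField Φ m x -
      (hessLoc Φ m x (y - x) + ∫ p, hessNonloc Φ m x p.1 (p.2 - p.1) ∂γ)‖ ≤
      ‖x - y‖ * (4 * k * ρ ‖x - y‖) +
        W2 m ν * (16 * k * √(k : ℝ) * ρ (2 * √(k : ℝ) * W2 m ν)) := by
  have hp := coupling_isProbabilityMeasure hγ.1
  have hfst := measurePreserving_fst_coupling hγ.1
  have hsnd := measurePreserving_snd_coupling hγ.1
  have hsub := memLp_sub_coupling hγ.1
  obtain ⟨C, hC0, hC⟩ := hΦ.bounded
  have tfst : MeasurePreserving (tup Prod.fst) (Measure.pi fun _ : Fin k => γ) (pw m.1 k) :=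
    measurePreserving_tup hfst
  have tsnd : MeasurePreserving (tup Prod.snd) (Measure.pi fun _ : Fin k => γ) (pw ν.1 k) :=
    measurePreserving_tup hsnd
  have hΔ : MemLp (fun P : Fin k → Sp d × Sp d => (2 : ℝ) • (tup Prod.snd P - tup Prod.fst P)) 2
      (Measure.pi fun _ => γ) := by
    have h : MemLp (fun P : Fin k → Sp d × Sp d => (tup Prod.snd P - tup Prod.fst P : Mk d k)) 2
      (Measure.pi fun _ => γ) := memLp_tup hsub
    exact h.const_smul (2 : ℝ)
  -- `E j P` is the `j`-th component of the Taylor remainder of `∇Φ`, written in blocks so that its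
  -- integral can be evaluated term by term.
  set E : Fin k → (Fin k → Sp d × Sp d) → Sp d := fun j P =>
    (gradient Φ (upd j (tup Prod.snd P) y)) j - (gradient Φ (upd j (tup Prod.fst P) x)) j -
      (blk Φ j j (upd j (tup Prod.fst P) x) (y - x) + ∑ i ∈ Finset.univ.erase j,
        blk Φ j i (upd j (tup Prod.fst P) x) ((P i).2 - (P i).1)) with hEdef
  have hE : ∀ j P, ‖E j P‖ ≤ ρ (‖x - y‖ + ‖(2 : ℝ) • (tup Prod.snd P - tup Prod.fst P : Mk d k)‖) *
      (‖x - y‖ + ‖(2 : ℝ) • (tup Prod.snd P - tup Prod.fst P : Mk d k)‖) := by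
    intro j P
    have h1 : E j P = (gradient Φ (upd j (tup Prod.snd P) y) - gradient Φ (upd j (tup Prod.fst P) x)
        - fderiv ℝ (gradient Φ) (upd j (tup Prod.fst P) x)
          (upd j (tup Prod.snd P) y - upd j (tup Prod.fst P) x)) j := by
      rw [upd_sub, upd_eq_add_sum j (tup Prod.snd P - tup Prod.fst P), map_add, map_sum]
      simp only [hEdef, blk_apply]
      rw [PiLp.sub_apply, PiLp.sub_apply, PiLp.add_apply]
      congr 2
      rw [← prj_apply j (∑ i ∈ _, _), map_sum]
      rfl
    rw [h1]
    refine (norm_apply_le_norm _ j).trans (hΦ.norm_taylor_le hρ hmod _ _ ?_)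
    rw [upd_sub]
    refine (norm_upd_le _ _ _).trans (le_of_eq ?_)
    rw [norm_smul, norm_sub_rev x y]
    simp [add_comm]
  have hblk : ∀ j i : Fin k, Continuous fun X => blk Φ j i (upd j X x) := fun j i =>
    (hΦ.continuous_blk j i).comp ((continuous_upd j).comp
      (continuous_id.prodMk continuous_const))
  have hred := fun j i : Fin k => integral_clm_redraw (hblk j i)
    (fun X => norm_blk_le hC0 hC j i _) hfst hsub i
  have i1 : ∀ j : Fin k, Integrable (fun P : Fin k → Sp d × Sp d =>
      (gradient Φ (upd j (tup Prod.snd P) y)) j) (Measure.pi fun _ => γ) := fun j =>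
    tsnd.integrable_comp_of_integrable (hΦ.isC1Lin.integrable_gradient_upd ν j y)
  have i2 : ∀ j : Fin k, Integrable (fun P : Fin k → Sp d × Sp d =>
      (gradient Φ (upd j (tup Prod.fst P) x)) j) (Measure.pi fun _ => γ) := fun j =>
    tfst.integrable_comp_of_integrable (hΦ.isC1Lin.integrable_gradient_upd m j x)
  have i3' : ∀ j : Fin k, Integrable (fun X => blk Φ j j (upd j X x)) (pw m.1 k) := fun j =>
    (integrable_const C).mono' (hblk j j).aestronglyMeasurable
      (ae_of_all _ fun X => norm_blk_le hC0 hC j j _)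
  have i3 : ∀ j : Fin k, Integrable (fun P : Fin k → Sp d × Sp d =>
      blk Φ j j (upd j (tup Prod.fst P) x) (y - x)) (Measure.pi fun _ => γ) := fun j =>
    tfst.integrable_comp_of_integrable ((i3' j).apply_continuousLinearMap (y - x))
  have i4 : ∀ j : Fin k, Integrable (fun P : Fin k → Sp d × Sp d => ∑ i ∈ Finset.univ.erase j,
      blk Φ j i (upd j (tup Prod.fst P) x) ((P i).2 - (P i).1)) (Measure.pi fun _ => γ) := fun j =>
    integrable_finsetSum _ fun i _ => (hred j i).1
  have hEint : ∀ j, ∫ P, E j P ∂(Measure.pi fun _ => γ) =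
      ∫ X, (gradient Φ (upd j X y)) j ∂(pw ν.1 k) - ∫ X, (gradient Φ (upd j X x)) j ∂(pw m.1 k) -
      ((∫ X, blk Φ j j (upd j X x) ∂(pw m.1 k)) (y - x) + ∑ i ∈ Finset.univ.erase j,
        ∫ p, (∫ X, blk Φ j i (upd j (upd i X p.1) x) ∂(pw m.1 k)) (p.2 - p.1) ∂γ) := by
    intro j
    have i12 : Integrable (fun P : Fin k → Sp d × Sp d =>
      (gradient Φ (upd j (tup Prod.snd P) y)) j - (gradient Φ (upd j (tup Prod.fst P) x)) j)
      (Measure.pi fun _ => γ) := (i1 j).sub (i2 j)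
    have i34 : Integrable (fun P : Fin k → Sp d × Sp d =>
      blk Φ j j (upd j (tup Prod.fst P) x) (y - x) + ∑ i ∈ Finset.univ.erase j,
        blk Φ j i (upd j (tup Prod.fst P) x) ((P i).2 - (P i).1))
      (Measure.pi fun _ => γ) := (i3 j).add (i4 j)
    simp only [hEdef]
    rw [integral_sub i12 i34, integral_sub (i1 j) (i2 j), integral_add (i3 j) (i4 j),
      integral_finsetSum _ fun i _ => (hred j i).1,
      integral_comp_tup hsnd (hΦ.isC1Lin.integrable_gradient_upd ν j y).1,
      integral_comp_tup hfst (hΦ.isC1Lin.integrable_gradient_upd m j x).1,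
      integral_comp_tup hfst (g := fun X => blk Φ j j (upd j X x) (y - x))
        ((i3' j).apply_continuousLinearMap (y - x)).1, ContinuousLinearMap.integral_apply (i3' j)]
    congr 2
    exact Finset.sum_congr rfl fun i _ => (hred j i).2.2.symm
  have htot : gradField Φ ν y - gradField Φ m x -
      (hessLoc Φ m x (y - x) + ∫ p, hessNonloc Φ m x p.1 (p.2 - p.1) ∂γ) =
      ∑ j, ∫ P, E j P ∂(Measure.pi fun _ => γ) := by
    have e1 : ∫ p, hessNonloc Φ m x p.1 (p.2 - p.1) ∂γ = ∑ j, ∑ i ∈ Finset.univ.erase j,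
        ∫ p, (∫ X, blk Φ j i (upd j (upd i X p.1) x) ∂(pw m.1 k)) (p.2 - p.1) ∂γ := by
      simp only [hessNonloc, _root_.sum_apply]
      rw [integral_finsetSum _ fun j _ => integrable_finsetSum _ fun i _ => (hred j i).2.1]
      exact Finset.sum_congr rfl fun j _ => integral_finsetSum _ fun i _ => (hred j i).2.1
    simp_rw [hEint]
    rw [e1, Finset.sum_sub_distrib, Finset.sum_sub_distrib, Finset.sum_add_distrib, gradField,
      gradField, hessLoc, _root_.sum_apply]
  rw [htot]
  refine (norm_sum_le _ _).trans ((Finset.sum_le_sum fun j _ =>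
    hρ.norm_integral_le hΔ (norm_nonneg (x - y)) (hE j)).trans (le_of_eq ?_))
  rw [sqrt_integral_norm_sq_two_tup hγ]
  simp only [Finset.sum_const, Finset.card_univ, Fintype.card_fin, nsmul_eq_mul]
  ring

theorem IsC2Mod.isSecondOrderExpansion (hΦ : IsC2Mod Φ) (m : P2 d) :
    IsSecondOrderExpansion (poly Φ) m (hessLoc Φ m) (hessNonloc Φ m) := by
  obtain ⟨C, hC0, hC⟩ := hΦ.bounded
  obtain ⟨ρ, hρ, hmod⟩ := hΦ.modulus
  obtain ⟨A, hA0, hA⟩ := hΦ.isC1Lin.growth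
  have hI0 : 0 ≤ ∫ X : Mk d k, ‖X‖ ∂(pw m.1 k) := integral_nonneg fun _ => norm_nonneg _
  refine ⟨(hΦ.continuous_hessLoc m).measurable, (hΦ.continuous_hessNonloc m).measurable,
    ⟨max (k * C) (k * (k * C)), fun x => (norm_hessLoc_le hC0 hC m x).trans (le_max_left _ _),
      fun x a => (norm_hessNonloc_le hC0 hC m x a).trans (le_max_right _ _)⟩,
    fun ν => gradField Φ ν, 1,
    -- Uniform growth constant for `W2 m ν < 1`: the mean of `‖X‖` under `ν^k` exceeds that under
    -- `m^k` by at most `√k W₂ ≤ √k`.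
    k * (A * (1 + 2 * (∫ X : Mk d k, ‖X‖ ∂(pw m.1 k) + √(k : ℝ)))),
    fun t => 4 * k * ρ t, fun t => 16 * k * √(k : ℝ) * ρ (2 * √(k : ℝ) * t), one_pos,
    hρ.const_mul (by positivity), fun t ht => ?_, ?_, fun ν hν => ?_⟩
  · exact mul_nonneg (by positivity) (hρ.nonneg (by positivity))
  · have h1 : Tendsto ρ (𝓝[≥] 0) (𝓝 0) := by
      have := hρ.continuousOn 0 Set.self_mem_Ici
      rwa [ContinuousWithinAt, hρ.map_zero] at this
    have h2 : Tendsto (fun t : ℝ => 2 * √(k : ℝ) * t) (𝓝[>] 0) (𝓝[≥] 0) := by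
      refine tendsto_nhdsWithin_iff.2 ⟨?_, ?_⟩
      · have : Tendsto (fun t : ℝ => 2 * √(k : ℝ) * t) (𝓝 0) (𝓝 (2 * √(k : ℝ) * 0)) :=
          (continuous_const.mul continuous_id).tendsto 0
        rw [mul_zero] at this
        exact this.mono_left nhdsWithin_le_nhds
      · filter_upwards [self_mem_nhdsWithin] with t ht
        have ht' : (0 : ℝ) < t := ht
        show (0 : ℝ) ≤ 2 * √(k : ℝ) * t
        positivity
    have h3 := (h1.comp h2).const_mul (16 * k * √(k : ℝ))
    rwa [mul_zero] at h3
  · have hs := hΦ.isC1Lin.isStrongGradient ν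
    refine ⟨hs.wDifferentiableAt, hs.isWGradient (hΦ.isC1Lin.isTangentField_gradField ν),
      hΦ.isC1Lin.continuous_gradField ν, fun x => ?_, fun γ hγ x y =>
      hΦ.norm_gradField_expansion_le hρ hmod hγ x y⟩
    refine (norm_gradField_le hA0 hA ν x).trans ?_
    have hle : ∫ X : Mk d k, ‖X‖ ∂(pw ν.1 k) ≤ ∫ X : Mk d k, ‖X‖ ∂(pw m.1 k) + √(k : ℝ) := by
      obtain ⟨γ, hγ⟩ := optimalPlans_nonempty m ν
      have hp := coupling_isProbabilityMeasure hγ.1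
      have hfst := measurePreserving_fst_coupling hγ.1
      have hsnd := measurePreserving_snd_coupling hγ.1
      have hΔ : MemLp (fun P : Fin k → Sp d × Sp d => (tup Prod.snd P - tup Prod.fst P : Mk d k)) 2
        (Measure.pi fun _ => γ) := memLp_tup (memLp_sub_coupling hγ.1)
      have hX : ∀ {ν : P2 d}, Integrable (fun X : Mk d k => ‖X‖) (pw ν.1 k) := fun {ν} =>
        ((memLp_pw_id ν).integrable (by norm_num)).norm
      have j1 : Integrable (fun P : Fin k → Sp d × Sp d => ‖(tup Prod.fst P : Mk d k)‖)
        (Measure.pi fun _ => γ) := (measurePreserving_tup hfst).integrable_comp_of_integrable hX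
      have j2 : Integrable (fun P : Fin k → Sp d × Sp d => ‖(tup Prod.snd P : Mk d k)‖)
        (Measure.pi fun _ => γ) := (measurePreserving_tup hsnd).integrable_comp_of_integrable hX
      have j3 := (hΔ.integrable (by norm_num)).norm
      rw [← integral_comp_tup hfst (hX (ν := m)).1, ← integral_comp_tup hsnd (hX (ν := ν)).1]
      have h1 := integral_mono j2 (j1.add j3) fun P => by
        simpa using norm_add_le (tup Prod.fst P : Mk d k) (tup Prod.snd P - tup Prod.fst P)
      refine h1.trans ?_
      have h2 := integral_norm_le_sqrt hΔ
      have h3 := integral_norm_sq_tup (k := k) (memLp_sub_coupling hγ.1)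
      simp_rw [tup_sub] at h3
      rw [h3, integral_sq_optimalPlans hγ, Real.sqrt_mul (by positivity),
        Real.sqrt_sq (W2_nonneg _ _)] at h2
      have h4 : √(k : ℝ) * W2 m ν ≤ √(k : ℝ) := mul_le_of_le_one_right (by positivity) hν.le
      have h5 := integral_add j1 j3
      simp only [Pi.add_apply]
      linarith
    have hs := Real.sqrt_nonneg (k : ℝ)
    set I := ∫ X : Mk d k, ‖X‖ ∂(pw m.1 k) + √(k : ℝ) with hI
    have hI' : 0 ≤ I := by positivity
    calc k * (A * (1 + 2 * ∫ X : Mk d k, ‖X‖ ∂(pw ν.1 k) + ‖x‖))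
        ≤ k * (A * ((1 + 2 * I) * (1 + ‖x‖))) := by
          gcongr
          nlinarith [mul_nonneg hI' (norm_nonneg x)]
      _ = _ := by ring

end

section

/-! ### Uniqueness of the local second order field -/

variable {d k : ℕ} {Φ : Mk d k → ℝ}

theorem norm_integral_clm_le_W2 {m ν : P2 d} {γ : Measure (Sp d × Sp d)}
    (hγ : γ ∈ optimalPlans m ν) {K : Sp d × Sp d → Sp d →L[ℝ] Sp d} {C : ℝ}
    (hC : ∀ p, ‖K p‖ ≤ C) : ‖∫ p, K p (p.2 - p.1) ∂γ‖ ≤ C * W2 m ν := by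
  have hp := coupling_isProbabilityMeasure hγ.1
  have hsub := memLp_sub_coupling hγ.1
  have h1 := norm_integral_le_of_norm_le (μ := γ) (f := fun p => K p (p.2 - p.1))
    (((hsub.integrable (by norm_num)).norm).const_mul C) (ae_of_all _ fun p =>
      ((K p).le_opNorm _).trans (mul_le_mul_of_nonneg_right (hC p) (norm_nonneg _)))
  have h2 := integral_norm_le_sqrt hsub
  rw [integral_sq_optimalPlans hγ, Real.sqrt_sq (W2_nonneg _ _)] at h2
  rw [integral_const_mul] at h1
  exact h1.trans (mul_le_mul_of_nonneg_left h2 ((norm_nonneg (K 0)).trans (hC 0)))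

/-- Taking `x = y` leaves only terms that vanish with `W₂`, so `A ν y → A m y` at every point.
Taking `ν = m` removes the integral, since the plan sits on the diagonal, and what is left says that
`A m` has derivative `At`. -/
theorem IsSecondOrderExpansion.exists_representative {U : P2 d → ℝ} {m : P2 d}
    {At : Sp d → (Sp d →L[ℝ] Sp d)} {Amm : Sp d → Sp d → (Sp d →L[ℝ] Sp d)}
    (h : IsSecondOrderExpansion U m At Amm) :
    ∃ (A : P2 d → Sp d → Sp d), (∃ r > 0, ∀ ν, W2 m ν < r → IsWGradient U ν (A ν)) ∧
      (∀ y, ∀ ε > 0, ∃ δ > 0, ∀ ν, W2 m ν < δ → ‖A ν y - A m y‖ ≤ ε) ∧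
      ∀ x, HasFDerivAt (A m) (At x) x := by
  obtain ⟨-, -, ⟨C, -, hC⟩, A, r, C', ρ, ε₂, hr, hρ, hε0, hε, hA⟩ := h
  refine ⟨A, ⟨r, hr, fun ν hν => (hA ν hν).2.1⟩, fun y ε hε' => ?_, fun x => ?_⟩
  · have hC0 : 0 ≤ C := (norm_nonneg _).trans (hC 0 0)
    have h1 : ∀ᶠ t in 𝓝[>] (0 : ℝ), ε₂ t < 1 := hε.eventually (gt_mem_nhds one_pos)
    obtain ⟨δ, hδ, h2⟩ := mem_nhdsGT_iff_exists_Ioo_subset.1 h1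
    have hδ' : (0 : ℝ) < δ := hδ
    refine ⟨min r (min δ (ε / (C + 1))), by positivity, fun ν hν => ?_⟩
    obtain ⟨hν1, hν2, hν3⟩ : W2 m ν < r ∧ W2 m ν < δ ∧ W2 m ν < ε / (C + 1) := by
      simpa [lt_min_iff] using hν
    obtain ⟨γ, hγ⟩ := optimalPlans_nonempty m ν
    have h3 := (hA ν hν1).2.2.2.2 γ hγ y y
    have h4 := norm_integral_clm_le_W2 hγ (K := fun p => Amm y p.1) (fun p => hC _ _)
    have h5 : W2 m ν * ε₂ (W2 m ν) ≤ W2 m ν := by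
      -- The limit of `ε₂` gives no control at `t = 0`, where the factor `W2 m ν` vanishes instead.
      rcases (W2_nonneg m ν).eq_or_lt with h0 | h0
      · rw [← h0, zero_mul]
      · exact mul_le_of_le_one_right h0.le (h2 ⟨h0, hν2⟩ : ε₂ (W2 m ν) < 1).le
    rw [sub_self, map_zero, zero_add, norm_zero, zero_mul, zero_add] at h3
    have h6 := norm_add_le (A ν y - A m y - ∫ p, Amm y p.1 (p.2 - p.1) ∂γ)
      (∫ p, Amm y p.1 (p.2 - p.1) ∂γ)
    rw [sub_add_cancel] at h6
    rw [lt_div_iff₀ (by positivity)] at hν3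
    linarith
  · obtain ⟨γ, hγ⟩ := optimalPlans_nonempty m m
    have h1 := (hA m (by rwa [W2_self])).2.2.2.2 γ hγ x
    have h2 : ∫ p, Amm x p.1 (p.2 - p.1) ∂γ = 0 := by
      refine integral_eq_zero_of_ae ?_
      filter_upwards [ae_eq_of_mem_optimalPlans_self hγ] with p hp
      rw [hp, map_zero]
      rfl
    simp only [h2, W2_self, zero_mul, add_zero] at h1
    have h3 : Tendsto (fun y => ρ ‖x - y‖) (𝓝 x) (𝓝 0) := by
      have h4 := hρ.continuousOn 0 Set.self_mem_Ici
      rw [ContinuousWithinAt, hρ.map_zero] at h4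
      refine h4.comp (tendsto_nhdsWithin_iff.2 ⟨?_, Eventually.of_forall fun y => norm_nonneg _⟩)
      have : Continuous fun y => ‖x - y‖ := by fun_prop
      simpa using this.tendsto x
    refine HasFDerivAt.of_isLittleO (Asymptotics.IsLittleO.of_bound fun c hc => ?_)
    filter_upwards [h3.eventually (gt_mem_nhds hc)] with y hy
    refine (h1 y).trans ?_
    rw [norm_sub_rev y x, mul_comm]
    exact mul_le_mul_of_nonneg_right hy.le (norm_nonneg _)

/-- Mixing in a small multiple of `δ_y` moves `m` by an arbitrarily small distance and creates an
atom at `y`. -/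
theorem exists_near_charging (m : P2 d) (y : Sp d) {q : ℝ} (hq : 0 < q) :
    ∃ ν : P2 d, W2 m ν < q ∧ ∀ p : Sp d → Prop, (∀ᵐ x ∂ν.1, p x) → p y := by
  obtain ⟨D, hD⟩ : ∃ D, D = ∫ x, ‖y - x‖ ^ 2 ∂m.1 := ⟨_, rfl⟩
  have hD0 : 0 ≤ D := hD ▸ integral_nonneg fun _ => by positivity
  obtain ⟨s, hs⟩ : ∃ s, s = min 1 (q ^ 2 / (2 * (D + 1))) := ⟨_, rfl⟩
  have hs0 : 0 < s := hs ▸ lt_min one_pos (by positivity)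
  have hsI : s ∈ Set.Icc (0 : ℝ) 1 := ⟨hs0.le, hs ▸ min_le_left _ _⟩
  refine ⟨mixDirac m y s hsI, ?_, fun p hp => mixDirac_ae hs0 hp⟩
  refine lt_of_pow_lt_pow_left₀ 2 hq.le ((W2_mixDirac_sq_le m y s hsI).trans_lt ?_)
  rw [← hD]
  calc s * D ≤ q ^ 2 / (2 * (D + 1)) * (D + 1) := by
        gcongr
        · exact hs ▸ min_le_right _ _
        · linarith
    _ = q ^ 2 / 2 := by field_simp
    _ < q ^ 2 := half_lt_self (by positivity)

/-- Where the Wasserstein gradients are unique, so is the field `Ã[m]`. -/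
theorem IsSecondOrderExpansion.local_unique {U : P2 d → ℝ} {m : P2 d}
    {At At' : Sp d → (Sp d →L[ℝ] Sp d)} {Amm Amm' : Sp d → Sp d → (Sp d →L[ℝ] Sp d)}
    (hU : ∀ ν ζ η, IsWGradient U ν ζ → IsWGradient U ν η → ζ =ᵐ[ν.1] η)
    (h : IsSecondOrderExpansion U m At Amm) (h' : IsSecondOrderExpansion U m At' Amm') :
    At = At' := by
  obtain ⟨A, ⟨r, hr, hA⟩, hA1, hA2⟩ := h.exists_representative
  obtain ⟨A', ⟨r', hr', hA'⟩, hA1', hA2'⟩ := h'.exists_representative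
  -- `Ã` is the derivative of the representative, so equality is needed at every point, including
  -- those outside the support of `m`.
  suffices hAA : A m = A' m from funext fun x => (hA2 x).unique (hAA ▸ hA2' x)
  funext y
  refine eq_of_forall_dist_le fun ε hε => ?_
  obtain ⟨δ, hδ, h1⟩ := hA1 y (ε / 2) (by positivity)
  obtain ⟨δ', hδ', h1'⟩ := hA1' y (ε / 2) (by positivity)
  obtain ⟨ν, hW, hν⟩ := exists_near_charging m y
    (show 0 < min (min r r') (min δ δ') from lt_min (lt_min hr hr') (lt_min hδ hδ'))
  obtain ⟨⟨w1, w2⟩, w3, w4⟩ : (W2 m ν < r ∧ W2 m ν < r') ∧ W2 m ν < δ ∧ W2 m ν < δ' := by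
    simpa only [lt_min_iff] using hW
  -- Gradients at `ν` agree `ν`-almost everywhere, hence at the atom `y`; letting `ν` approach `m`
  -- transfers this to `m`.
  have he : A ν y = A' ν y := hν _ (hU ν _ _ (hA ν w1) (hA' ν w2))
  rw [dist_eq_norm]
  have h2 : A m y - A' m y = (A' ν y - A' m y) - (A ν y - A m y) := by rw [he]; abel
  rw [h2]
  refine (norm_sub_le _ _).trans ?_
  linarith [h1 ν w3, h1' ν w4]

theorem IsC2Mod.wTwiceDifferentiableAt (hΦ : IsC2Mod Φ) (m : P2 d) :
    WTwiceDifferentiableAt (poly Φ) m := ⟨_, _, hΦ.isSecondOrderExpansion m⟩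

theorem IsC2Mod.secondOrderLocal_eq (hΦ : IsC2Mod Φ) (m : P2 d) :
    secondOrderLocal (poly Φ) m = hessLoc Φ m := by
  have h := hΦ.wTwiceDifferentiableAt m
  rw [secondOrderLocal, dif_pos h]
  obtain ⟨Amm, h1⟩ := h.choose_spec
  refine h1.local_unique (fun ν ζ η hζ hη => ?_) (hΦ.isSecondOrderExpansion m)
  have hs := hΦ.isC1Lin.isStrongGradient ν
  have hT := hΦ.isC1Lin.isTangentField_gradField ν
  exact (hs.ae_eq_of_isWGradient hT hζ).trans (hs.ae_eq_of_isWGradient hT hη).symm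

/-- The Laplacian of `Φ` on `(ℝ^d)^k`. -/
def lapFull (Φ : Mk d k → ℝ) (X : Mk d k) : ℝ :=
  ∑ i : Fin d, ∑ j : Fin k,
    inner ℝ (fderiv ℝ (gradient Φ) X (inj j (stdVec i))) (inj j (stdVec i))

/-- Averaging `hessLoc` over `x` fills the replaced entry with an independent draw from `m`, so the
full product measure reappears. -/
theorem IsC2Mod.integral_inner_hessLoc (hΦ : IsC2Mod Φ) (m : P2 d) (v : Sp d) :
    ∫ x, inner ℝ (hessLoc Φ m x v) v ∂m.1 =
      ∑ j, ∫ X, inner ℝ (fderiv ℝ (gradient Φ) X (inj j v)) (inj j v) ∂(pw m.1 k) := by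
  obtain ⟨C, hC0, hC⟩ := hΦ.bounded
  have hid : MeasurePreserving (fun x : Sp d => x) m.1 m.1 := MeasurePreserving.id _
  have hred := fun j : Fin k => integral_clm_redraw (hΦ.continuous_blk j j)
    (fun X => norm_blk_le hC0 hC j j X) hid (memLp_const (μ := m.1) (p := 2) v) j
  have hb : ∀ j : Fin k, Continuous fun X => blk Φ j j X v := fun j =>
    (hΦ.continuous_blk j j).clm_apply continuous_const
  have hi : ∀ j : Fin k, Integrable (fun X => blk Φ j j X v) (pw m.1 k) := fun j =>
    (integrable_const (C * ‖v‖)).mono' (hb j).aestronglyMeasurable (ae_of_all _ fun X =>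
      ((blk Φ j j X).le_opNorm v).trans
        (mul_le_mul_of_nonneg_right (norm_blk_le hC0 hC j j X) (norm_nonneg v)))
  have hi2 : Integrable (fun x => hessLoc Φ m x v) m.1 := by
    simp only [hessLoc, _root_.sum_apply]
    exact integrable_finsetSum _ fun j _ => (hred j).2.1
  have h1 : ∫ x, hessLoc Φ m x v ∂m.1 = ∑ j, ∫ X, blk Φ j j X v ∂(pw m.1 k) := by
    simp only [hessLoc, _root_.sum_apply]
    rw [integral_finsetSum _ fun j _ => (hred j).2.1]
    refine Finset.sum_congr rfl fun j _ => ((hred j).2.2).trans ?_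
    exact integral_comp_tup hid (g := fun X => blk Φ j j X v) (hb j).aestronglyMeasurable
  simp_rw [real_inner_comm v]
  rw [integral_inner hi2, h1, inner_sum]
  refine Finset.sum_congr rfl fun j _ => ?_
  rw [← integral_inner (hi j)]
  refine integral_congr_ae (ae_of_all _ fun X => ?_)
  simp only
  rw [blk_apply, real_inner_comm, ← inner_inj_right, real_inner_comm]

theorem IsC2Mod.wLaplacianEps_poly (hΦ : IsC2Mod Φ) (ε : ℝ) (m : P2 d) :
    wLaplacianEps ε (poly Φ) m = poly (lapDiag Φ) m + ε * poly (lapFull Φ) m := by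
  have h1 : ∀ i : Fin d, ∫ x, inner ℝ (secondOrderLocal (poly Φ) m x ((momentGradient m i).1 x))
      ((momentGradient m i).1 x) ∂m.1 = ∑ j : Fin k,
        ∫ X, inner ℝ (fderiv ℝ (gradient Φ) X (inj j (stdVec i))) (inj j (stdVec i))
          ∂(pw m.1 k) := by
    intro i
    rw [hΦ.secondOrderLocal_eq, ← hΦ.integral_inner_hessLoc]
    refine integral_congr_ae ?_
    filter_upwards [momentGradient_ae_eq m i] with x hx
    rw [hx]
  rw [wLaplacianEps, Finset.sum_add_distrib, ← hΦ.wLaplacian_poly, ← wLaplacian,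
    ← Finset.mul_sum]
  congr 2
  simp_rw [h1]
  unfold poly lapFull
  rw [integral_finsetSum _ fun i _ => integrable_finsetSum _ fun j _ =>
    hΦ.integrable_fderiv_gradient m _ _]
  exact Finset.sum_congr rfl fun i _ => (integral_finsetSum _ fun j _ =>
    hΦ.integrable_fderiv_gradient m _ _).symm

end

section

/-! ### Complex valued polynomials -/

variable {d k : ℕ} {Φ : Mk d k → ℂ}

/-- Complex valued `C²` functions with bounded second derivative having a concave modulus of
continuity. -/
structure IsComplexC2Mod {V : Type*} [NormedAddCommGroup V] [InnerProductSpace ℝ V]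
    (Φ : V → ℂ) : Prop where
  contDiff : ContDiff ℝ 2 Φ
  bounded : ∃ C : ℝ, ∀ x, ‖fderiv ℝ (fderiv ℝ Φ) x‖ ≤ C
  modulus : ∃ ρ : ℝ → ℝ, IsConcaveModulus ρ ∧
    ∀ x y, ‖fderiv ℝ (fderiv ℝ Φ) x - fderiv ℝ (fderiv ℝ Φ) y‖ ≤ ρ ‖x - y‖

theorem IsSymC2.isComplexC2Mod (h : IsSymC2 Φ) : IsComplexC2Mod Φ :=
  ⟨h.contDiff, h.bounded, h.modulus⟩

/-- The linear map that sends `DΦ` to the gradient of `ℓ ∘ Φ`. -/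
def compGrad (d k : ℕ) (l : ℂ →L[ℝ] ℝ) : (Mk d k →L[ℝ] ℂ) →L[ℝ] Mk d k :=
  (rieszSymm (Mk d k)).comp (ContinuousLinearMap.compL ℝ (Mk d k) ℂ ℝ l)

theorem inner_compGrad (l : ℂ →L[ℝ] ℝ) (f : Mk d k →L[ℝ] ℂ) (w : Mk d k) :
    inner ℝ (compGrad d k l f) w = l (f w) := inner_rieszSymm _ w

theorem IsComplexC2Mod.differentiable (h : IsComplexC2Mod Φ) : Differentiable ℝ Φ :=
  h.contDiff.differentiable two_ne_zero

theorem IsComplexC2Mod.contDiff_fderiv (h : IsComplexC2Mod Φ) : ContDiff ℝ 1 (fderiv ℝ Φ) :=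
  h.contDiff.fderiv_right (m := 1) (by norm_num)

theorem IsComplexC2Mod.continuous_fderiv_fderiv (h : IsComplexC2Mod Φ) :
    Continuous (fderiv ℝ (fderiv ℝ Φ)) := h.contDiff_fderiv.continuous_fderiv one_ne_zero

theorem IsComplexC2Mod.gradient_comp (h : IsComplexC2Mod Φ) (l : ℂ →L[ℝ] ℝ) :
    gradient (fun X => l (Φ X)) = fun X => compGrad d k l (fderiv ℝ Φ X) := by
  rw [gradient_eq_rieszSymm]
  funext X
  have h1 : HasFDerivAt (fun X => l (Φ X)) (l.comp (fderiv ℝ Φ X)) X :=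
    l.hasFDerivAt.comp X (h.differentiable X).hasFDerivAt
  rw [fderiv_eq_of_hasFDerivAt h1]
  rfl

theorem IsComplexC2Mod.fderiv_gradient_comp (h : IsComplexC2Mod Φ) (l : ℂ →L[ℝ] ℝ) (X : Mk d k) :
    fderiv ℝ (gradient fun X => l (Φ X)) X =
      (compGrad d k l).comp (fderiv ℝ (fderiv ℝ Φ) X) := by
  rw [h.gradient_comp]
  exact fderiv_eq_of_hasFDerivAt ((compGrad d k l).hasFDerivAt.comp X
    (h.contDiff_fderiv.differentiable one_ne_zero X).hasFDerivAt)

theorem IsComplexC2Mod.inner_fderiv_gradient_comp (h : IsComplexC2Mod Φ) (l : ℂ →L[ℝ] ℝ)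
    (X v w : Mk d k) : inner ℝ (fderiv ℝ (gradient fun X => l (Φ X)) X v) w =
      l (fderiv ℝ (fderiv ℝ Φ) X v w) := by
  rw [h.fderiv_gradient_comp]
  exact inner_compGrad l _ w

/-- The real theory is applied to `l ∘ Φ` with `l` the real or imaginary part, scaled by `k⁻¹` so
that the normalization of `polyF` is absorbed. -/
theorem IsComplexC2Mod.isC2Mod_comp (h : IsComplexC2Mod Φ) (l : ℂ →L[ℝ] ℝ) :
    IsC2Mod fun X => l (Φ X) := by
  obtain ⟨C, hC⟩ := h.bounded
  obtain ⟨ρ, hρ, hmod⟩ := h.modulus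
  have hC0 : 0 ≤ C := le_trans (norm_nonneg (fderiv ℝ (fderiv ℝ Φ) 0)) (hC 0)
  refine ⟨l.contDiff.comp h.contDiff, ⟨‖compGrad d k l‖ * C, by positivity, fun x => ?_⟩,
    fun t => ‖compGrad d k l‖ * ρ t, hρ.const_mul (norm_nonneg (compGrad d k l)), fun x y => ?_⟩
  · rw [h.fderiv_gradient_comp]
    exact (ContinuousLinearMap.opNorm_comp_le _ _).trans
      (mul_le_mul_of_nonneg_left (hC x) (norm_nonneg _))
  · rw [h.fderiv_gradient_comp, h.fderiv_gradient_comp, ← ContinuousLinearMap.comp_sub]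
    exact (ContinuousLinearMap.opNorm_comp_le _ _).trans
      (mul_le_mul_of_nonneg_left (hmod x y) (norm_nonneg _))

theorem IsComplexC2Mod.integrable_pw (h : IsComplexC2Mod Φ) (m : P2 d) :
    Integrable Φ (pw m.1 k) := by
  have h1 := ((h.isC2Mod_comp Complex.reCLM).isC1Lin.integrable_pw m).ofReal (𝕜 := ℂ)
  have h2 := ((h.isC2Mod_comp Complex.imCLM).isC1Lin.integrable_pw m).ofReal (𝕜 := ℂ)
  refine (h1.add (h2.mul_const Complex.I)).congr (ae_of_all _ fun X => ?_)
  exact Complex.re_add_im (Φ X)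

theorem polyF_eq (hΦ : Continuous Φ) (m : P2 d) :
    polyF Φ m = (k : ℂ)⁻¹ * ∫ X, Φ X ∂(pw m.1 k) := by
  rw [polyF, pw, integral_map (WithLp.measurable_toLp 2 _).aemeasurable
    hΦ.aestronglyMeasurable]

/-- `z ↦ k⁻¹ Re z`. -/
def scaledRe (k : ℕ) : ℂ →L[ℝ] ℝ := (k : ℝ)⁻¹ • Complex.reCLM

/-- `z ↦ k⁻¹ Im z`. -/
def scaledIm (k : ℕ) : ℂ →L[ℝ] ℝ := (k : ℝ)⁻¹ • Complex.imCLM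

theorem scaledRe_add_scaledIm (z : ℂ) :
    (scaledRe k z : ℂ) + (scaledIm k z : ℂ) * Complex.I = (k : ℂ)⁻¹ * z := by
  apply Complex.ext <;> simp [scaledRe, scaledIm, Complex.mul_re, Complex.mul_im,
    Complex.inv_re, Complex.inv_im, Complex.normSq_apply]

theorem scaledRe_eq (z : ℂ) : scaledRe k z = ((k : ℂ)⁻¹ * z).re := by
  simp [← scaledRe_add_scaledIm]

theorem scaledIm_eq (z : ℂ) : scaledIm k z = ((k : ℂ)⁻¹ * z).im := by
  simp [← scaledRe_add_scaledIm]

theorem poly_comp_clm {Ψ : Mk d k → ℂ} {m : P2 d} (hΨ : Integrable Ψ (pw m.1 k))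
    (l : ℂ →L[ℝ] ℝ) : poly (fun X => l (Ψ X)) m = l (∫ X, Ψ X ∂(pw m.1 k)) :=
  l.integral_comp_comm hΨ

theorem IsComplexC2Mod.re_polyF (h : IsComplexC2Mod Φ) :
    (fun ν => (polyF Φ ν).re) = poly fun X => scaledRe k (Φ X) := by
  funext ν
  rw [poly_comp_clm (h.integrable_pw ν), polyF_eq h.contDiff.continuous, scaledRe_eq]

theorem IsComplexC2Mod.im_polyF (h : IsComplexC2Mod Φ) :
    (fun ν => (polyF Φ ν).im) = poly fun X => scaledIm k (Φ X) := by
  funext ν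
  rw [poly_comp_clm (h.integrable_pw ν), polyF_eq h.contDiff.continuous, scaledIm_eq]

theorem IsComplexC2Mod.cTwiceDifferentiableAt_polyF (h : IsComplexC2Mod Φ) (m : P2 d) :
    CTwiceDifferentiableAt (polyF Φ) m := by
  rw [CTwiceDifferentiableAt, h.re_polyF, h.im_polyF]
  exact ⟨⟨(h.isC2Mod_comp _).wTwiceDifferentiableAt m, (h.isC2Mod_comp _).hasWHessianAt m⟩,
    (h.isC2Mod_comp _).wTwiceDifferentiableAt m, (h.isC2Mod_comp _).hasWHessianAt m⟩

/-- The second order operator `Σ_i D²Φ(E_i, E_i)`, `E_i = (e_i, …, e_i)`, that represents `△_w`. -/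
def cLapDiag (Φ : Mk d k → ℂ) (X : Mk d k) : ℂ :=
  ∑ i : Fin d, fderiv ℝ (fderiv ℝ Φ) X (diagVec k (stdVec i)) (diagVec k (stdVec i))

/-- The Laplacian of `Φ` on `(ℝ^d)^k`. -/
def cLapFull (Φ : Mk d k → ℂ) (X : Mk d k) : ℂ :=
  ∑ i : Fin d, ∑ j : Fin k, fderiv ℝ (fderiv ℝ Φ) X (inj j (stdVec i)) (inj j (stdVec i))

theorem IsComplexC2Mod.lapDiag_comp (h : IsComplexC2Mod Φ) (l : ℂ →L[ℝ] ℝ) :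
    lapDiag (fun X => l (Φ X)) = fun X => l (cLapDiag Φ X) := by
  funext X
  simp only [lapDiag, cLapDiag, h.inner_fderiv_gradient_comp, map_sum]

theorem IsComplexC2Mod.lapFull_comp (h : IsComplexC2Mod Φ) (l : ℂ →L[ℝ] ℝ) :
    lapFull (fun X => l (Φ X)) = fun X => l (cLapFull Φ X) := by
  funext X
  simp only [lapFull, cLapFull, h.inner_fderiv_gradient_comp, map_sum]

theorem IsComplexC2Mod.continuous_fderiv_fderiv_apply (h : IsComplexC2Mod Φ) (v w : Mk d k) :
    Continuous fun X => fderiv ℝ (fderiv ℝ Φ) X v w :=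
  (h.continuous_fderiv_fderiv.clm_apply continuous_const).clm_apply continuous_const

theorem IsComplexC2Mod.integrable_fderiv_fderiv (h : IsComplexC2Mod Φ) (m : P2 d)
    (v w : Mk d k) : Integrable (fun X => fderiv ℝ (fderiv ℝ Φ) X v w) (pw m.1 k) := by
  obtain ⟨C, hC⟩ := h.bounded
  refine (integrable_const (C * ‖v‖ * ‖w‖)).mono'
    (h.continuous_fderiv_fderiv_apply v w).aestronglyMeasurable (ae_of_all _ fun X => ?_)
  refine (ContinuousLinearMap.le_opNorm₂ _ v w).trans ?_
  gcongr
  exact hC X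

theorem IsComplexC2Mod.continuous_cLapDiag (h : IsComplexC2Mod Φ) : Continuous (cLapDiag Φ) :=
  continuous_finsetSum _ fun _ _ => h.continuous_fderiv_fderiv_apply _ _

theorem IsComplexC2Mod.continuous_cLapFull (h : IsComplexC2Mod Φ) : Continuous (cLapFull Φ) :=
  continuous_finsetSum _ fun _ _ => continuous_finsetSum _ fun _ _ =>
    h.continuous_fderiv_fderiv_apply _ _

theorem IsComplexC2Mod.integrable_cLapDiag (h : IsComplexC2Mod Φ) (m : P2 d) :
    Integrable (cLapDiag Φ) (pw m.1 k) :=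
  integrable_finsetSum _ fun _ _ => h.integrable_fderiv_fderiv m _ _

theorem IsComplexC2Mod.integrable_cLapFull (h : IsComplexC2Mod Φ) (m : P2 d) :
    Integrable (cLapFull Φ) (pw m.1 k) :=
  integrable_finsetSum _ fun _ _ => integrable_finsetSum _ fun _ _ =>
    h.integrable_fderiv_fderiv m _ _

theorem IsComplexC2Mod.cLaplacian_polyF (h : IsComplexC2Mod Φ) (m : P2 d) :
    cLaplacian (polyF Φ) m = polyF (cLapDiag Φ) m := by
  rw [cLaplacian, h.re_polyF, h.im_polyF, (h.isC2Mod_comp _).wLaplacian_poly,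
    (h.isC2Mod_comp _).wLaplacian_poly, h.lapDiag_comp, h.lapDiag_comp,
    poly_comp_clm (h.integrable_cLapDiag m), poly_comp_clm (h.integrable_cLapDiag m),
    scaledRe_add_scaledIm, polyF_eq h.continuous_cLapDiag]

theorem IsComplexC2Mod.cLaplacianEps_polyF (h : IsComplexC2Mod Φ) (ε : ℝ) (m : P2 d) :
    cLaplacianEps ε (polyF Φ) m = polyF (cLapDiag Φ) m + ε * polyF (cLapFull Φ) m := by
  rw [cLaplacianEps, h.re_polyF, h.im_polyF, (h.isC2Mod_comp _).wLaplacianEps_poly,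
    (h.isC2Mod_comp _).wLaplacianEps_poly, h.lapDiag_comp, h.lapDiag_comp, h.lapFull_comp,
    h.lapFull_comp, poly_comp_clm (h.integrable_cLapDiag m),
    poly_comp_clm (h.integrable_cLapDiag m), poly_comp_clm (h.integrable_cLapFull m),
    poly_comp_clm (h.integrable_cLapFull m), polyF_eq h.continuous_cLapDiag,
    polyF_eq h.continuous_cLapFull, ← scaledRe_add_scaledIm, ← scaledRe_add_scaledIm]
  push_cast
  ring

end

section

/-! ### Symmetrized exponentials -/

variable {d k : ℕ}

section

variable {V : Type*} [NormedAddCommGroup V] [InnerProductSpace ℝ V]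

/-- The linear form `-2πi ⟨η, ·⟩`. -/
def phase (η : V) : V →L[ℝ] ℂ :=
  (-2 * Real.pi * Complex.I : ℂ) • Complex.ofRealCLM.comp (innerSL ℝ η)

theorem phase_apply (η X : V) :
    phase η X = -2 * Real.pi * Complex.I * ((inner ℝ η X : ℝ) : ℂ) := rfl

/-- `exp(-2πi ⟨η, ·⟩)`. -/
def planeWave (η X : V) : ℂ := Complex.exp (phase η X)

theorem norm_planeWave (η X : V) : ‖planeWave η X‖ = 1 := by
  rw [planeWave, phase_apply, show -2 * Real.pi * Complex.I * ((inner ℝ η X : ℝ) : ℂ) =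
    ((-2 * Real.pi * inner ℝ η X : ℝ) : ℂ) * Complex.I by push_cast; ring,
    Complex.norm_exp_ofReal_mul_I]

theorem hasFDerivAt_planeWave (η X : V) :
    HasFDerivAt (planeWave η) (planeWave η X • phase η) X :=
  (phase η).hasFDerivAt.cexp

theorem contDiff_planeWave (η : V) : ContDiff ℝ 2 (planeWave η) :=
  (phase η).contDiff.cexp

theorem norm_planeWave_sub_le (η X Y : V) :
    ‖planeWave η X - planeWave η Y‖ ≤ ‖phase η‖ * ‖X - Y‖ := by
  refine Convex.norm_image_sub_le_of_norm_hasFDerivWithin_le (𝕜 := ℝ) (f := planeWave η)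
    (fun Z _ => (hasFDerivAt_planeWave η Z).hasFDerivWithinAt) (fun Z _ => ?_) convex_univ
    (Set.mem_univ Y) (Set.mem_univ X)
  rw [norm_smul, norm_planeWave, one_mul]

/-- The bilinear form `-4π² ⟨η, ·⟩ ⟨η, ·⟩`. -/
def phaseSq (η : V) : V →L[ℝ] V →L[ℝ] ℂ := (phase η).smulRight (phase η)

theorem phaseSq_apply (η v w : V) : phaseSq η v w = phase η v * phase η w := rfl

theorem phaseSq_self (η v : V) :
    phaseSq η v v = ((-(4 * Real.pi ^ 2) * (inner ℝ η v) ^ 2 : ℝ) : ℂ) := by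
  rw [phaseSq_apply, phase_apply]
  push_cast
  linear_combination (4 * (Real.pi : ℂ) ^ 2 * ((inner ℝ η v : ℝ) : ℂ) ^ 2) * Complex.I_sq

variable {ι : Type*} [Fintype ι]

theorem norm_smul_sum_smul_le {E : Type*} [NormedAddCommGroup E] [NormedSpace ℂ E] (c : ℂ)
    {p : ι → ℂ} {b : ι → ℝ} (hp : ∀ i, ‖p i‖ ≤ b i) (B : ι → E) :
    ‖c • ∑ i, p i • B i‖ ≤ ‖c‖ * ∑ i, b i * ‖B i‖ := by
  rw [norm_smul]
  gcongr
  refine (norm_sum_le _ _).trans (Finset.sum_le_sum fun i _ => ?_)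
  rw [norm_smul]
  gcongr
  exact hp i

/-- `c ∑ i, exp(-2πi ⟨η i, ·⟩)`. -/
def waveSum (c : ℂ) (η : ι → V) (X : V) : ℂ := c * ∑ i, planeWave (η i) X

theorem fderiv_waveSum (c : ℂ) (η : ι → V) : fderiv ℝ (waveSum c η) = fun X =>
    c • ∑ i, planeWave (η i) X • phase (η i) := by
  funext X
  exact ((HasFDerivAt.fun_sum fun i _ => hasFDerivAt_planeWave (η i) X).const_smul c).fderiv

theorem fderiv_fderiv_waveSum (c : ℂ) (η : ι → V) (X : V) :
    fderiv ℝ (fderiv ℝ (waveSum c η)) X = c • ∑ i, planeWave (η i) X • phaseSq (η i) := by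
  rw [fderiv_waveSum]
  have h : ∀ i, HasFDerivAt (fun X => planeWave (η i) X • phase (η i))
      (planeWave (η i) X • phaseSq (η i)) X := fun i => by
    refine ((hasFDerivAt_planeWave (η i) X).smul_const (phase (η i))).congr_fderiv ?_
    ext v w
    simp [phaseSq_apply, mul_assoc]
  exact ((HasFDerivAt.fun_sum fun i _ => h i).const_smul c).fderiv

theorem fderiv_fderiv_waveSum_apply (c : ℂ) (η : ι → V) (X v w : V) :
    fderiv ℝ (fderiv ℝ (waveSum c η)) X v w =
      c * ∑ i, planeWave (η i) X * phaseSq (η i) v w := by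
  rw [fderiv_fderiv_waveSum]
  simp only [_root_.sum_apply, _root_.smul_apply, smul_eq_mul]

/-- The second derivative is a sum of unimodular waves with constant coefficients; it is bounded and
Lipschitz, so a linear modulus serves. -/
theorem isComplexC2Mod_waveSum (c : ℂ) (η : ι → V) : IsComplexC2Mod (waveSum c η) := by
  refine ⟨contDiff_const.mul (ContDiff.sum fun i _ => contDiff_planeWave (η i)),
    ⟨‖c‖ * ∑ i, 1 * ‖phaseSq (η i)‖, fun X => ?_⟩,
    fun t => (‖c‖ * ∑ i, ‖phase (η i)‖ * ‖phaseSq (η i)‖) * t, ?_, fun X Y => ?_⟩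
  · rw [fderiv_fderiv_waveSum]
    exact norm_smul_sum_smul_le (E := V →L[ℝ] V →L[ℝ] ℂ) c
      (fun i => (norm_planeWave (η i) X).le) fun i => phaseSq (η i)
  · have h0 : 0 ≤ ‖c‖ * ∑ i, ‖phase (η i)‖ * ‖phaseSq (η i)‖ := by positivity
    have hid : IsConcaveModulus fun t => t := ⟨continuousOn_id, fun _ _ _ _ h => h,
      fun _ _ _ _ => le_rfl, rfl, concaveOn_id (convex_Ici 0)⟩
    exact hid.const_mul h0
  · have h1 : fderiv ℝ (fderiv ℝ (waveSum c η)) X - fderiv ℝ (fderiv ℝ (waveSum c η)) Y =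
        c • ∑ i, (planeWave (η i) X - planeWave (η i) Y) • phaseSq (η i) := by
      ext v w
      simp only [_root_.sub_apply, fderiv_fderiv_waveSum_apply, _root_.sum_apply,
        _root_.smul_apply, smul_eq_mul, ← mul_sub, ← Finset.sum_sub_distrib, sub_mul]
    rw [h1]
    refine (norm_smul_sum_smul_le (E := V →L[ℝ] V →L[ℝ] ℂ) c
      (fun i => norm_planeWave_sub_le (η i) X Y) fun i => phaseSq (η i)).trans (le_of_eq ?_)
    simp only [mul_right_comm _ ‖X - Y‖, ← Finset.sum_mul, mul_assoc ‖c‖]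

end

theorem permute_apply (σ : Equiv.Perm (Fin k)) (x : Mk d k) (j : Fin k) :
    permute σ x j = x (σ j) := rfl

theorem symExp_eq (ξ : Mk d k) : symExp ξ =
    waveSum (k.factorial : ℂ)⁻¹ fun σ : Equiv.Perm (Fin k) => permute σ ξ := by
  funext X
  simp only [symExp, waveSum, planeWave, phase_apply, PiLp.inner_apply, permute_apply]

theorem isComplexC2Mod_symExp (ξ : Mk d k) : IsComplexC2Mod (symExp ξ) := by
  rw [symExp_eq]
  exact isComplexC2Mod_waveSum _ _

theorem inner_diagVec (η : Mk d k) (v : Sp d) :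
    inner ℝ η (diagVec k v) = inner ℝ (∑ j, η j) v := by
  rw [PiLp.inner_apply, sum_inner]
  rfl

theorem sum_permute (σ : Equiv.Perm (Fin k)) (ξ : Mk d k) : ∑ j, permute σ ξ j = ∑ j, ξ j :=
  Equiv.sum_comp σ fun j => ξ j

theorem sum_inner_stdVec_sq (x : Sp d) : ∑ i : Fin d, inner ℝ x (stdVec i) ^ 2 = ‖x‖ ^ 2 := by
  rw [EuclideanSpace.norm_sq_eq]
  refine Finset.sum_congr rfl fun i _ => ?_
  rw [real_inner_comm, inner_stdVec, Real.norm_eq_abs, sq_abs]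

/-- A wave of frequency `η` has second derivative `-4π²⟨η, E_i⟩²` along `E_i`, and `⟨η, E_i⟩` is the
`i`-th coordinate of `∑ η_j`. All permuted frequencies share this sum, hence the eigenvalue. -/
theorem cLapDiag_symExp (ξ X : Mk d k) :
    cLapDiag (symExp ξ) X = -(lambdaSq ξ : ℂ) * symExp ξ X := by
  have h1 : ∀ σ : Equiv.Perm (Fin k), ∑ i : Fin d,
      phaseSq (permute σ ξ) (diagVec k (stdVec i)) (diagVec k (stdVec i)) = -(lambdaSq ξ : ℂ) := by
    intro σ
    simp_rw [phaseSq_self, inner_diagVec, sum_permute]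
    rw [← Complex.ofReal_sum, ← Finset.mul_sum, sum_inner_stdVec_sq, lambdaSq]
    push_cast
    ring
  simp only [cLapDiag, symExp_eq, fderiv_fderiv_waveSum_apply]
  rw [← Finset.mul_sum, Finset.sum_comm]
  simp_rw [← Finset.mul_sum, h1, ← Finset.sum_mul]
  rw [waveSum]
  ring

/-- Here the directions run over an orthonormal basis of `(ℝ^d)^k`, so the eigenvalue involves `∑
|ξ_j|²`, again invariant under permutations. -/
theorem cLapFull_symExp (ξ X : Mk d k) :
    cLapFull (symExp ξ) X = -((4 * Real.pi ^ 2 * ∑ j, ‖ξ j‖ ^ 2 : ℝ) : ℂ) * symExp ξ X := by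
  have h1 : ∀ σ : Equiv.Perm (Fin k), ∑ i : Fin d, ∑ j : Fin k,
      phaseSq (permute σ ξ) (inj j (stdVec i)) (inj j (stdVec i)) =
        -((4 * Real.pi ^ 2 * ∑ j, ‖ξ j‖ ^ 2 : ℝ) : ℂ) := by
    intro σ
    simp_rw [phaseSq_self, inner_inj_right]
    simp_rw [← Complex.ofReal_sum, ← Finset.mul_sum]
    rw [Finset.sum_comm]
    simp_rw [sum_inner_stdVec_sq, permute_apply]
    rw [Equiv.sum_comp σ fun j => ‖ξ j‖ ^ 2]
    push_cast
    ring
  simp only [cLapFull, symExp_eq, fderiv_fderiv_waveSum_apply]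
  simp_rw [← Finset.mul_sum]
  have h2 : ∀ i : Fin d, ∑ j : Fin k, ∑ σ : Equiv.Perm (Fin k), planeWave (permute σ ξ) X *
      phaseSq (permute σ ξ) (inj j (stdVec i)) (inj j (stdVec i)) =
      ∑ σ : Equiv.Perm (Fin k), ∑ j : Fin k, planeWave (permute σ ξ) X *
      phaseSq (permute σ ξ) (inj j (stdVec i)) (inj j (stdVec i)) := fun i => Finset.sum_comm
  simp_rw [h2]
  rw [Finset.sum_comm]
  simp_rw [← Finset.mul_sum, h1, ← Finset.sum_mul]
  rw [waveSum]
  ring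

theorem polyF_const_mul (c : ℂ) (Φ : Mk d k → ℂ) (m : P2 d) :
    polyF (fun X => c * Φ X) m = c * polyF Φ m := by
  rw [polyF, polyF, integral_const_mul]
  ring

theorem cLaplacian_Fk (ξ : Mk d k) (m : P2 d) :
    cLaplacian (Fk ξ) m = -(lambdaSq ξ : ℂ) * Fk ξ m := by
  rw [Fk, (isComplexC2Mod_symExp ξ).cLaplacian_polyF, ← polyF_const_mul]
  exact congrArg (fun Ψ => polyF Ψ m) (funext (cLapDiag_symExp ξ))

theorem cLaplacianEps_Fk (ε : ℝ) (ξ : Mk d k) (m : P2 d) :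
    cLaplacianEps ε (Fk ξ) m =
      -((lambdaSq ξ + 4 * Real.pi ^ 2 * ε * ∑ j, ‖ξ j‖ ^ 2 : ℝ) : ℂ) * Fk ξ m := by
  rw [Fk, (isComplexC2Mod_symExp ξ).cLaplacianEps_polyF, funext (cLapDiag_symExp ξ),
    funext (cLapFull_symExp ξ), polyF_const_mul, polyF_const_mul]
  push_cast
  ring

theorem Fk_eq_prod (ξ : Mk d k) (m : P2 d) : Fk ξ m = (k : ℂ)⁻¹ * ∏ j, mHat m (ξ j) := by
  have h1 : ∀ η : Mk d k, ∫ x : Fin k → Sp d, planeWave η (WithLp.toLp 2 x)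
      ∂(Measure.pi fun _ => m.1) = ∏ j, mHat m (η j) := by
    intro η
    rw [show ∏ j, mHat m (η j) = ∏ j, ∫ z, Complex.exp (-2 * Real.pi * Complex.I *
      ((inner ℝ (η j) z : ℝ) : ℂ)) ∂m.1 from rfl, ← integral_fintype_prod_eq_prod]
    refine integral_congr_ae (ae_of_all _ fun x => ?_)
    simp only [planeWave, phase_apply, PiLp.inner_apply]
    rw [Complex.ofReal_sum, Finset.mul_sum, Complex.exp_sum]
  have h2 : ∀ η : Mk d k, Integrable (fun x : Fin k → Sp d => planeWave η (WithLp.toLp 2 x))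
      (Measure.pi fun _ => m.1) := fun η =>
    (integrable_const (1 : ℝ)).mono' ((contDiff_planeWave η).continuous.comp
      (PiLp.continuous_toLp 2 _)).aestronglyMeasurable
      (ae_of_all _ fun x => (norm_planeWave η _).le)
  simp only [Fk, polyF, symExp_eq, waveSum]
  rw [integral_const_mul, integral_finsetSum _ fun σ _ => h2 _]
  simp_rw [h1, permute_apply]
  have h3 : ∀ σ : Equiv.Perm (Fin k), ∏ j, mHat m (ξ (σ j)) = ∏ j, mHat m (ξ j) := fun σ =>
    Equiv.prod_comp σ fun j => mHat m (ξ j)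
  simp_rw [h3]
  rw [Finset.sum_const, Finset.card_univ, Fintype.card_perm, Fintype.card_fin, nsmul_eq_mul,
    inv_mul_cancel_left₀ (Nat.cast_ne_zero.2 k.factorial_ne_zero)]

end

section

/-! ### Parametrization of the exponentials -/

variable {d k : ℕ}

/-- The Dirac mass at `y`. -/
def diracP2 (y : Sp d) : P2 d :=
  ⟨Measure.dirac y, inferInstance, by
    rw [lintegral_dirac]
    exact ENNReal.pow_lt_top enorm_lt_top⟩

theorem mHat_eq (m : P2 d) (ξ : Sp d) : mHat m ξ = ∫ z, planeWave ξ z ∂m.1 := rfl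

theorem planeWave_zero (ξ : Sp d) : planeWave ξ 0 = 1 := by simp [planeWave]

theorem Fk_dirac_zero (ξ : Mk d k) : Fk ξ (diracP2 0) = (k : ℂ)⁻¹ := by
  have h : ∀ v : Sp d, mHat (diracP2 0) v = 1 := fun v => by
    rw [mHat_eq, diracP2, integral_dirac, planeWave_zero]
  rw [Fk_eq_prod]
  simp [h]

/-- `F^k_ξ` is an eigenfunction and does not vanish at `δ_0`, so the kernel equation holds only if
the eigenvalue matches. -/
theorem Fk_mem_laplacianKernel_iff (hk : 1 ≤ k) (β : ℝ) (ξ : Mk d k) :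
    Fk ξ ∈ laplacianKernel d β ↔ ξ ∈ conicSurface d k β := by
  have hk0 : (k : ℂ)⁻¹ ≠ 0 := inv_ne_zero (Nat.cast_ne_zero.2 (by omega))
  constructor
  · intro h
    have h1 := (h (diracP2 0)).2
    rw [cLaplacian_Fk, Fk_dirac_zero, ← add_mul, mul_eq_zero, or_iff_left hk0,
      neg_add_eq_zero] at h1
    exact Complex.ofReal_injective h1
  · intro h m
    refine ⟨(isComplexC2Mod_symExp ξ).cTwiceDifferentiableAt_polyF m, ?_⟩
    rw [cLaplacian_Fk, show lambdaSq ξ = β from h]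
    ring

theorem integrable_planeWave (m : P2 d) (ξ : Sp d) : Integrable (planeWave ξ) m.1 :=
  (integrable_const (1 : ℝ)).mono' (contDiff_planeWave ξ).continuous.aestronglyMeasurable
    (ae_of_all _ fun _ => (norm_planeWave ξ _).le)

theorem mHat_mixDirac (m : P2 d) (z : Sp d) {s : ℝ} (hs : s ∈ Set.Icc (0 : ℝ) 1) (ξ : Sp d) :
    mHat (mixDirac m z s hs) ξ = (1 - s : ℝ) * mHat m ξ + s * planeWave ξ z := by
  have h := (integrable_planeWave m ξ).smul_measure (c := ENNReal.ofReal (1 - s))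
    ENNReal.ofReal_ne_top
  have h' : Integrable (planeWave ξ) (ENNReal.ofReal s • Measure.dirac z) :=
    (integrable_planeWave (diracP2 z) ξ).smul_measure ENNReal.ofReal_ne_top
  rw [mHat_eq, mixDirac, integral_add_measure h h', integral_smul_measure, integral_smul_measure,
    integral_dirac, ENNReal.toReal_ofReal (by linarith [hs.2]), ENNReal.toReal_ofReal hs.1,
    mHat_eq]
  simp only [Complex.real_smul]

/-- Equal multisets have fibres of equal cardinality; bijections between the fibres are glued
together. -/
theorem exists_perm_of_map_univ_eq {α : Type*} {f g : Fin k → α}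
    (h : (Finset.univ : Finset (Fin k)).val.map f = Finset.univ.val.map g) :
    ∃ σ : Equiv.Perm (Fin k), ∀ j, g j = f (σ j) := by
  classical
  have hc : ∀ a, Nonempty ({j // g j = a} ≃ {j // f j = a}) := fun a => by
    refine ⟨Fintype.equivOfCardEq ?_⟩
    have h1 := congrArg (Multiset.count a) h
    rw [Multiset.count_map, Multiset.count_map] at h1
    rw [Fintype.card_subtype, Fintype.card_subtype]
    simp only [Finset.card, Finset.filter_val, eq_comm (b := a)] at h1 ⊢
    simp only [eq_comm (a := a)] at h1 ⊢
    exact h1.symm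
  have e' : ∀ a, {j // g j = a} ≃ {j // f j = a} := fun a => (hc a).some
  refine ⟨(Equiv.sigmaFiberEquiv g).symm.trans
    ((Equiv.sigmaCongrRight e').trans (Equiv.sigmaFiberEquiv f)), fun j => ?_⟩
  exact ((e' (g j)) ⟨j, rfl⟩).2.symm

/-- Both sides are monic polynomials in `u` with roots `-a j` and `-b j`; agreeing at infinitely
many points, they have the same roots with multiplicity. -/
theorem exists_perm_of_forall_prod_eq {a b : Fin k → ℂ}
    (h : ∀ u : ℝ, 0 ≤ u → ∏ j, ((u : ℂ) + a j) = ∏ j, ((u : ℂ) + b j)) :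
    ∃ σ : Equiv.Perm (Fin k), ∀ j, b j = a (σ j) := by
  open Polynomial in
  have hp : ∀ a : Fin k → ℂ, ∃ p : ℂ[X], (∀ x, p.eval x = ∏ j, (x + a j)) ∧
      p.roots = (Finset.univ : Finset (Fin k)).val.map fun j => -a j := fun a => by
    refine ⟨(((Finset.univ : Finset (Fin k)).val.map fun j => -a j).map fun c => X - C c).prod,
      fun x => ?_, roots_multiset_prod_X_sub_C _⟩
    rw [Multiset.map_map, eval_multiset_prod, Multiset.map_map]
    simp [Finset.prod]
  obtain ⟨p, hp1, hp2⟩ := hp a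
  obtain ⟨q, hq1, hq2⟩ := hp b
  have hpq : p = q := by
    refine Polynomial.eq_of_infinite_eval_eq p q (Set.Infinite.mono (s := (fun u : ℝ => (u : ℂ)) ''
      Set.Ici 0) ?_ ((Set.Ici_infinite (0 : ℝ)).image Complex.ofReal_injective.injOn))
    rintro _ ⟨u, hu, rfl⟩
    show p.eval (u : ℂ) = q.eval (u : ℂ)
    rw [hp1, hq1, h u hu]
  obtain ⟨σ, hσ⟩ := exists_perm_of_map_univ_eq (hp2.symm.trans (hpq ▸ hq2))
  exact ⟨σ, fun j => neg_injective (hσ j)⟩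

/-- A vector outside finitely many hyperplanes separates the `w i` by inner products. Shrinking it
rules out coincidences modulo the period of the exponential. -/
theorem exists_planeWave_separating {ι : Type*} [Finite ι] (w : ι → Sp d) :
    ∃ z : Sp d, ∀ i j, planeWave (w i) z = planeWave (w j) z → w i = w j := by
  cases nonempty_fintype ι
  obtain ⟨z, hz⟩ := Module.Dual.exists_forall_ne_zero_of_forall_exists (K := ℝ) (M := Sp d)
    (ι := {p : ι × ι // w p.1 ≠ w p.2}) (fun p => innerₛₗ ℝ (w p.1.1 - w p.1.2)) (fun p =>
      ⟨w p.1.1 - w p.1.2, by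
        rw [innerₛₗ_apply_apply, Ne, inner_self_eq_zero, sub_eq_zero]
        exact p.2⟩)
  -- Division by `D` brings every difference of inner products below `1` in absolute value, where
  -- the only integer is `0`.
  set D : ℝ := 1 + ∑ p : ι × ι, |inner ℝ (w p.1 - w p.2) z| with hD
  have hD0 : 0 < D := by positivity
  refine ⟨D⁻¹ • z, fun i j hij => ?_⟩
  by_contra hne
  have h1 : inner ℝ (w i - w j) z ≠ 0 := hz ⟨(i, j), hne⟩
  obtain ⟨n, hn⟩ := Complex.exp_eq_exp_iff_exists_int.1 hij
  rw [phase_apply, phase_apply] at hn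
  have h2 : D⁻¹ * inner ℝ (w i - w j) z = -(n : ℝ) := by
    have hpi : (2 * Real.pi * Complex.I : ℂ) ≠ 0 := Complex.two_pi_I_ne_zero
    rw [← inner_smul_right, inner_sub_left]
    apply Complex.ofReal_injective
    push_cast
    refine mul_left_cancel₀ hpi ?_
    linear_combination -hn
  have h3 : |inner ℝ (w i - w j) z| < D := by
    have := Finset.single_le_sum (f := fun p : ι × ι => |inner ℝ (w p.1 - w p.2) z|)
      (fun p _ => abs_nonneg _) (Finset.mem_univ (i, j))
    simp only at this
    linarith
  have h4 : |(n : ℝ)| < 1 := by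
    rw [← abs_neg, ← h2, abs_mul, abs_of_pos (inv_pos.2 hD0), inv_mul_lt_iff₀ hD0, mul_one]
    exact h3
  have h5 : n = 0 := by
    have h6 : |n| < 1 := by exact_mod_cast h4
    exact Int.abs_lt_one_iff.1 h6
  rw [h5, Int.cast_zero, neg_zero, mul_eq_zero, or_iff_right (inv_pos.2 hD0).ne'] at h2
  exact h1 h2

/-- On `(1 - s)δ_0 + sδ_z` with `s = 1/(1 + u)` the product becomes `(1 + u)⁻ᵏ ∏ (u + planeWave (ξ
j) z)`. Hence `F^k_ξ` determines the values `planeWave (ξ j) z` up to order, and for a separating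
`z` these determine the `ξ j`. -/
theorem Fk_eq_iff (hk : 1 ≤ k) (ξ η : Mk d k) :
    Fk ξ = Fk η ↔ ∃ σ : Equiv.Perm (Fin k), η = permute σ ξ := by
  constructor
  · intro h
    obtain ⟨z, hz⟩ := exists_planeWave_separating (Sum.elim (fun j => ξ j) fun j => η j)
    have hk0 : (k : ℂ)⁻¹ ≠ 0 := inv_ne_zero (Nat.cast_ne_zero.2 (by omega))
    obtain ⟨σ, hσ⟩ := exists_perm_of_forall_prod_eq (a := fun j => planeWave (ξ j) z)
      (b := fun j => planeWave (η j) z) fun u hu => by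
        have hu1 : (0 : ℝ) < 1 + u := by linarith
        have hs : (1 + u)⁻¹ ∈ Set.Icc (0 : ℝ) 1 :=
          ⟨by positivity, inv_le_one_of_one_le₀ (by linarith)⟩
        have hu1' : (1 + u : ℂ) ≠ 0 := by exact_mod_cast hu1.ne'
        have key : ∀ ζ : Mk d k, ∏ j, ((u : ℂ) + planeWave (ζ j) z) =
            (1 + u : ℂ) ^ k * ∏ j, mHat (mixDirac (diracP2 0) z _ hs) (ζ j) := by
          intro ζ
          have hpow : (1 + u : ℂ) ^ k = ∏ _j : Fin k, (1 + u : ℂ) := by simp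
          rw [hpow, ← Finset.prod_mul_distrib]
          refine Finset.prod_congr rfl fun j _ => ?_
          rw [mHat_mixDirac, mHat_eq, diracP2, integral_dirac, planeWave_zero]
          push_cast
          field_simp
          ring
        have h1 := congrFun h (mixDirac (diracP2 0) z _ hs)
        rw [Fk_eq_prod, Fk_eq_prod] at h1
        rw [key, key, mul_left_cancel₀ hk0 h1]
    refine ⟨σ, ?_⟩
    ext j : 1
    exact hz (Sum.inr j) (Sum.inl (σ j)) (hσ j)
  · rintro ⟨σ, rfl⟩
    funext m
    rw [Fk_eq_prod, Fk_eq_prod]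
    exact congrArg _ (Equiv.prod_comp σ fun j => mHat m (ξ j)).symm

end

section

/-! ### Fourier transforms of functions of quadratic growth -/

section

open LineDeriv

variable {V : Type*} [NormedAddCommGroup V] [InnerProductSpace ℝ V] [FiniteDimensional ℝ V]
  [MeasurableSpace V] [BorelSpace V]

theorem integrable_mul_schwartz {g : V → ℂ} (hg : Continuous g) {C : ℝ}
    (hC : ∀ x, ‖g x‖ ≤ C * (1 + ‖x‖ ^ 2)) (ψ : 𝓢(V, ℂ)) : Integrable fun x => g x * ψ x := by
  have h1 : Integrable fun x : V => C * (‖x‖ ^ 0 * ‖ψ x‖ + ‖x‖ ^ 2 * ‖ψ x‖) :=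
    ((ψ.integrable_pow_mul volume 0).add (ψ.integrable_pow_mul volume 2)).const_mul C
  refine h1.mono' (hg.mul ψ.continuous).aestronglyMeasurable (ae_of_all _ fun x => ?_)
  rw [norm_mul, pow_zero, ← add_mul, ← mul_assoc]
  exact mul_le_mul_of_nonneg_right (hC x) (norm_nonneg _)

theorem integral_mul_lineDeriv_eq_neg {g : V → ℂ} (hg : ContDiff ℝ 1 g) {C C' : ℝ}
    (hC : ∀ x, ‖g x‖ ≤ C * (1 + ‖x‖ ^ 2)) (v : V)
    (hC' : ∀ x, ‖fderiv ℝ g x v‖ ≤ C' * (1 + ‖x‖ ^ 2)) (ψ : 𝓢(V, ℂ)) :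
    ∫ x, g x * (∂_{v} ψ) x = -∫ x, fderiv ℝ g x v * ψ x := by
  refine integral_mul_fderiv_eq_neg_fderiv_mul_of_integrable
    (integrable_mul_schwartz ((hg.continuous_fderiv one_ne_zero).clm_apply continuous_const) hC' ψ)
    (integrable_mul_schwartz hg.continuous hC (∂_{v} ψ)) (integrable_mul_schwartz hg.continuous hC ψ)
    (fun x _ => hg.differentiable one_ne_zero x) fun x _ => ψ.differentiableAt

theorem IsComplexC2Mod.integral_mul_lineDeriv_lineDeriv {Φ : V → ℂ} (h : IsComplexC2Mod Φ) {C : ℝ}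
    (hC : ∀ x, ‖Φ x‖ ≤ C * (1 + ‖x‖ ^ 2)) (v : V) (ψ : 𝓢(V, ℂ)) :
    ∫ x, Φ x * (∂_{v} (∂_{v} ψ)) x = ∫ x, fderiv ℝ (fderiv ℝ Φ) x v v * ψ x := by
  obtain ⟨K, hK⟩ := h.bounded
  have hK0 : 0 ≤ K := le_trans (norm_nonneg (fderiv ℝ (fderiv ℝ Φ) 0)) (hK 0)
  have hd : ContDiff ℝ 1 (fderiv ℝ Φ) := h.contDiff.fderiv_right (m := 1) (by norm_num)
  have hdv : ContDiff ℝ 1 fun x => fderiv ℝ Φ x v := hd.clm_apply contDiff_const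
  have h2 : ∀ x, fderiv ℝ (fun x => fderiv ℝ Φ x v) x v = fderiv ℝ (fderiv ℝ Φ) x v v := fun x => by
    have h3 : HasFDerivAt (fun x => fderiv ℝ Φ x v)
        ((ContinuousLinearMap.apply ℝ ℂ v).comp (fderiv ℝ (fderiv ℝ Φ) x)) x :=
      (ContinuousLinearMap.apply ℝ ℂ v).hasFDerivAt.comp x
        (hd.differentiable one_ne_zero x).hasFDerivAt
    rw [h3.fderiv]
    rfl
  have b1 : ∀ x, ‖fderiv ℝ Φ x v‖ ≤ ((‖fderiv ℝ Φ 0‖ + K) * ‖v‖) * (1 + ‖x‖ ^ 2) := fun x => by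
    have h4 := Convex.norm_image_sub_le_of_norm_fderiv_le (𝕜 := ℝ) (f := fderiv ℝ Φ)
      (fun y _ => hd.differentiable one_ne_zero y) (fun y _ => hK y) convex_univ (Set.mem_univ 0)
      (Set.mem_univ x)
    have h5 := norm_le_norm_add_norm_sub (fderiv ℝ Φ 0) (fderiv ℝ Φ x)
    rw [norm_sub_rev] at h5
    rw [sub_zero] at h4
    have h6 : ‖fderiv ℝ Φ x‖ ≤ (‖fderiv ℝ Φ 0‖ + K) * (1 + ‖x‖ ^ 2) := by
      have h7 : ‖x‖ ≤ 1 + ‖x‖ ^ 2 := by nlinarith [sq_nonneg (‖x‖ - 1)]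
      have h8 := mul_le_mul_of_nonneg_left h7 hK0
      nlinarith [mul_nonneg (norm_nonneg (fderiv ℝ Φ 0)) (sq_nonneg ‖x‖)]
    calc ‖fderiv ℝ Φ x v‖ ≤ ‖fderiv ℝ Φ x‖ * ‖v‖ := (fderiv ℝ Φ x).le_opNorm v
      _ ≤ (‖fderiv ℝ Φ 0‖ + K) * (1 + ‖x‖ ^ 2) * ‖v‖ := by gcongr
      _ = _ := by ring
  have b2 : ∀ x, ‖fderiv ℝ (fun x => fderiv ℝ Φ x v) x v‖ ≤ (K * ‖v‖ * ‖v‖) * (1 + ‖x‖ ^ 2) :=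
    fun x => by
      rw [h2]
      have h3 : ‖fderiv ℝ (fderiv ℝ Φ) x v v‖ ≤ K * ‖v‖ * ‖v‖ :=
        (ContinuousLinearMap.le_opNorm₂ _ v v).trans (by gcongr; exact hK x)
      have h4 : 0 ≤ K * ‖v‖ * ‖v‖ * ‖x‖ ^ 2 := by positivity
      linarith
  rw [integral_mul_lineDeriv_eq_neg (h.contDiff.of_le one_le_two) hC v b1,
    integral_mul_lineDeriv_eq_neg hdv b1 v b2, neg_neg]
  simp_rw [h2]

variable {ι : Type*} [Fintype ι]

/-- The Fourier transform exchanges multiplication by `-2πi⟨·, v⟩` with `∂_v`. Two such factors give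
`-4π²⟨·, v⟩²`, whence the overall sign. -/
theorem exists_schwartz_symbol_mul (E : ι → V) (β : ℝ) (φ : 𝓢(V, ℂ)) :
    ∃ χ : 𝓢(V, ℂ), (∀ ξ, χ ξ =
      ((4 * Real.pi ^ 2 * ∑ i, inner ℝ ξ (E i) ^ 2 - β : ℝ) : ℂ) * φ ξ) ∧
      ∀ x, (𝓕 χ) x = -(∑ i, (∂_{E i} (∂_{E i} (𝓕 φ))) x + (β : ℂ) * (𝓕 φ) x) := by
  set M : V → 𝓢(V, ℂ) → 𝓢(V, ℂ) := fun v f =>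
    -(2 * Real.pi * Complex.I : ℂ) • SchwartzMap.smulLeftCLM ℂ (inner ℝ · v) f with hM
  have hMx : ∀ v f ξ, M v f ξ = -(2 * Real.pi * Complex.I : ℂ) * ((inner ℝ ξ v : ℝ) * f ξ) := by
    intro v f ξ
    simp only [hM, _root_.smul_apply, smul_eq_mul,
      SchwartzMap.smulLeftCLM_apply_apply (Function.hasTemperateGrowth_inner_left v), Complex.real_smul]
  have hF : ∀ v f, ∂_{v} (𝓕 f) = 𝓕 (M v f) := fun v f => SchwartzMap.lineDerivOp_fourier_eq f v
  refine ⟨-(∑ i, M (E i) (M (E i) φ) + (β : ℂ) • φ), fun ξ => ?_, fun x => ?_⟩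
  · have h1 : (∑ i, M (E i) (M (E i) φ)) ξ = ∑ i, M (E i) (M (E i) φ) ξ :=
      _root_.sum_apply _ _ _
    have h2 : ∑ i, -(2 * Real.pi * Complex.I : ℂ) * (((inner ℝ ξ (E i) : ℝ) : ℂ) *
        (-(2 * Real.pi * Complex.I : ℂ) * (((inner ℝ ξ (E i) : ℝ) : ℂ) * φ ξ))) =
        -(4 * Real.pi ^ 2 * ∑ i, ((inner ℝ ξ (E i) : ℝ) : ℂ) ^ 2) * φ ξ := by
      rw [Finset.mul_sum, ← Finset.sum_neg_distrib, Finset.sum_mul]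
      refine Finset.sum_congr rfl fun i _ => ?_
      linear_combination (4 * (Real.pi : ℂ) ^ 2 * ((inner ℝ ξ (E i) : ℝ) : ℂ) ^ 2 * φ ξ) *
        Complex.I_sq
    simp only [_root_.neg_apply, _root_.add_apply, h1, _root_.smul_apply, hMx]
    rw [h2]
    push_cast
    simp only [smul_eq_mul]
    ring
  · have h1 : 𝓕 (-(∑ i, M (E i) (M (E i) φ) + (β : ℂ) • φ)) =
        -(∑ i, ∂_{E i} (∂_{E i} (𝓕 φ)) + (β : ℂ) • 𝓕 φ) := by
      simp_rw [hF]
      rw [← SchwartzMap.fourierTransformCLM_apply (𝕜 := ℂ), map_neg, map_add, map_sum, map_smul]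
      rfl
    rw [h1]
    have h2 : (∑ i, ∂_{E i} (∂_{E i} (𝓕 φ))) x = ∑ i, (∂_{E i} (∂_{E i} (𝓕 φ))) x :=
      _root_.sum_apply _ _ _
    simp only [_root_.neg_apply, _root_.add_apply, h2, _root_.smul_apply, smul_eq_mul]

/-- The second order operator `∑ i, D²Φ(E_i, E_i) + β Φ`. -/
def helmholtz (E : ι → V) (β : ℝ) (Φ : V → ℂ) (x : V) : ℂ :=
  ∑ i, fderiv ℝ (fderiv ℝ Φ) x (E i) (E i) + β * Φ x

theorem IsComplexC2Mod.continuous_helmholtz {W : Type*} [NormedAddCommGroup W]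
    [InnerProductSpace ℝ W] {Φ : W → ℂ} (h : IsComplexC2Mod Φ) (E : ι → W) (β : ℝ) : Continuous (helmholtz E β Φ) := by
  have h1 : Continuous (fderiv ℝ (fderiv ℝ Φ)) :=
    (h.contDiff.fderiv_right (m := 1) (by norm_num)).continuous_fderiv one_ne_zero
  exact (continuous_finsetSum _ fun i _ => (h1.clm_apply continuous_const).clm_apply
    continuous_const).add (continuous_const.mul h.contDiff.continuous)

/-- Transfer the symbol to derivatives of `𝓕 φ`, then move these onto `Φ` by two integrations by
parts; quadratic growth against Schwartz decay leaves no boundary terms. -/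
theorem IsComplexC2Mod.integral_mul_fourier_symbol {Φ : V → ℂ} (h : IsComplexC2Mod Φ) {C : ℝ}
    (hC : ∀ x, ‖Φ x‖ ≤ C * (1 + ‖x‖ ^ 2)) (E : ι → V) (β : ℝ) (φ : 𝓢(V, ℂ)) :
    ∫ x, Φ x * 𝓕 (fun ξ : V =>
      ((4 * Real.pi ^ 2 * ∑ i, inner ℝ ξ (E i) ^ 2 - β : ℝ) : ℂ) * φ ξ) x =
      -∫ x, helmholtz E β Φ x * (𝓕 φ) x := by
  obtain ⟨χ, hχ1, hχ2⟩ := exists_schwartz_symbol_mul E β φ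
  obtain ⟨K, hK⟩ := h.bounded
  have hK0 : 0 ≤ K := le_trans (norm_nonneg (fderiv ℝ (fderiv ℝ Φ) 0)) (hK 0)
  have h1 : ∀ x, 𝓕 (fun ξ : V =>
      ((4 * Real.pi ^ 2 * ∑ i, inner ℝ ξ (E i) ^ 2 - β : ℝ) : ℂ) * φ ξ) x = (𝓕 χ) x := fun x => by
    rw [← funext hχ1]
    rfl
  have hcont : Continuous (fderiv ℝ (fderiv ℝ Φ)) :=
    (h.contDiff.fderiv_right (m := 1) (by norm_num)).continuous_fderiv one_ne_zero
  have i1 : ∀ i, Integrable fun x => Φ x * (∂_{E i} (∂_{E i} (𝓕 φ))) x := fun i =>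
    integrable_mul_schwartz h.contDiff.continuous hC _
  have i2 : ∀ i, Integrable fun x => fderiv ℝ (fderiv ℝ Φ) x (E i) (E i) * (𝓕 φ) x := fun i =>
    integrable_mul_schwartz (C := K * ‖E i‖ * ‖E i‖)
      ((hcont.clm_apply continuous_const).clm_apply continuous_const) (fun x => by
        have h3 : ‖fderiv ℝ (fderiv ℝ Φ) x (E i) (E i)‖ ≤ K * ‖E i‖ * ‖E i‖ :=
          (ContinuousLinearMap.le_opNorm₂ _ _ _).trans (by gcongr; exact hK x)
        have h4 : 0 ≤ K * ‖E i‖ * ‖E i‖ * ‖x‖ ^ 2 := by positivity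
        linarith) _
  have i3 : Integrable fun x => β * (Φ x * (𝓕 φ) x) :=
    (integrable_mul_schwartz h.contDiff.continuous hC (𝓕 φ)).const_mul (β : ℂ)
  simp_rw [h1, hχ2]
  have e1 : ∀ x, Φ x * -(∑ i, (∂_{E i} (∂_{E i} (𝓕 φ))) x + β * (𝓕 φ) x) =
      -(∑ i, Φ x * (∂_{E i} (∂_{E i} (𝓕 φ))) x + β * (Φ x * (𝓕 φ) x)) := fun x => by
    rw [← Finset.mul_sum]
    ring
  have e2 : ∀ x, helmholtz E β Φ x * (𝓕 φ) x =
      ∑ i, fderiv ℝ (fderiv ℝ Φ) x (E i) (E i) * (𝓕 φ) x + β * (Φ x * (𝓕 φ) x) := fun x => by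
    rw [helmholtz, add_mul, Finset.sum_mul]
    ring
  simp_rw [e1, e2]
  rw [integral_neg, integral_add (integrable_finsetSum _ fun i _ => i1 i) i3,
    integral_add (integrable_finsetSum _ fun i _ => i2 i) i3,
    integral_finsetSum _ fun i _ => i1 i, integral_finsetSum _ fun i _ => i2 i]
  simp_rw [h.integral_mul_lineDeriv_lineDeriv hC]

theorem eq_zero_of_integral_mul_schwartz {Ψ : V → ℂ} (hΨ : Continuous Ψ)
    (h : ∀ ψ : 𝓢(V, ℂ), ∫ x, Ψ x * ψ x = 0) : Ψ = 0 := by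
  refine (Continuous.ae_eq_iff_eq volume hΨ continuous_const).1 ?_
  refine ae_eq_zero_of_integral_contDiff_smul_eq_zero hΨ.locallyIntegrable fun g hg hgc => ?_
  have hc : HasCompactSupport fun x => (g x : ℂ) := hgc.comp_left Complex.ofReal_zero
  have h1 := h (hc.toSchwartzMap (Complex.ofRealCLM.contDiff.comp hg))
  rw [← h1]
  refine integral_congr_ae (ae_of_all _ fun x => ?_)
  simp only [Complex.real_smul]
  rw [mul_comm]
  rfl

theorem IsComplexC2Mod.forall_integral_mul_fourier_symbol_eq_zero_iff {Φ : V → ℂ}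
    (h : IsComplexC2Mod Φ) {C : ℝ} (hC : ∀ x, ‖Φ x‖ ≤ C * (1 + ‖x‖ ^ 2)) (E : ι → V) (β : ℝ) :
    (∀ φ : 𝓢(V, ℂ), ∫ x, Φ x * 𝓕 (fun ξ : V =>
      ((4 * Real.pi ^ 2 * ∑ i, inner ℝ ξ (E i) ^ 2 - β : ℝ) : ℂ) * φ ξ) x = 0) ↔
      helmholtz E β Φ = 0 := by
  simp_rw [h.integral_mul_fourier_symbol hC]
  constructor
  · intro h1
    refine eq_zero_of_integral_mul_schwartz (h.continuous_helmholtz E β) fun ψ => ?_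
    -- The Fourier transform is onto the Schwartz functions, so the functions `𝓕 φ` exhaust all
    -- tests.
    have h2 := h1 (𝓕⁻ ψ)
    rwa [FourierTransform.fourier_fourierInv_eq, neg_eq_zero] at h2
  · intro h1 φ
    simp [h1]

end

end

section

/-! ### Polarization -/

variable {d k : ℕ}

/-- The uniform distribution on the points `x i`, `i ∈ S`. -/
def empirical (x : Fin k → Sp d) (S : Finset (Fin k)) (hS : S.Nonempty) : P2 d :=
  ⟨(PMF.uniformOfFinset S hS).toMeasure.map x,
    Measure.isProbabilityMeasure_map (measurable_of_finite x).aemeasurable, by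
    rw [lintegral_map (by fun_prop) (measurable_of_finite x), lintegral_fintype]
    exact ENNReal.sum_lt_top.2 fun i _ => ENNReal.mul_lt_top (ENNReal.pow_lt_top enorm_lt_top)
      (measure_lt_top _ _)⟩

/-- The `k`-fold product of the uniform law on `S` is uniform on the maps `f : Fin k → Fin k` with
values in `S`. -/
theorem integral_pw_empirical {Ψ : Mk d k → ℂ} (hΨ : Continuous Ψ) (x : Fin k → Sp d)
    {S : Finset (Fin k)} (hS : S.Nonempty) :
    ∫ X, Ψ X ∂(pw (empirical x S hS).1 k) =
      (((S.card : ℝ)⁻¹ ^ k : ℝ) : ℂ) *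
        ∑ f : Fin k → Fin k with ∀ j, f j ∈ S, Ψ (WithLp.toLp 2 fun j => x (f j)) := by
  set μ := (PMF.uniformOfFinset S hS).toMeasure with hμ
  have hx : MeasurePreserving x μ (empirical x S hS).1 := (measurable_of_finite x).measurePreserving _
  rw [← integral_comp_tup hx hΨ.aestronglyMeasurable, integral_fintype (Integrable.of_finite),
    Finset.sum_filter, Finset.mul_sum]
  refine Finset.sum_congr rfl fun f _ => ?_
  have h1 : (Measure.pi fun _ : Fin k => μ).real {f} =
      if ∀ j, f j ∈ S then (S.card : ℝ)⁻¹ ^ k else 0 := by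
    have h2 : ∀ j, (μ {f j}).toReal = if f j ∈ S then (S.card : ℝ)⁻¹ else 0 := fun j => by
      rw [hμ, PMF.toMeasure_apply_singleton _ _ (measurableSet_singleton _),
        PMF.uniformOfFinset_apply]
      split_ifs <;> simp
    rw [measureReal_def, Measure.pi_singleton, ENNReal.toReal_prod]
    simp_rw [h2]
    rw [Finset.prod_ite_zero]
    simp
  rw [h1]
  split_ifs
  · rw [Complex.real_smul]
    rfl
  · simp

/-- Inclusion–exclusion by induction on `S`: group the maps into `S` by their image; all proper
images contribute zero. -/
theorem eq_zero_of_sum_image_subset_eq_zero {M : Type*} [AddCommGroup M] (F : (Fin k → Fin k) → M)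
    (h : ∀ S : Finset (Fin k), ∑ f : Fin k → Fin k with ∀ j, f j ∈ S, F f = 0) (S : Finset (Fin k)) :
    ∑ f : Fin k → Fin k with Finset.univ.image f = S, F f = 0 := by
  induction S using Finset.strongInduction with
  | _ S ih =>
    have h1 := h S
    have h2 : ∀ f : Fin k → Fin k, (∀ j, f j ∈ S) ↔ Finset.univ.image f ∈ S.powerset := fun f => by
      simp [Finset.image_subset_iff]
    simp_rw [h2] at h1
    rw [← Finset.sum_fiberwise_of_maps_to (t := S.powerset) (g := fun f => Finset.univ.image f)
      (fun f hf => (Finset.mem_filter.1 hf).2)] at h1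
    have h3 : ∀ T ∈ S.powerset, ∑ f ∈ ({f : Fin k → Fin k | Finset.univ.image f ∈ S.powerset} :
        Finset (Fin k → Fin k)) with Finset.univ.image f = T, F f =
        ∑ f : Fin k → Fin k with Finset.univ.image f = T, F f := fun T hT => by
      rw [Finset.filter_filter]
      refine Finset.sum_congr (Finset.filter_congr fun f _ => ?_) fun _ _ => rfl
      exact ⟨fun h => h.2, fun h => ⟨h ▸ hT, h⟩⟩
    rw [Finset.sum_congr rfl h3, ← Finset.sum_erase_add _ _ (Finset.mem_powerset_self S),
      Finset.sum_eq_zero, zero_add] at h1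
    · exact h1
    · intro T hT
      rw [Finset.mem_erase, Finset.mem_powerset] at hT
      exact ih T (hT.2.ssubset_of_ne hT.1)

/-- Polarization. Uniform laws on the subsets of `{X_1, …, X_k}` isolate the sum of `Ψ` over
surjective selections. These are the permutations, and by symmetry each contributes `Ψ X`. -/
theorem eq_zero_of_forall_integral_pw_eq_zero (hk : 1 ≤ k) {Ψ : Mk d k → ℂ} (hΨ : Continuous Ψ)
    (hs : ∀ (σ : Equiv.Perm (Fin k)) X, Ψ (permute σ X) = Ψ X)
    (h : ∀ m : P2 d, ∫ X, Ψ X ∂(pw m.1 k) = 0) : Ψ = 0 := by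
  funext X
  have h1 := eq_zero_of_sum_image_subset_eq_zero
    (fun f : Fin k → Fin k => Ψ (WithLp.toLp 2 fun j => X (f j))) (fun S => by
      rcases S.eq_empty_or_nonempty with rfl | hS
      -- There is no uniform law on `∅`, but for `k ≥ 1` no map takes its values there.
      · refine Finset.sum_eq_zero fun f hf => ?_
        exact absurd ((Finset.mem_filter.1 hf).2 ⟨0, hk⟩) (Finset.notMem_empty _)
      · have h2 := integral_pw_empirical hΨ (fun j => X j) hS
        rw [h, zero_eq_mul, or_iff_right] at h2
        · exact h2
        · have : (S.card : ℝ) ≠ 0 := Nat.cast_ne_zero.2 hS.card_pos.ne'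
          exact_mod_cast pow_ne_zero k (inv_ne_zero this)) Finset.univ
  have h2 : ∀ f ∈ ({f : Fin k → Fin k | Finset.univ.image f = Finset.univ} :
      Finset (Fin k → Fin k)), Ψ (WithLp.toLp 2 fun j => X (f j)) = Ψ X := fun f hf => by
    have hf' : Function.Surjective f := by
      intro b
      have hb : b ∈ Finset.univ.image f := by
        rw [(Finset.mem_filter.1 hf).2]
        exact Finset.mem_univ b
      obtain ⟨a, -, ha⟩ := Finset.mem_image.1 hb
      exact ⟨a, ha⟩
    exact hs (Equiv.ofBijective f (Finite.surjective_iff_bijective.1 hf')) X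
  rw [Finset.sum_congr rfl h2, Finset.sum_const, smul_eq_zero, or_iff_right] at h1
  · exact h1
  · refine Finset.card_ne_zero_of_mem (a := id) ?_
    simp

/-! ### Polynomials in the kernel -/

/-- Permutation of the entries as a continuous linear map. -/
def permuteCLM (σ : Equiv.Perm (Fin k)) : Mk d k →L[ℝ] Mk d k := ∑ j, (inj j).comp (prj (σ j))

theorem permuteCLM_apply (σ : Equiv.Perm (Fin k)) (X : Mk d k) :
    permuteCLM σ X = permute σ X := by
  rw [permuteCLM, _root_.sum_apply]
  exact sum_inj (permute σ X)

theorem fderiv_fderiv_comp_clm_apply {V W F : Type*} [NormedAddCommGroup V] [NormedSpace ℝ V]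
    [NormedAddCommGroup W] [NormedSpace ℝ W] [NormedAddCommGroup F] [NormedSpace ℝ F] {Φ : W → F}
    (h : ContDiff ℝ 2 Φ) (P : V →L[ℝ] W) (x v w : V) :
    fderiv ℝ (fderiv ℝ fun x => Φ (P x)) x v w = fderiv ℝ (fderiv ℝ Φ) (P x) (P v) (P w) := by
  have hd : ContDiff ℝ 1 (fderiv ℝ Φ) := h.fderiv_right (m := 1) (by norm_num)
  have h1 : fderiv ℝ (fun x => Φ (P x)) = fun x =>
      (ContinuousLinearMap.compL ℝ V W F).flip P (fderiv ℝ Φ (P x)) := funext fun x =>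
    ((h.differentiable two_ne_zero (P x)).hasFDerivAt.comp x P.hasFDerivAt).fderiv
  have h2 := ((ContinuousLinearMap.compL ℝ V W F).flip P).hasFDerivAt.comp x
    ((hd.differentiable one_ne_zero (P x)).hasFDerivAt.comp x P.hasFDerivAt)
  rw [h1]
  have h3 := h2.fderiv
  simp only [Function.comp_def] at h3
  rw [h3]
  rfl

theorem permute_diagVec (σ : Equiv.Perm (Fin k)) (v : Sp d) :
    permute σ (diagVec k v) = diagVec k v := rfl

variable {Φ : Mk d k → ℂ}

theorem helmholtz_diagVec (β : ℝ) (X : Mk d k) :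
    helmholtz (fun i : Fin d => diagVec k (stdVec i)) β Φ X = cLapDiag Φ X + β * Φ X := rfl

/-- Permutations fix the diagonal directions, so the operator preserves symmetry; polarization
requires this. -/
theorem IsSymC2.helmholtz_permute (h : IsSymC2 Φ) (β : ℝ) (σ : Equiv.Perm (Fin k)) (X : Mk d k) :
    helmholtz (fun i : Fin d => diagVec k (stdVec i)) β Φ (permute σ X) =
      helmholtz (fun i : Fin d => diagVec k (stdVec i)) β Φ X := by
  have h1 : (fun X => Φ (permuteCLM σ X)) = Φ := funext fun X => by
    rw [permuteCLM_apply, h.symm]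
  have h2 : ∀ i : Fin d,
      fderiv ℝ (fderiv ℝ Φ) (permute σ X) (diagVec k (stdVec i)) (diagVec k (stdVec i)) =
        fderiv ℝ (fderiv ℝ Φ) X (diagVec k (stdVec i)) (diagVec k (stdVec i)) := fun i => by
    have h3 := fderiv_fderiv_comp_clm_apply h.contDiff (permuteCLM σ) X
      (diagVec k (stdVec i)) (diagVec k (stdVec i))
    rw [h1, permuteCLM_apply, permuteCLM_apply, permute_diagVec] at h3
    exact h3.symm
  rw [helmholtz, helmholtz, h.symm]
  simp_rw [h2]

theorem IsSymC2.polyF_mem_laplacianKernel_iff (hk : 1 ≤ k) (h : IsSymC2 Φ) (β : ℝ) :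
    polyF Φ ∈ laplacianKernel d β ↔
      helmholtz (fun i : Fin d => diagVec k (stdVec i)) β Φ = 0 := by
  have h' := h.isComplexC2Mod
  have hk0 : (k : ℂ)⁻¹ ≠ 0 := inv_ne_zero (Nat.cast_ne_zero.2 (by omega))
  have key : ∀ m : P2 d, cLaplacian (polyF Φ) m + β * polyF Φ m = (k : ℂ)⁻¹ *
      ∫ X, helmholtz (fun i : Fin d => diagVec k (stdVec i)) β Φ X ∂(pw m.1 k) := fun m => by
    simp_rw [helmholtz_diagVec]
    rw [h'.cLaplacian_polyF, polyF_eq h'.continuous_cLapDiag, polyF_eq h'.contDiff.continuous,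
      integral_add (h'.integrable_cLapDiag m) ((h'.integrable_pw m).const_mul _),
      integral_const_mul]
    ring
  constructor
  · intro hmem
    refine eq_zero_of_forall_integral_pw_eq_zero hk (h'.continuous_helmholtz _ β)
      (h.helmholtz_permute β) fun m => ?_
    have h1 := (hmem m).2
    rw [key, mul_eq_zero, or_iff_right hk0] at h1
    exact h1
  · intro h0 m
    refine ⟨h'.cTwiceDifferentiableAt_polyF m, ?_⟩
    rw [key, h0]
    simp

theorem lambdaSq_eq (ξ : Mk d k) :
    lambdaSq ξ = 4 * Real.pi ^ 2 * ∑ i : Fin d, inner ℝ ξ (diagVec k (stdVec i)) ^ 2 := by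
  simp_rw [inner_diagVec]
  rw [sum_inner_stdVec_sq, lambdaSq]

theorem IsSymC2.fourierAnnihilated_iff (h : IsSymC2 Φ) (β : ℝ) :
    FourierAnnihilated β Φ ↔ helmholtz (fun i : Fin d => diagVec k (stdVec i)) β Φ = 0 := by
  obtain ⟨C, hC⟩ := h.growth
  rw [← h.isComplexC2Mod.forall_integral_mul_fourier_symbol_eq_zero_iff hC, FourierAnnihilated]
  simp_rw [lambdaSq_eq]

theorem contDiff_lambdaSq : ContDiff ℝ (⊤ : ℕ∞) (lambdaSq : Mk d k → ℝ) := by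
  rw [funext lambdaSq_eq]
  refine contDiff_const.mul (ContDiff.sum fun i _ => ContDiff.pow ?_ 2)
  exact contDiff_id.inner ℝ contDiff_const

theorem contDiff_div_of_ne_zero_on_tsupport {V : Type*} [NormedAddCommGroup V] [NormedSpace ℝ V]
    {f g : V → ℂ} (hf : ContDiff ℝ (⊤ : ℕ∞) f) (hg : ContDiff ℝ (⊤ : ℕ∞) g)
    (h : ∀ x ∈ tsupport f, g x ≠ 0) : ContDiff ℝ (⊤ : ℕ∞) fun x => f x / g x := by
  refine contDiff_iff_contDiffAt.2 fun x => ?_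
  by_cases hx : x ∈ tsupport f
  · simp_rw [div_eq_mul_inv]
    exact hf.contDiffAt.mul (hg.contDiffAt.inv (h x hx))
  · have h1 : (fun x => f x / g x) =ᶠ[𝓝 x] fun _ => 0 := by
      filter_upwards [notMem_tsupport_iff_eventuallyEq.1 hx] with y hy
      rw [hy]
      simp
    exact contDiffAt_const.congr_of_eventuallyEq h1

/-- A test function supported away from the surface can be divided by `λ_k² - β`, which does not
vanish on its support; the quotient is smooth with compact support, and annihilation applies to it.
-/
theorem FourierAnnihilated.fourierSupportedIn {β : ℝ} (h : FourierAnnihilated β Φ) :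
    FourierSupportedIn (conicSurface d k β) Φ := by
  intro φ hφ hdisj
  have hne : ∀ ξ ∈ tsupport φ, ((lambdaSq ξ - β : ℝ) : ℂ) ≠ 0 := fun ξ hξ h0 => by
    rw [Complex.ofReal_eq_zero, sub_eq_zero] at h0
    exact Set.disjoint_left.1 hdisj hξ h0
  have hg : ContDiff ℝ (⊤ : ℕ∞) fun ξ : Mk d k => ((lambdaSq ξ - β : ℝ) : ℂ) :=
    Complex.ofRealCLM.contDiff.comp (contDiff_lambdaSq.sub contDiff_const)
  have hc : HasCompactSupport fun ξ => φ ξ / ((lambdaSq ξ - β : ℝ) : ℂ) :=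
    hφ.mono fun ξ hξ => by
      rw [Function.mem_support] at hξ ⊢
      exact fun h0 => hξ (by rw [h0, zero_div])
  have h1 := h (hc.toSchwartzMap (contDiff_div_of_ne_zero_on_tsupport (φ.smooth _) hg hne))
  rw [← h1]
  have h2 : (fun ξ => φ ξ) = fun ξ : Mk d k => ((lambdaSq ξ - β : ℝ) : ℂ) *
      hc.toSchwartzMap (contDiff_div_of_ne_zero_on_tsupport (φ.smooth _) hg hne) ξ := by
    funext ξ
    show φ ξ = ((lambdaSq ξ - β : ℝ) : ℂ) * (φ ξ / ((lambdaSq ξ - β : ℝ) : ℂ))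
    by_cases h0 : ((lambdaSq ξ - β : ℝ) : ℂ) = 0
    · rw [h0, zero_mul]
      by_contra h3
      exact hne ξ (subset_tsupport _ h3) h0
    · rw [mul_div_cancel₀ _ h0]
  rw [h2]

end

end WassersteinFourier

end

theorem mainTheorem5 (d k : ℕ) (hd : 1 ≤ d) (hk : 1 ≤ k) :
    -- the value of `F^k_ξ`
    (∀ (ξ : WassersteinFourier.Mk d k) (m : WassersteinFourier.P2 d),
      WassersteinFourier.Fk ξ m = (k : ℂ)⁻¹ * ∏ j, WassersteinFourier.mHat m (ξ j)) ∧
    -- `F^k_ξ` is twice differentiable and an eigenfunction of `△_w`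
    (∀ (ξ : WassersteinFourier.Mk d k) (m : WassersteinFourier.P2 d),
      WassersteinFourier.CTwiceDifferentiableAt (WassersteinFourier.Fk ξ) m ∧
      WassersteinFourier.cLaplacian (WassersteinFourier.Fk ξ) m
        = -(WassersteinFourier.lambdaSq ξ : ℂ) * WassersteinFourier.Fk ξ m) ∧
    -- and of `△_{w,ε}`
    (∀ (ε : ℝ), 0 ≤ ε → ∀ (ξ : WassersteinFourier.Mk d k) (m : WassersteinFourier.P2 d),
      WassersteinFourier.cLaplacianEps ε (WassersteinFourier.Fk ξ) m
        = -((WassersteinFourier.lambdaSq ξ + 4 * Real.pi ^ 2 * ε * ∑ j, ‖ξ j‖ ^ 2 : ℝ) : ℂ)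
            * WassersteinFourier.Fk ξ m) ∧
    -- the functions `F^k_ξ` in the kernel of `△_w + β` are parametrized by the surface mod `P_k`
    (∀ ξ η : WassersteinFourier.Mk d k,
      WassersteinFourier.Fk ξ = WassersteinFourier.Fk η ↔
        ∃ σ : Equiv.Perm (Fin k), η = WassersteinFourier.permute σ ξ) ∧
    (∀ β : ℝ, 0 ≤ β →
      (∀ ξ : WassersteinFourier.Mk d k,
        WassersteinFourier.Fk ξ ∈ WassersteinFourier.laplacianKernel d β ↔
          ξ ∈ WassersteinFourier.conicSurface d k β) ∧
      -- the general `k`-polynomial `F_Φ` in the kernel of `△_w + β`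
      (∀ Φ : WassersteinFourier.Mk d k → ℂ, WassersteinFourier.IsSymC2 Φ →
        (WassersteinFourier.polyF Φ ∈ WassersteinFourier.laplacianKernel d β ↔
          WassersteinFourier.FourierAnnihilated β Φ) ∧
        (WassersteinFourier.polyF Φ ∈ WassersteinFourier.laplacianKernel d β →
          WassersteinFourier.FourierSupportedIn
            (WassersteinFourier.conicSurface d k β) Φ))) := by
  refine ⟨WassersteinFourier.Fk_eq_prod, fun ξ m =>
    ⟨(WassersteinFourier.isComplexC2Mod_symExp ξ).cTwiceDifferentiableAt_polyF m,
      WassersteinFourier.cLaplacian_Fk ξ m⟩,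
    fun ε _ ξ m => WassersteinFourier.cLaplacianEps_Fk ε ξ m, WassersteinFourier.Fk_eq_iff hk,
    fun β _ => ⟨WassersteinFourier.Fk_mem_laplacianKernel_iff hk β, fun Φ hΦ => ?_⟩⟩
  have h := (hΦ.polyF_mem_laplacianKernel_iff hk β).trans (hΦ.fourierAnnihilated_iff β).symm
  exact ⟨h, fun hmem => (h.1 hmem).fourierSupportedIn⟩
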